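/- **Setting.** Matrices are complex $3\times3$, $E_{jk}$ are matrix units, $P_{13},P_{12}$ are the permutation matrices interchanging $1\leftrightarrow3$, resp. $1\leftrightarrow2$, and $O(\cdot)$ for matrices is entrywise. All arcs are oriented, simple, of class $C^2$ and regular up to their endpoints; $F_\pm$ denote the boundary values from the left/right of an arc (limits in one-sided neighbourhoods of each interior point of the arc). *Regular two-edge regime (independent of $n$).* Let $x_0>0$, and let $L_\Gamma,L_\Delta$ be two arcs (conductors) joining the edges $0$ and $x_0$. For $\ast\in\{\Gamma,\Delta\}$ there are two further arcs joining $0$ and $x_0$ (the lips $\Sigma_\ast^{+},\Sigma_\ast^-$) and bounded open lens domains $\Omega_\ast^{\pm}$ with $\partial\Omega_\ast^\pm=L_\ast\cup\Sigma_\ast^\pm$, $\Omega_\ast^+$ on the left and $\Omega_\ast^-$ on the right of $L_\ast$; each lip has its lens domain on its left and the complement of the lens domain on its right. The six arcs meet only at $0$ and $x_0$; the four lens domains are pairwise disjoint and disjoint from the arcs. Let $\Sigma_S$ be the union of the six arcs. Let $U_0,U_{x_0}$ be open disks of positive radii $r_0,r_1$ around $0,x_0$ with $r_0+r_1<x_0$,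 such that each of the six arcs crosses each of the circles $\partial U_0,\partial U_{x_0}$ exactly once, transversally. The phases $\phi_\Gamma,\phi_\Delta$ are analytic in $\mathbb C\setminus(L_\Gamma\cup L_\Delta)$, $\operatorname{Re}\phi_\ast\to0$ from both sides at $L_\ast$ (endpoints excluded), and there is $c>0$ with $\operatorname{Re}\phi_\ast\ge c$ on $(\Sigma_\ast^+\cup\Sigma_\ast^-)\setminus(U_0\cup U_{x_0})$. Let $k_\Gamma=3$, $k_\Delta=2$ and $$J^{(u)}_\ast=I+\alpha_\ast^+e^{-n\phi_\ast}E_{1k_\ast},\qquad J^{(l)}_\ast=I+\alpha_\ast^-e^{-n\phi_\ast}E_{k_\ast1},$$ with functions $\alpha_\ast^\pm$ analytic in a neighbourhood of $\overline{\Omega_\ast^\pm}\setminus L_\ast$. *The unknown $T$.* $T=T_n$ is analytic off $L_\Gamma\cup L_\Delta$, $T(z)=I+O(1/z)$ as $z\to\infty$, and, on the conductors without their endpoints, $T$ has boundary values $T_\pm$, the boundary values of $J_\ast^{(u)}$ from the left and of $J_\ast^{(l)}$ from the right exist, and $$T_+=T_-\,(J_\Gamma^{(l)})_-\,P_{13}\,(J_\Gamma^{(u)})_+\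 \text{ on }L_\Gamma,\qquad T_+=T_-\,(J_\Delta^{(l)})_-\,P_{12}\,(J_\Delta^{(u)})_+\ \text{ on }L_\Delta .$$ *Lens opening.* $S=T(J_\ast^{(u)})^{-1}$ in $\Omega_\ast^+$, $S=TJ_\ast^{(l)}$ in $\Omega_\ast^-$, and $S=T$ elsewhere. Its jumps are $J_S=P_{13}$ on $L_\Gamma$, $P_{12}$ on $L_\Delta$, $(J_\ast^{(u)})^{-1}$ on $\Sigma_\ast^+$, $J_\ast^{(l)}$ on $\Sigma_\ast^-$. *Outer parametrix.* $N$ (independent of $n$) is analytic and invertible off $L_\Gamma\cup L_\Delta$, has invertible boundary values on the conductors (endpoints excluded) with $N_+=N_-P_{13}$ on $L_\Gamma$, $N_+=N_-P_{12}$ on $L_\Delta$, and $N(z)=I+O(1/z)$ as $z\to\infty$. *Local parametrices.* For $e\in\{0,x_0\}$, $P^{(e)}$ is analytic in $U_e\setminus\Sigma_S$, continuous and invertible on $\overline{U_e}\setminus\Sigma_S$, and, on the part of $\Sigma_S\setminus\{0,x_0\}$ in $\overline{U_e}$, has invertible boundary values (from within $U_e$) with $P^{(e)}_+=P^{(e)}_-J_S$.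 It matches $N$: $P^{(e)}N^{-1}=I+O(1/n)$ on $\partial U_e\setminus\Sigma_S$, in the sense that all entries of $P^{(e)}N^{-1}-I$ are bounded by $M/n$. Its singularity at $e$ is compatible with that of $S$: $S(z)P^{(e)}(z)^{-1}=o(|z-e|^{-1})$ as $z\to e$, $z\notin\Sigma_S$. *Error matrix.* $R=SP^{-1}$, where $P=P^{(0)}$ in $U_0$, $P=P^{(x_0)}$ in $U_{x_0}$ and $P=N$ elsewhere. **Corollary 7.2 (First coefficient at infinity).** Given a regular two-edge regime, an outer parametrix $N$ and a constant $M$, there are $C,\rho>0$ and $n_0\ge1$ such that for every $n\ge n_0$ and all $T,P^{(0)},P^{(x_0)}$ as above (for this $n$ and $M$) the error matrix has an expansion $$R(z)=I+\frac{R_1}{z}+O(z^{-2}),\qquad z\to\infty,\qquad\text{with}\qquad R_1=O(1/n);$$ precisely, there is a matrix $R_1$ (depending on $n$) with all entries bounded by $C/n$, and for $|z|\ge\rho$ all entries of $R(z)-I-R_1/z$ are bounded by $C|z|^{-2}$. -/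

import Mathlib

open Filter Topology Set Asymptotics

noncomputable section

namespace TwoEdge

/-- `3 × 3` complex matrices; the index `0, 1, 2 : Fin 3` stands for the index `1, 2, 3` of the
usual notation. -/
abbrev Mat3 := Matrix (Fin 3) (Fin 3) ℂ

/-- The permutation matrix interchanging the indices `1` and `3`. -/
def P13 : Mat3 := !![0, 0, 1; 0, 1, 0; 1, 0, 0]

/-- The permutation matrix interchanging the indices `1` and `2`. -/
def P12 : Mat3 := !![0, 1, 0; 1, 0, 0; 0, 0, 1]

/-- Entrywise analyticity on an open set. -/
def AnalyticMat (F : ℂ → Mat3) (D : Set ℂ) : Prop :=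
  ∀ i j, DifferentiableOn ℂ (fun z => F z i j) D

/-- The normalization `F(z) = I + O(1/z)` as `z → ∞`. -/
def NormalizedAtInfinity (F : ℂ → Mat3) : Prop :=
  ∀ i j, (fun z => (F z - 1) i j) =O[Bornology.cobounded ℂ] (fun z => z⁻¹)

/-! ### Oriented arcs and boundary values -/

/-- An oriented simple arc of class `C²`, regular up to its endpoints, parametrized by `[0,1]`. -/
structure Arc where
  toFun : ℝ → ℂ
  contDiff : ContDiff ℝ 2 toFun
  injOn : InjOn toFun (Icc 0 1)
  regular : ∀ t ∈ Icc (0 : ℝ) 1, deriv toFun t ≠ 0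

/-- The arc as a (closed) subset of the plane. -/
def Arc.carrier (γ : Arc) : Set ℂ := γ.toFun '' Icc 0 1

/-- The arc without its endpoints. -/
def Arc.openPart (γ : Arc) : Set ℂ := γ.toFun '' Ioo 0 1

/-- The arc connects the points `a` and `b`, in one of the two directions. -/
def Arc.Joins (γ : Arc) (a b : ℂ) : Prop :=
  (γ.toFun 0 = a ∧ γ.toFun 1 = b) ∨ (γ.toFun 0 = b ∧ γ.toFun 1 = a)

/-- The filter of one-sided neighbourhoods of `γ(t)` on the left of the oriented arc: the points
`γ(t') + i s γ'(t')` with `t'` close to `t` and `s > 0` close to `0`. -/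
def Arc.leftOf (γ : Arc) (t : ℝ) : Filter ℂ :=
  Filter.map (fun p : ℝ × ℝ => γ.toFun p.1 + (p.2 : ℂ) * Complex.I * deriv γ.toFun p.1)
    (𝓝 t ×ˢ 𝓝[>] (0 : ℝ))

/-- The filter of one-sided neighbourhoods of `γ(t)` on the right of the oriented arc. -/
def Arc.rightOf (γ : Arc) (t : ℝ) : Filter ℂ :=
  Filter.map (fun p : ℝ × ℝ => γ.toFun p.1 - (p.2 : ℂ) * Complex.I * deriv γ.toFun p.1)
    (𝓝 t ×ˢ 𝓝[>] (0 : ℝ))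

/-- The arc meets the circle `|z - c| = r` in exactly one point, and transversally. -/
def Arc.CrossesOnce (γ : Arc) (c : ℂ) (r : ℝ) : Prop :=
  (∃! t : ℝ, t ∈ Icc (0 : ℝ) 1 ∧ ‖γ.toFun t - c‖ = r) ∧
  ∀ t ∈ Icc (0 : ℝ) 1, ‖γ.toFun t - c‖ = r →
    ((starRingEnd ℂ) (γ.toFun t - c) * deriv γ.toFun t).re ≠ 0

/-- On the part of the arc in the closure of the domain `D`, the function `F`, restricted to `D`,
has (locally uniform) one-sided boundary values `F₊` from the left and `F₋` from the right;
these are invertible and satisfy `F₊ = F₋ J`. -/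
def HasJump (F : ℂ → Mat3) (D : Set ℂ) (γ : Arc) (J : ℂ → Mat3) : Prop :=
  ∀ t ∈ Ioo (0 : ℝ) 1, γ.toFun t ∈ closure D →
    ∃ Fp Fm : Mat3, Tendsto F (γ.leftOf t ⊓ 𝓟 D) (𝓝 Fp) ∧ Tendsto F (γ.rightOf t ⊓ 𝓟 D) (𝓝 Fm) ∧
      IsUnit Fp ∧ IsUnit Fm ∧ Fp = Fm * J (γ.toFun t)

/-! ### A conductor with its lens -/

/-- A conductor joining `a` and `b` together with its lens and its phase. The lens domain
`domUp` lies between the conductor and the lip `lipUp`, on the left of the conductor; `domLo`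
lies between the conductor and `lipLo`, on the right of it. Each lip carries the boundary
orientation of its lens domain, which therefore is on the left of the lip. -/
structure Lens (a b : ℂ) where
  arc : Arc
  lipUp : Arc
  lipLo : Arc
  domUp : Set ℂ
  domLo : Set ℂ
  /-- the phase function attached to the conductor -/
  phase : ℂ → ℂ
  /-- the coefficients of `exp (-n * phase)` in the two triangular factors of the jump -/
  ampUp : ℂ → ℂ
  ampLo : ℂ → ℂ
  arc_joins : arc.Joins a b
  lipUp_joins : lipUp.Joins a b
  lipLo_joins : lipLo.Joins a b
  isOpen_domUp : IsOpen domUp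
  isOpen_domLo : IsOpen domLo
  isBounded_domUp : Bornology.IsBounded domUp
  isBounded_domLo : Bornology.IsBounded domLo
  frontier_domUp : frontier domUp = arc.carrier ∪ lipUp.carrier
  frontier_domLo : frontier domLo = arc.carrier ∪ lipLo.carrier
  domUp_left_arc : ∀ t ∈ Ioo (0 : ℝ) 1, domUp ∈ arc.leftOf t
  domLo_right_arc : ∀ t ∈ Ioo (0 : ℝ) 1, domLo ∈ arc.rightOf t
  domUp_left_lip : ∀ t ∈ Ioo (0 : ℝ) 1, domUp ∈ lipUp.leftOf t ∧ domUpᶜ ∈ lipUp.rightOf t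
  domLo_left_lip : ∀ t ∈ Ioo (0 : ℝ) 1, domLo ∈ lipLo.leftOf t ∧ domLoᶜ ∈ lipLo.rightOf t
  /-- the real part of the phase vanishes on both sides of the conductor -/
  phase_re_left : ∀ t ∈ Ioo (0 : ℝ) 1, Tendsto (fun z => (phase z).re) (arc.leftOf t) (𝓝 0)
  phase_re_right : ∀ t ∈ Ioo (0 : ℝ) 1, Tendsto (fun z => (phase z).re) (arc.rightOf t) (𝓝 0)
  ampUp_analytic : AnalyticOnNhd ℂ ampUp (closure domUp \ arc.carrier)
  ampLo_analytic : AnalyticOnNhd ℂ ampLo (closure domLo \ arc.carrier)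

namespace Lens

variable {a b : ℂ}

/-- The union of the conductor and its two lips. -/
def contour (L : Lens a b) : Set ℂ := L.arc.carrier ∪ L.lipUp.carrier ∪ L.lipLo.carrier

/-- The upper triangular factor `J⁽ᵘ⁾ = I + α₊ e^{-nφ} E_{1k}` of the channel `(1,k)`. -/
def upper (L : Lens a b) (k : Fin 3) (n : ℕ) (z : ℂ) : Mat3 :=
  1 + Matrix.single 0 k (L.ampUp z * Complex.exp (-(n : ℂ) * L.phase z))

/-- The lower triangular factor `J⁽ˡ⁾ = I + α₋ e^{-nφ} E_{k1}` of the channel `(1,k)`. It is used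
on the right side of the conductor; when `φ₋ = -φ₊` on the conductor, its boundary value there
carries `e^{+nφ₊}`. -/
def lower (L : Lens a b) (k : Fin 3) (n : ℕ) (z : ℂ) : Mat3 :=
  1 + Matrix.single k 0 (L.ampLo z * Complex.exp (-(n : ℂ) * L.phase z))

/-- On the conductor, `T` has boundary values with `T₊ = T₋ J_T`, where `J_T = J⁽ˡ⁾ J⁽⁰⁾ J⁽ᵘ⁾`,
the factors `J⁽ᵘ⁾` and `J⁽ˡ⁾` being taken at the left and the right side, respectively. -/
def FactorizedJump (L : Lens a b) (k : Fin 3) (J0 : Mat3) (n : ℕ) (T : ℂ → Mat3) : Prop :=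
  ∀ t ∈ Ioo (0 : ℝ) 1, ∃ Tp Tm Ju Jl : Mat3,
    Tendsto T (L.arc.leftOf t) (𝓝 Tp) ∧ Tendsto T (L.arc.rightOf t) (𝓝 Tm) ∧
    Tendsto (L.upper k n) (L.arc.leftOf t) (𝓝 Ju) ∧
    Tendsto (L.lower k n) (L.arc.rightOf t) (𝓝 Jl) ∧
    Tp = Tm * (Jl * J0 * Ju)

/-- `F` has in `D` the jumps of the post-lens unknown `S`: the reduced jump `J0` on the conductor
and the triangular ones on the lips. -/
def HasLensJumps (L : Lens a b) (k : Fin 3) (J0 : Mat3) (n : ℕ) (F : ℂ → Mat3) (D : Set ℂ) :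
    Prop :=
  HasJump F D L.arc (fun _ => J0) ∧
  HasJump F D L.lipUp (fun z => (L.upper k n z)⁻¹) ∧
  HasJump F D L.lipLo (L.lower k n)

end Lens

/-! ### The regular two-edge regime -/

/-- The data, independent of `n`, of a regular two-edge regime with edges `0` and `x₀ > 0`: the
two conductors `Γ` (channel `(1,3)`) and `Δ` (channel `(1,2)`) with lenses and phases, the two
endpoint disks, and the constant of the sign chart. -/
structure Regime where
  x₀ : ℝ
  x₀_pos : 0 < x₀
  Γ : Lens 0 (x₀ : ℂ)
  Δ : Lens 0 (x₀ : ℂ)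
  /-- radii of the endpoint disks around `0` and `x₀` -/
  r₀ : ℝ
  r₁ : ℝ
  r₀_pos : 0 < r₀
  r₁_pos : 0 < r₁
  disks_disjoint : r₀ + r₁ < x₀
  /-- the six arcs meet at `0` and `x₀` only -/
  arcs_disjoint :
    [Γ.arc, Γ.lipUp, Γ.lipLo, Δ.arc, Δ.lipUp, Δ.lipLo].Pairwise
      (fun γ δ => Disjoint γ.openPart δ.openPart)
  domains_disjoint : [Γ.domUp, Γ.domLo, Δ.domUp, Δ.domLo].Pairwise Disjoint
  domains_off_contour :
    ∀ Ω ∈ [Γ.domUp, Γ.domLo, Δ.domUp, Δ.domLo], Disjoint Ω (Γ.contour ∪ Δ.contour)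
  crosses_disks :
    ∀ γ ∈ [Γ.arc, Γ.lipUp, Γ.lipLo, Δ.arc, Δ.lipUp, Δ.lipLo],
      γ.CrossesOnce 0 r₀ ∧ γ.CrossesOnce (x₀ : ℂ) r₁
  phaseΓ_analytic : DifferentiableOn ℂ Γ.phase (Γ.arc.carrier ∪ Δ.arc.carrier)ᶜ
  phaseΔ_analytic : DifferentiableOn ℂ Δ.phase (Γ.arc.carrier ∪ Δ.arc.carrier)ᶜ
  /-- sign chart on the lens lips, outside the endpoint disks -/
  c : ℝ
  c_pos : 0 < c
  signΓ : ∀ z ∈ (Γ.lipUp.carrier ∪ Γ.lipLo.carrier) \ (Metric.ball 0 r₀ ∪ Metric.ball (x₀ : ℂ) r₁),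
    c ≤ (Γ.phase z).re
  signΔ : ∀ z ∈ (Δ.lipUp.carrier ∪ Δ.lipLo.carrier) \ (Metric.ball 0 r₀ ∪ Metric.ball (x₀ : ℂ) r₁),
    c ≤ (Δ.phase z).re

namespace Regime

/-- The union of the two conductors. -/
def conductors (D : Regime) : Set ℂ := D.Γ.arc.carrier ∪ D.Δ.arc.carrier

/-- The post-lens contour: conductors and lens lips. -/
def contourS (D : Regime) : Set ℂ := D.Γ.contour ∪ D.Δ.contour

/-- The endpoint disk around the hard edge `0`. -/
def U0 (D : Regime) : Set ℂ := Metric.ball 0 D.r₀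

/-- The endpoint disk around the soft edge `x₀`. -/
def U1 (D : Regime) : Set ℂ := Metric.ball (D.x₀ : ℂ) D.r₁

/-- `T` solves the `g`-normalized Riemann-Hilbert problem with parameter `n`. -/
structure IsT (D : Regime) (n : ℕ) (T : ℂ → Mat3) : Prop where
  analytic : AnalyticMat T D.conductorsᶜ
  jumpΓ : D.Γ.FactorizedJump 2 P13 n T
  jumpΔ : D.Δ.FactorizedJump 1 P12 n T
  infinity : NormalizedAtInfinity T

open Classical in
/-- The lens opening `T ↦ S`. -/
def lensOpening (D : Regime) (n : ℕ) (T : ℂ → Mat3) (z : ℂ) : Mat3 :=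
  if z ∈ D.Γ.domUp then T z * (D.Γ.upper 2 n z)⁻¹
  else if z ∈ D.Γ.domLo then T z * D.Γ.lower 2 n z
  else if z ∈ D.Δ.domUp then T z * (D.Δ.upper 1 n z)⁻¹
  else if z ∈ D.Δ.domLo then T z * D.Δ.lower 1 n z
  else T z

/-- `N` is an outer parametrix: an (invertible) solution of the reduced Riemann-Hilbert problem
with permutation jumps on the conductors. -/
structure IsOuter (D : Regime) (N : ℂ → Mat3) : Prop where
  analytic : AnalyticMat N D.conductorsᶜ
  invertible : ∀ z ∈ D.conductorsᶜ, IsUnit (N z)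
  jumpΓ : HasJump N univ D.Γ.arc (fun _ => P13)
  jumpΔ : HasJump N univ D.Δ.arc (fun _ => P12)
  infinity : NormalizedAtInfinity N

/-- `P` is a local parametrix in the disk `|z - e| < r` around the edge `e`: an invertible matrix
function with exactly the jumps of `S` in the disk, matching the outer parametrix up to `M / n`
on the circle, whose singularity at `e` is compatible with that of `S` (so that `S P⁻¹` has less
than a simple pole there). -/
structure IsLocal (D : Regime) (N : ℂ → Mat3) (n : ℕ) (T : ℂ → Mat3) (M : ℝ) (e : ℂ) (r : ℝ)
    (P : ℂ → Mat3) : Prop where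
  analytic : AnalyticMat P (Metric.ball e r \ D.contourS)
  continuous_boundary : ContinuousOn P (Metric.closedBall e r \ D.contourS)
  invertible : ∀ z ∈ Metric.closedBall e r \ D.contourS, IsUnit (P z)
  jumpsΓ : D.Γ.HasLensJumps 2 P13 n P (Metric.ball e r)
  jumpsΔ : D.Δ.HasLensJumps 1 P12 n P (Metric.ball e r)
  matching : ∀ z ∈ Metric.sphere e r \ D.contourS, ∀ i j,
    ‖(P z * (N z)⁻¹ - 1) i j‖ ≤ M / n
  edge : ∀ i j, (fun z => (D.lensOpening n T z * (P z)⁻¹) i j) =o[𝓝[D.contourSᶜ] e]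
    (fun z => (z - e)⁻¹)

open Classical in
/-- The global parametrix: `P0` and `P1` in the endpoint disks, `N` elsewhere. -/
def globalParametrix (D : Regime) (N P0 P1 : ℂ → Mat3) (z : ℂ) : Mat3 :=
  if z ∈ D.U0 then P0 z else if z ∈ D.U1 then P1 z else N z

/-- The error matrix `R = S P⁻¹`. -/
def errorMatrix (D : Regime) (n : ℕ) (T N P0 P1 : ℂ → Mat3) (z : ℂ) : Mat3 :=
  D.lensOpening n T z * (D.globalParametrix N P0 P1 z)⁻¹

end Regime

end TwoEdge

end

/-!
The error matrix `R` is close to the identity because it is analytic across everything except two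
circles and some exponentially small jumps; the expansion at infinity is then read off from its
Laurent series. No contour integral along the arcs of the problem is needed.

*Inside an endpoint disk*, `S P⁻¹` is continuous across the open arcs, hence analytic there by
Painlevé's theorem (`differentiableOn_of_lipschitz_arcs`): a Lipschitz arc is removable for
continuous functions. At the edge itself `S P⁻¹` is less singular than a simple pole, so that the
edge is removable too (`Regime.exists_inner_extension`).

*Outside the disks*, the jumps on the lips are smoothed. Writing `S = T (1 - Y)` with `Y` nilpotent,
choose a cutoff `χ` that equals `1` near the lips outside the disks and is supported where `Y` is
exponentially small, and put `H = S N⁻¹ (1 + χ Q)` with `Q = N Y N⁻¹`. The lens is then not opened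
at all near these lips, and `H` has no jump there; instead `∂̄H = H W` with the small, smooth,
compactly supported coefficient `W = ∂̄χ Q`. Inside the disks, where the equation plays no role, a
second cutoff `θ` keeps `W` smooth across the lips. The equation `∂̄V = -W V` is solved by a Neumann
series of solid Cauchy transforms, with `V - 1 = O(1/n)` (`exists_wirtinger_solution`), and
`B = H V` is analytic outside the disks, again by Painlevé's theorem on the conductors
(`Regime.exists_outer_extension`).

*On the two circles* the matching of the parametrices gives `B - S P⁻¹ = O(1/n) S P⁻¹`. As no bound
on `S P⁻¹` is known beforehand, it is obtained together with that on `B`: functions analytic inside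
the circles are orthogonal in `L²` to those analytic outside, so that the jumps control both sides
(`exists_norm_sub_le_of_small_jumps`). Hence `B - 1 = O(1/n)`, and `R = B V⁻¹` near infinity; two
applications of the Schwarz lemma in `1 / z` bound the first coefficient and the remainder
(`exists_laurent_coefficient`).
-/

open scoped Interval

/-! ### Painlevé's theorem: a rectifiable arc is removable for continuous functions -/

section Painleve

variable {E : Type*} [NormedAddCommGroup E] [NormedSpace ℂ E]

/-- The integral of `f` over the boundary of the rectangle `[x₀, x₁] × [y₀, y₁]`, in the form used
by Mathlib's Cauchy–Goursat theorem. -/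
noncomputable def rectIntegral (f : ℂ → E) (x₀ x₁ y₀ y₁ : ℝ) : E :=
  (∫ x : ℝ in x₀..x₁, f (x + y₀ * Complex.I)) - (∫ x : ℝ in x₀..x₁, f (x + y₁ * Complex.I)) +
    Complex.I • (∫ y : ℝ in y₀..y₁, f (x₁ + y * Complex.I)) -
    Complex.I • (∫ y : ℝ in y₀..y₁, f (x₀ + y * Complex.I))

theorem mem_reProdIm_line_re {x₀ x₁ y₀ y₁ x y : ℝ} (hx : x ∈ [[x₀, x₁]]) (hy : y ∈ [[y₀, y₁]]) :
    ((x : ℂ) + y * Complex.I) ∈ [[x₀, x₁]] ×ℂ [[y₀, y₁]] := by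
  simp [Complex.mem_reProdIm, hx, hy]

theorem intervalIntegrable_horizontal {F : Type*} [NormedAddCommGroup F] {f : ℂ → F}
    {x₀ x₁ y₀ y₁ a b y : ℝ}
    (hf : ContinuousOn f ([[x₀, x₁]] ×ℂ [[y₀, y₁]])) (ha : a ∈ [[x₀, x₁]]) (hb : b ∈ [[x₀, x₁]])
    (hy : y ∈ [[y₀, y₁]]) :
    IntervalIntegrable (fun x : ℝ => f (x + y * Complex.I)) MeasureTheory.volume a b := by
  apply ContinuousOn.intervalIntegrable
  refine hf.comp (by fun_prop) fun x hx => mem_reProdIm_line_re (uIcc_subset_uIcc ha hb hx) hy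

theorem intervalIntegrable_vertical {F : Type*} [NormedAddCommGroup F] {f : ℂ → F}
    {x₀ x₁ y₀ y₁ a b x : ℝ}
    (hf : ContinuousOn f ([[x₀, x₁]] ×ℂ [[y₀, y₁]])) (ha : a ∈ [[y₀, y₁]]) (hb : b ∈ [[y₀, y₁]])
    (hx : x ∈ [[x₀, x₁]]) :
    IntervalIntegrable (fun y : ℝ => f (x + y * Complex.I)) MeasureTheory.volume a b := by
  apply ContinuousOn.intervalIntegrable
  refine hf.comp (by fun_prop) fun y hy => mem_reProdIm_line_re hx (uIcc_subset_uIcc ha hb hy)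

theorem norm_rectIntegral_le {g : ℂ → E} {x₀ x₁ y₀ y₁ ε : ℝ}
    (h : ∀ z ∈ [[x₀, x₁]] ×ℂ [[y₀, y₁]], ‖g z‖ ≤ ε) :
    ‖rectIntegral g x₀ x₁ y₀ y₁‖ ≤ 2 * ε * (|x₁ - x₀| + |y₁ - y₀|) := by
  have h1 : ∀ y ∈ [[y₀, y₁]], ‖∫ x : ℝ in x₀..x₁, g (x + y * Complex.I)‖ ≤ ε * |x₁ - x₀| :=
    fun y hy => intervalIntegral.norm_integral_le_of_norm_le_const fun x hx =>
      h _ (mem_reProdIm_line_re (uIoc_subset_uIcc hx) hy)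
  have h2 : ∀ x ∈ [[x₀, x₁]], ‖∫ y : ℝ in y₀..y₁, g (x + y * Complex.I)‖ ≤ ε * |y₁ - y₀| :=
    fun x hx => intervalIntegral.norm_integral_le_of_norm_le_const fun y hy =>
      h _ (mem_reProdIm_line_re hx (uIoc_subset_uIcc hy))
  unfold rectIntegral
  refine (norm_sub_le _ _).trans ?_
  refine (add_le_add_left (norm_add_le _ _) _).trans ?_
  refine (add_le_add_left (add_le_add_left (norm_sub_le _ _) _) _).trans ?_
  rw [norm_smul, norm_smul, Complex.norm_I, one_mul, one_mul]
  linarith [h1 y₀ left_mem_uIcc, h1 y₁ right_mem_uIcc, h2 x₀ left_mem_uIcc, h2 x₁ right_mem_uIcc]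

theorem rectIntegral_sub_const [CompleteSpace E] {f : ℂ → E} {x₀ x₁ y₀ y₁ : ℝ}
    (hf : ContinuousOn f ([[x₀, x₁]] ×ℂ [[y₀, y₁]])) (c : E) :
    rectIntegral (fun z => f z - c) x₀ x₁ y₀ y₁ = rectIntegral f x₀ x₁ y₀ y₁ := by
  have H : ∀ y ∈ [[y₀, y₁]], (∫ x : ℝ in x₀..x₁, (f (x + y * Complex.I) - c)) =
      (∫ x : ℝ in x₀..x₁, f (x + y * Complex.I)) - ∫ _ in x₀..x₁, c := fun y hy =>
    intervalIntegral.integral_sub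
      (intervalIntegrable_horizontal hf left_mem_uIcc right_mem_uIcc hy) (by simp)
  have V : ∀ x ∈ [[x₀, x₁]], (∫ y : ℝ in y₀..y₁, (f (x + y * Complex.I) - c)) =
      (∫ y : ℝ in y₀..y₁, f (x + y * Complex.I)) - ∫ _ in y₀..y₁, c := fun x hx =>
    intervalIntegral.integral_sub
      (intervalIntegrable_vertical hf left_mem_uIcc right_mem_uIcc hx) (by simp)
  unfold rectIntegral
  rw [H _ left_mem_uIcc, H _ right_mem_uIcc, V _ left_mem_uIcc, V _ right_mem_uIcc]
  simp only [smul_sub]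
  abel

/-- The nodes of the subdivision of `[x₀, x₁]` into `m` equal parts. -/
noncomputable def gridNode (x₀ x₁ : ℝ) (m : ℕ) (i : ℕ) : ℝ := x₀ + i * ((x₁ - x₀) / m)

theorem gridNode_zero (x₀ x₁ : ℝ) (m : ℕ) : gridNode x₀ x₁ m 0 = x₀ := by simp [gridNode]

theorem gridNode_last (x₀ x₁ : ℝ) {m : ℕ} (hm : 0 < m) : gridNode x₀ x₁ m m = x₁ := by
  have : (m : ℝ) ≠ 0 := by positivity
  simp only [gridNode]; field_simp; ring

theorem gridNode_succ_sub (x₀ x₁ : ℝ) (m i : ℕ) :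
    gridNode x₀ x₁ m (i + 1) - gridNode x₀ x₁ m i = (x₁ - x₀) / m := by
  simp only [gridNode]; push_cast; ring

theorem gridNode_mem (x₀ x₁ : ℝ) {m i : ℕ} (hm : 0 < m) (hi : i ≤ m) :
    gridNode x₀ x₁ m i ∈ [[x₀, x₁]] := by
  have hm' : (0 : ℝ) < m := by positivity
  have hi' : (i : ℝ) ≤ m := by exact_mod_cast hi
  rw [← segment_eq_uIcc]
  refine ⟨1 - i / m, i / m, ?_, by positivity, by ring, ?_⟩
  · rw [sub_nonneg, div_le_one hm']; exact hi'
  · simp only [gridNode, smul_eq_mul]; ring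

theorem sum_rectIntegral_grid {f : ℂ → E} {x₀ x₁ y₀ y₁ : ℝ}
    (hf : ContinuousOn f ([[x₀, x₁]] ×ℂ [[y₀, y₁]])) {m : ℕ} (hm : 0 < m) :
    rectIntegral f x₀ x₁ y₀ y₁ = ∑ i ∈ Finset.range m, ∑ j ∈ Finset.range m,
      rectIntegral f (gridNode x₀ x₁ m i) (gridNode x₀ x₁ m (i + 1))
        (gridNode y₀ y₁ m j) (gridNode y₀ y₁ m (j + 1)) := by
  set X := gridNode x₀ x₁ m
  set Y := gridNode y₀ y₁ m
  have hX : ∀ i ≤ m, X i ∈ [[x₀, x₁]] := fun i hi => gridNode_mem x₀ x₁ hm hi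
  have hY : ∀ i ≤ m, Y i ∈ [[y₀, y₁]] := fun i hi => gridNode_mem y₀ y₁ hm hi
  have H : ∀ y ∈ [[y₀, y₁]], ∑ i ∈ Finset.range m, ∫ x in X i..X (i + 1), f (x + y * Complex.I) =
      ∫ x : ℝ in x₀..x₁, f (x + y * Complex.I) := fun y hy => by
    rw [intervalIntegral.sum_integral_adjacent_intervals fun k hk =>
      intervalIntegrable_horizontal hf (hX k hk.le) (hX (k + 1) hk) hy]
    simp only [X, gridNode_zero, gridNode_last _ _ hm]
  have V : ∀ x ∈ [[x₀, x₁]], ∑ j ∈ Finset.range m, ∫ y in Y j..Y (j + 1), f (x + y * Complex.I) =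
      ∫ y : ℝ in y₀..y₁, f (x + y * Complex.I) := fun x hx => by
    rw [intervalIntegral.sum_integral_adjacent_intervals fun k hk =>
      intervalIntegrable_vertical hf (hY k hk.le) (hY (k + 1) hk) hx]
    simp only [Y, gridNode_zero, gridNode_last _ _ hm]
  have hsum : ∀ i j, rectIntegral f (X i) (X (i + 1)) (Y j) (Y (j + 1)) =
      ((∫ x in X i..X (i + 1), f (x + Y j * Complex.I)) -
        ∫ x in X i..X (i + 1), f (x + Y (j + 1) * Complex.I)) +
      Complex.I • ((∫ y in Y j..Y (j + 1), f (X (i + 1) + y * Complex.I)) -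
        ∫ y in Y j..Y (j + 1), f (X i + y * Complex.I)) := fun i j => by
    simp only [rectIntegral, smul_sub]; abel
  simp only [hsum, Finset.sum_add_distrib]
  have e1 : ∑ i ∈ Finset.range m, ∑ j ∈ Finset.range m,
      ((∫ x in X i..X (i + 1), f (x + Y j * Complex.I)) -
        ∫ x in X i..X (i + 1), f (x + Y (j + 1) * Complex.I)) =
      (∫ x : ℝ in x₀..x₁, f (x + y₀ * Complex.I)) - ∫ x : ℝ in x₀..x₁, f (x + y₁ * Complex.I) := by
    rw [← H _ left_mem_uIcc, ← H _ right_mem_uIcc, ← Finset.sum_sub_distrib]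
    refine Finset.sum_congr rfl fun i _ => ?_
    rw [Finset.sum_range_sub' (fun j => ∫ x in X i..X (i + 1), f (x + Y j * Complex.I))]
    simp only [Y, gridNode_zero, gridNode_last _ _ hm]
  have e2 : ∑ i ∈ Finset.range m, ∑ j ∈ Finset.range m,
      Complex.I • ((∫ y in Y j..Y (j + 1), f (X (i + 1) + y * Complex.I)) -
        ∫ y in Y j..Y (j + 1), f (X i + y * Complex.I)) =
      Complex.I • ((∫ y : ℝ in y₀..y₁, f (x₁ + y * Complex.I)) -
        ∫ y : ℝ in y₀..y₁, f (x₀ + y * Complex.I)) := by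
    rw [Finset.sum_comm, ← V _ left_mem_uIcc, ← V _ right_mem_uIcc, ← Finset.sum_sub_distrib,
      Finset.smul_sum]
    refine Finset.sum_congr rfl fun j _ => ?_
    rw [← Finset.smul_sum,
      Finset.sum_range_sub (fun i => ∫ y in Y j..Y (j + 1), f (X i + y * Complex.I))]
    simp only [X, gridNode_zero, gridNode_last _ _ hm]
  rw [e1, e2]
  simp only [rectIntegral, smul_sub]; abel

theorem card_le_of_forall_dist_le {s : Finset ℕ} {N : ℕ} (h : ∀ i ∈ s, ∀ j ∈ s, i ≤ j + N) :
    s.card ≤ N + 1 := by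
  rcases s.eq_empty_or_nonempty with rfl | hs
  · simp
  · have : s ⊆ Finset.Icc (s.min' hs) (s.min' hs + N) := fun i hi =>
      Finset.mem_Icc.2 ⟨s.min'_le i hi, h i hi _ (s.min'_mem hs)⟩
    refine (Finset.card_le_card this).trans ?_
    simp [Nat.card_Icc]; omega

theorem abs_sub_le_of_mem_gridCell {x₀ x₁ u : ℝ} {m i : ℕ}
    (hu : u ∈ [[gridNode x₀ x₁ m i, gridNode x₀ x₁ m (i + 1)]]) :
    |u - gridNode x₀ x₁ m i| ≤ |x₁ - x₀| / m := by
  have := abs_sub_left_of_mem_uIcc hu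
  rwa [gridNode_succ_sub, abs_div, Nat.abs_cast] at this

/-- Grid cells whose abscissae (or ordinates) contain points at distance at most `K / m` have
indices that differ by a number independent of the mesh. -/
theorem gridIndex_le {x₀ x₁ K u v : ℝ} (hx : x₀ ≠ x₁) {m : ℕ} (hm : 0 < m) {i j N : ℕ}
    (hN : 2 + K / |x₁ - x₀| ≤ N)
    (hu : u ∈ [[gridNode x₀ x₁ m i, gridNode x₀ x₁ m (i + 1)]])
    (hv : v ∈ [[gridNode x₀ x₁ m j, gridNode x₀ x₁ m (j + 1)]]) (huv : |u - v| ≤ K / m) :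
    i ≤ j + N := by
  have hm' : (0 : ℝ) < m := by positivity
  have ha : 0 < |x₁ - x₀| := abs_pos.2 (sub_ne_zero.2 hx.symm)
  have h1 := abs_sub_le_of_mem_gridCell hu
  have h2 := abs_sub_le_of_mem_gridCell hv
  have h3 : |gridNode x₀ x₁ m i - gridNode x₀ x₁ m j| ≤ (2 * |x₁ - x₀| + K) / m := by
    have e : gridNode x₀ x₁ m i - gridNode x₀ x₁ m j =
      -(u - gridNode x₀ x₁ m i) + (u - v) + (v - gridNode x₀ x₁ m j) := by ring
    rw [e]
    refine (abs_add_le _ _).trans ?_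
    refine (add_le_add_left (abs_add_le _ _) _).trans ?_
    rw [abs_neg]
    have : (2 * |x₁ - x₀| + K) / m = |x₁ - x₀| / m + K / m + |x₁ - x₀| / m := by ring
    linarith
  have h4 : gridNode x₀ x₁ m i - gridNode x₀ x₁ m j = ((i : ℝ) - j) * ((x₁ - x₀) / m) := by
    simp only [gridNode]; ring
  rw [h4, abs_mul, abs_div, Nat.abs_cast, ← mul_div_assoc, div_le_div_iff_of_pos_right hm'] at h3
  have h5 : |(i : ℝ) - j| ≤ 2 + K / |x₁ - x₀| := by
    rwa [← le_div_iff₀ ha, add_div, mul_div_cancel_right₀ _ ha.ne'] at h3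
  have h6 : (i : ℝ) ≤ j + N := by linarith [le_abs_self ((i : ℝ) - j)]
  exact_mod_cast h6

theorem rectIntegral_eq_zero_of_lipschitz_arc [CompleteSpace E] {γ : ℝ → ℂ} {K : NNReal}
    (hγ : LipschitzOnWith K γ (Icc 0 1)) {f : ℂ → E} {x₀ x₁ y₀ y₁ : ℝ} {U : Set ℂ}
    (hUr : [[x₀, x₁]] ×ℂ [[y₀, y₁]] ⊆ U) (hf : ContinuousOn f U)
    (hd : DifferentiableOn ℂ f (U \ γ '' Icc 0 1)) :
    rectIntegral f x₀ x₁ y₀ y₁ = 0 := by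
  rcases eq_or_ne x₀ x₁ with rfl | hx
  · simp [rectIntegral]
  rcases eq_or_ne y₀ y₁ with rfl | hy
  · simp [rectIntegral]
  have hcA : IsClosed (γ '' Icc 0 1) := (isCompact_Icc.image_of_continuousOn hγ.continuousOn).isClosed
  have hfR := hf.mono hUr
  have hcomp : IsCompact ([[x₀, x₁]] ×ℂ [[y₀, y₁]]) := isCompact_uIcc.reProdIm isCompact_uIcc
  have huc := hcomp.uniformContinuousOn_of_continuous hfR
  rw [Metric.uniformContinuousOn_iff] at huc
  obtain ⟨N₁, hN₁⟩ := exists_nat_ge (2 + (K : ℝ) / |x₁ - x₀|)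
  obtain ⟨N₂, hN₂⟩ := exists_nat_ge (2 + (K : ℝ) / |y₁ - y₀|)
  set a := |x₁ - x₀|
  set b := |y₁ - y₀|
  have hab : 0 ≤ a + b := by positivity
  set B : ℝ := (N₁ + 1) * (N₂ + 1) * (2 * (a + b)) with hB
  have key : ∀ ε > 0, ‖rectIntegral f x₀ x₁ y₀ y₁‖ ≤ B * ε := by
    intro ε hε
    obtain ⟨δ, hδ, hfδ⟩ := huc ε hε
    obtain ⟨m, hm⟩ := exists_nat_gt (max 0 ((a + b) / δ))
    have hm0 : (0 : ℝ) < m := (le_max_left _ _).trans_lt hm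
    have hmpos : 0 < m := by exact_mod_cast hm0
    have hmesh : (a + b) / m < δ := by
      have := (le_max_right _ _).trans_lt hm
      rw [div_lt_iff₀ hδ] at this
      rw [div_lt_iff₀ hm0]; linarith
    set X := gridNode x₀ x₁ m
    set Y := gridNode y₀ y₁ m
    set cell : ℕ → ℕ → Set ℂ := fun i j => [[X i, X (i + 1)]] ×ℂ [[Y j, Y (j + 1)]]
    have hcell : ∀ i < m, ∀ j < m, cell i j ⊆ [[x₀, x₁]] ×ℂ [[y₀, y₁]] := fun i hi j hj z hz =>
      ⟨uIcc_subset_uIcc (gridNode_mem _ _ hmpos hi.le) (gridNode_mem _ _ hmpos hi) hz.1,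
        uIcc_subset_uIcc (gridNode_mem _ _ hmpos hj.le) (gridNode_mem _ _ hmpos hj) hz.2⟩
    classical
    -- cells met by the `k`-th of `m` pieces of the arc
    let I : ℕ → Finset ℕ := fun k => (Finset.range m).filter fun i =>
      ∃ t ∈ Icc (0 : ℝ) 1, k ≤ t * m ∧ t * m ≤ k + 1 ∧
        (γ t).re ∈ [[X i, X (i + 1)]]
    let J : ℕ → Finset ℕ := fun k => (Finset.range m).filter fun j =>
      ∃ t ∈ Icc (0 : ℝ) 1, k ≤ t * m ∧ t * m ≤ k + 1 ∧
        (γ t).im ∈ [[Y j, Y (j + 1)]]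
    have hdist : ∀ (k : ℕ) (t s : ℝ), t ∈ Icc (0 : ℝ) 1 → s ∈ Icc (0 : ℝ) 1 → k ≤ t * m →
        t * m ≤ k + 1 → k ≤ s * m → s * m ≤ k + 1 → ‖γ t - γ s‖ ≤ K / m := by
      intro k t s ht hs h1 h2 h3 h4
      have := hγ.dist_le_mul t ht s hs
      rw [dist_eq_norm] at this
      refine this.trans ?_
      rw [div_eq_mul_inv]
      refine mul_le_mul_of_nonneg_left ?_ K.2
      have e : |t - s| * m = |t * m - s * m| := by rw [← sub_mul, abs_mul, Nat.abs_cast]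
      rw [Real.dist_eq, ← one_div, le_div_iff₀ hm0, e, abs_le]
      constructor <;> linarith
    have hI : ∀ k, (I k).card ≤ N₁ + 1 := by
      intro k
      refine card_le_of_forall_dist_le fun i hi j hj => ?_
      obtain ⟨-, t, ht, h1, h2, h3⟩ := Finset.mem_filter.1 hi
      obtain ⟨-, s, hs, g1, g2, g3⟩ := Finset.mem_filter.1 hj
      refine gridIndex_le hx hmpos hN₁ h3 g3 ?_
      rw [← Complex.sub_re]
      exact (Complex.abs_re_le_norm _).trans (hdist k t s ht hs h1 h2 g1 g2)
    have hJ : ∀ k, (J k).card ≤ N₂ + 1 := by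
      intro k
      refine card_le_of_forall_dist_le fun i hi j hj => ?_
      obtain ⟨-, t, ht, h1, h2, h3⟩ := Finset.mem_filter.1 hi
      obtain ⟨-, s, hs, g1, g2, g3⟩ := Finset.mem_filter.1 hj
      refine gridIndex_le hy hmpos hN₂ h3 g3 ?_
      rw [← Complex.sub_im]
      exact (Complex.abs_im_le_norm _).trans (hdist k t s ht hs h1 h2 g1 g2)
    set bad : Finset (ℕ × ℕ) := (Finset.range m).biUnion fun k => I k ×ˢ J k
    have hbad : (bad.card : ℝ) ≤ m * ((N₁ + 1) * (N₂ + 1)) := by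
      have : bad.card ≤ m * ((N₁ + 1) * (N₂ + 1)) := by
        refine Finset.card_biUnion_le.trans ?_
        refine (Finset.sum_le_card_nsmul _ _ ((N₁ + 1) * (N₂ + 1)) fun k _ => ?_).trans (by simp)
        rw [Finset.card_product]
        exact Nat.mul_le_mul (hI k) (hJ k)
      exact_mod_cast this
    have hgood : ∀ p ∈ Finset.range m ×ˢ Finset.range m, p ∉ bad →
        rectIntegral f (X p.1) (X (p.1 + 1)) (Y p.2) (Y (p.2 + 1)) = 0 := by
      rintro ⟨i, j⟩ hp hpb
      rw [Finset.mem_product, Finset.mem_range, Finset.mem_range] at hp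
      have hoff : ∀ z ∈ cell i j, z ∉ γ '' Icc 0 1 := by
        rintro z hz ⟨t, ht, rfl⟩
        apply hpb
        obtain ⟨k, hk, hk1, hk2⟩ : ∃ k < m, (k : ℝ) ≤ t * m ∧ t * m ≤ k + 1 := by
          rcases eq_or_lt_of_le ht.2 with rfl | h1
          · refine ⟨m - 1, by omega, ?_, ?_⟩ <;> push_cast [Nat.cast_sub hmpos] <;> linarith
          · refine ⟨⌊t * m⌋₊, ?_, Nat.floor_le (by have := ht.1; positivity),
              (Nat.lt_floor_add_one _).le⟩
            rw [Nat.floor_lt (by have := ht.1; positivity)]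
            nlinarith
        simp only [bad, Finset.mem_biUnion, Finset.mem_range, Finset.mem_product, I, J,
          Finset.mem_filter]
        exact ⟨k, hk, ⟨hp.1, t, ht, hk1, hk2, hz.1⟩, ⟨hp.2, t, ht, hk1, hk2, hz.2⟩⟩
      have hdiff : DifferentiableOn ℂ f (cell i j) :=
        hd.mono fun z hz => ⟨hUr (hcell i hp.1 j hp.2 hz), hoff z hz⟩
      have := Complex.integral_boundary_rect_eq_zero_of_differentiableOn f ⟨X i, Y j⟩
        ⟨X (i + 1), Y (j + 1)⟩ hdiff
      exact this
    have hone : ∀ i < m, ∀ j < m,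
        ‖rectIntegral f (X i) (X (i + 1)) (Y j) (Y (j + 1))‖ ≤ 2 * ε * ((a + b) / m) := by
      intro i hi j hj
      rw [← rectIntegral_sub_const (hfR.mono (hcell i hi j hj)) (f ⟨X i, Y j⟩)]
      refine (norm_rectIntegral_le (ε := ε) fun z hz => ?_).trans (le_of_eq ?_)
      · have h0 : (⟨X i, Y j⟩ : ℂ) ∈ cell i j := ⟨left_mem_uIcc, left_mem_uIcc⟩
        rw [← dist_eq_norm]
        refine (hfδ z (hcell i hi j hj hz) _ (hcell i hi j hj h0) ?_).le
        rw [dist_eq_norm]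
        refine (Complex.norm_le_abs_re_add_abs_im _).trans_lt ?_
        have h1 := abs_sub_le_of_mem_gridCell hz.1
        have h2 := abs_sub_le_of_mem_gridCell hz.2
        simp only [Complex.sub_re, Complex.sub_im]
        refine (add_le_add h1 h2).trans_lt ?_
        rwa [← add_div]
      · simp only [X, Y, gridNode_succ_sub, abs_div, Nat.abs_cast, a, b]
        ring
    rw [sum_rectIntegral_grid hfR hmpos, ← Finset.sum_product']
    have hsub : bad ⊆ Finset.range m ×ˢ Finset.range m := by
      intro p hp
      simp only [bad, Finset.mem_biUnion, Finset.mem_product] at hp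
      obtain ⟨k, -, h1, h2⟩ := hp
      exact Finset.mem_product.2 ⟨(Finset.mem_filter.1 h1).1, (Finset.mem_filter.1 h2).1⟩
    rw [← Finset.sum_subset hsub hgood]
    refine (norm_sum_le _ _).trans ?_
    refine (Finset.sum_le_card_nsmul _ _ (2 * ε * ((a + b) / m)) fun p hp => ?_).trans ?_
    · have := Finset.mem_product.1 (hsub hp)
      exact hone _ (Finset.mem_range.1 this.1) _ (Finset.mem_range.1 this.2)
    · rw [nsmul_eq_mul]
      refine (mul_le_mul_of_nonneg_right hbad (by positivity)).trans (le_of_eq ?_)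
      rw [hB]; field_simp
  have : ‖rectIntegral f x₀ x₁ y₀ y₁‖ ≤ 0 := by
    refine le_of_forall_gt_imp_ge_of_dense fun c hc => ?_
    have hBp : 0 < B + 1 := by positivity
    refine (key (c / (B + 1)) (by positivity)).trans ?_
    rw [← mul_div_assoc, div_le_iff₀ hBp]
    nlinarith
  exact norm_le_zero_iff.1 this

theorem differentiableOn_of_lipschitz_arc [CompleteSpace E] {γ : ℝ → ℂ} {K : NNReal}
    (hγ : LipschitzOnWith K γ (Icc 0 1)) {f : ℂ → E} {U : Set ℂ} (hU : IsOpen U)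
    (hf : ContinuousOn f U) (hd : DifferentiableOn ℂ f (U \ γ '' Icc 0 1)) :
    DifferentiableOn ℂ f U := by
  refine (Complex.isConservativeOn_and_continuousOn_iff_isDifferentiableOn hU).1 ⟨?_, hf⟩
  intro z w hzw
  rw [← add_eq_zero_iff_eq_neg, Complex.wedgeIntegral_add_wedgeIntegral_eq]
  exact rectIntegral_eq_zero_of_lipschitz_arc hγ hzw hf hd

/-- Painlevé's theorem for a finite family of Lipschitz arcs. -/
theorem differentiableOn_of_lipschitz_arcs [CompleteSpace E] (l : List (ℝ → ℂ))
    (hl : ∀ γ ∈ l, ∃ K : NNReal, LipschitzOnWith K γ (Icc 0 1)) {f : ℂ → E} {U : Set ℂ}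
    (hU : IsOpen U) (hf : ContinuousOn f U)
    (hd : DifferentiableOn ℂ f (U \ {z | ∃ γ ∈ l, z ∈ γ '' Icc 0 1})) :
    DifferentiableOn ℂ f U := by
  induction l generalizing U with
  | nil => simpa using hd
  | cons γ l ih =>
    obtain ⟨K, hK⟩ := hl γ (by simp)
    have hc : IsClosed (γ '' Icc 0 1) := (isCompact_Icc.image_of_continuousOn hK.continuousOn).isClosed
    refine differentiableOn_of_lipschitz_arc hK hU hf ?_
    refine ih (fun γ' h' => hl γ' (by simp [h'])) (hU.sdiff hc) (hf.mono sdiff_subset) ?_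
    refine hd.mono ?_
    rintro z ⟨⟨hzU, hzγ⟩, hz⟩
    refine ⟨hzU, ?_⟩
    rintro ⟨γ', h', hz'⟩
    rcases List.mem_cons.1 h' with rfl | h'
    · exact hzγ hz'
    · exact hz ⟨γ', h', hz'⟩

end Painleve

/-! ### Hardy space orthogonality on a circle -/

section Circle

open Metric Real

theorem tendsto_inv_conj_cobounded (c a : ℂ) {r : ℝ} (hr : 0 < r) :
    Tendsto (fun w : ℂ => a + r ^ 2 / starRingEnd ℂ (w - c)) (𝓝[≠] c) (Bornology.cobounded ℂ) := by
  rw [← tendsto_norm_atTop_iff_cobounded]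
  have h1 : Tendsto (fun w : ℂ => r ^ 2 / ‖w - c‖ - ‖a‖) (𝓝[≠] c) atTop := by
    apply Filter.tendsto_atTop_add_const_right
    have : Tendsto (fun w : ℂ => ‖w - c‖) (𝓝[≠] c) (𝓝[>] 0) := by
      refine tendsto_nhdsWithin_iff.2 ⟨?_, ?_⟩
      · have : Tendsto (fun w : ℂ => ‖w - c‖) (𝓝 c) (𝓝 ‖c - c‖) := by
          apply Continuous.tendsto; fun_prop
        simp only [sub_self, norm_zero] at this
        exact this.mono_left nhdsWithin_le_nhds
      · filter_upwards [self_mem_nhdsWithin] with w hw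
        exact norm_pos_iff.2 (sub_ne_zero.2 hw)
    exact (this.inv_tendsto_nhdsGT_zero).const_mul_atTop (by positivity)
  refine tendsto_atTop_mono (fun w => ?_) h1
  have e : r ^ 2 / ‖w - c‖ = ‖(r : ℂ) ^ 2 / starRingEnd ℂ (w - c)‖ := by
    rw [norm_div, RCLike.norm_conj]; simp
  rw [e]
  have := norm_sub_norm_le ((r : ℂ) ^ 2 / starRingEnd ℂ (w - c)) (-a)
  rw [norm_neg, sub_neg_eq_add, add_comm _ a] at this
  exact this

/-- The boundary values on a circle of a function holomorphic inside are orthogonal to those of a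
function holomorphic outside that vanishes at infinity: reflecting the latter in the circle turns
the inner product into the mean value of a holomorphic function that vanishes at the centre. -/
theorem circleAverage_mul_conj_eq_zero {f h : ℂ → ℂ} {c : ℂ} {r : ℝ} (hr : 0 < r)
    (hf : DiffContOnCl ℂ f (ball c r)) (hh : ContinuousOn h (ball c r)ᶜ)
    (hd : DifferentiableOn ℂ h (closedBall c r)ᶜ)
    (h0 : Tendsto h (Bornology.cobounded ℂ) (𝓝 0)) :
    circleAverage (fun z => f z * starRingEnd ℂ (h z)) c r = 0 := by
  classical
  set σ : ℂ → ℂ := fun w => c + r ^ 2 / starRingEnd ℂ (w - c) with hσ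
  set k : ℂ → ℂ := Function.update (fun w => starRingEnd ℂ (h (σ w))) c 0 with hk
  have hkne : ∀ w, w ≠ c → k w = starRingEnd ℂ (h (σ w)) := fun w hw => by
    rw [hk, Function.update_of_ne hw]
  have hσn : ∀ w, ‖σ w - c‖ = r ^ 2 / ‖w - c‖ := fun w => by
    simp only [hσ, add_sub_cancel_left, norm_div, RCLike.norm_conj]; simp
  have hσcirc : ∀ w ∈ sphere c r, σ w = w := by
    intro w hw
    have hw' : ‖w - c‖ = r := mem_sphere_iff_norm.1 hw
    have hne : starRingEnd ℂ (w - c) ≠ 0 := by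
      rw [Ne, map_eq_zero, ← norm_eq_zero, hw']; exact hr.ne'
    have : (r : ℂ) ^ 2 = (w - c) * starRingEnd ℂ (w - c) := by
      rw [Complex.mul_conj, Complex.normSq_eq_norm_sq, hw']; simp
    simp only [hσ]
    rw [this, mul_div_assoc, div_self hne]; ring
  have hσc : ∀ w, w ≠ c → ContinuousAt σ w := by
    intro w hw
    have : starRingEnd ℂ (w - c) ≠ 0 := by rw [Ne, map_eq_zero]; exact sub_ne_zero.2 hw
    have hc : ContinuousAt (fun w : ℂ => starRingEnd ℂ (w - c)) w :=
      (RCLike.continuous_conj.comp (continuous_id.sub continuous_const)).continuousAt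
    exact continuousAt_const.add (continuousAt_const.div hc this)
  -- the reflected function is continuous on the closed disk
  have hkcont : ContinuousOn k (closedBall c r) := by
    intro w hw
    rcases eq_or_ne w c with rfl | hwc
    · have ht : Tendsto (fun w' => starRingEnd ℂ (h (σ w'))) (𝓝[≠] w) (𝓝 0) := by
        have := (RCLike.continuous_conj (K := ℂ)).tendsto (0 : ℂ)
        rw [map_zero] at this
        exact this.comp (h0.comp (tendsto_inv_conj_cobounded w w hr))
      exact (continuousAt_update_same.2 ht).continuousWithinAt
    · have hmaps : MapsTo σ (closedBall c r \ {c}) (ball c r)ᶜ := by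
        intro v hv
        have hv0 : 0 < ‖v - c‖ := norm_pos_iff.2 (sub_ne_zero.2 hv.2)
        have hv1 : ‖v - c‖ ≤ r := mem_closedBall_iff_norm.1 hv.1
        rw [mem_compl_iff, mem_ball_iff_norm, hσn, not_lt, le_div_iff₀ hv0]
        nlinarith
      have h1 : ContinuousWithinAt (fun w => starRingEnd ℂ (h (σ w))) (closedBall c r \ {c}) w := by
        refine (RCLike.continuous_conj (K := ℂ)).continuousAt.comp_continuousWithinAt ?_
        exact (hh _ (hmaps ⟨hw, hwc⟩)).comp (hσc w hwc).continuousWithinAt hmaps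
      have h2 : ContinuousWithinAt k (closedBall c r \ {c}) w :=
        h1.congr (fun v hv => hkne v hv.2) (hkne w hwc)
      refine h2.mono_of_mem_nhdsWithin ?_
      exact Filter.inter_mem self_mem_nhdsWithin (nhdsWithin_le_nhds (isOpen_ne.mem_nhds hwc))
  have hkd : ∀ w ∈ ball c r \ {c}, DifferentiableAt ℂ k w := by
    rintro w ⟨hw, hwc⟩
    have hwc : w ≠ c := hwc
    have hv0 : 0 < ‖w - c‖ := norm_pos_iff.2 (sub_ne_zero.2 hwc)
    have hv1 : ‖w - c‖ < r := mem_ball_iff_norm.1 hw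
    have hout : σ w ∈ (closedBall c r)ᶜ := by
      rw [mem_compl_iff, mem_closedBall_iff_norm, hσn, not_le, lt_div_iff₀ hv0]
      nlinarith
    have hdh : DifferentiableAt ℂ h (σ w) := hd.differentiableAt (isClosed_closedBall.isOpen_compl.mem_nhds hout)
    have hne : starRingEnd ℂ w - starRingEnd ℂ c ≠ 0 := by
      rw [← map_sub, Ne, map_eq_zero]; exact sub_ne_zero.2 hwc
    set g : ℂ → ℂ := fun v => h (c + r ^ 2 / (v - starRingEnd ℂ c)) with hg
    have hgd : DifferentiableAt ℂ g (starRingEnd ℂ w) := by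
      have e : c + r ^ 2 / (starRingEnd ℂ w - starRingEnd ℂ c) = σ w := by simp [hσ]
      refine DifferentiableAt.comp (starRingEnd ℂ w) (g := h) ?_ ?_
      · rw [e]; exact hdh
      · exact (differentiableAt_const _).add ((differentiableAt_const _).div
          (differentiableAt_id.sub (differentiableAt_const _)) hne)
    have h1 := hgd.conj_conj
    rw [Complex.conj_conj] at h1
    refine h1.congr_of_eventuallyEq ?_
    filter_upwards [isOpen_ne.mem_nhds hwc] with v hv
    rw [hkne v hv]
    simp [hg, hσ]
  have hkdiff : DifferentiableOn ℂ k (ball c r) := by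
    refine (Complex.differentiableOn_compl_singleton_and_continuousAt_iff (ball_mem_nhds c hr)).1
      ⟨fun w hw => (hkd w hw).differentiableWithinAt, ?_⟩
    exact hkcont.continuousAt (closedBall_mem_nhds c hr)
  have hkdc : DiffContOnCl ℂ k (ball c r) :=
    ⟨hkdiff, by rwa [closure_ball c hr.ne']⟩
  have hprod : DiffContOnCl ℂ (fun z => f z * k z) (ball c |r|) := by
    rw [abs_of_pos hr]; exact hf.smul hkdc
  have := hprod.circleAverage
  rw [show k c = 0 by simp [hk], mul_zero] at this
  rw [← this]
  refine circleAverage_congr_sphere fun z hz => ?_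
  rw [abs_of_pos hr] at hz
  have hzc : z ≠ c := by
    rintro rfl
    simp only [mem_sphere, dist_self] at hz
    exact hr.ne hz
  simp only [hkne z hzc, hσcirc z hz]

theorem circleAverage_norm_sq_le {f h : ℂ → ℂ} {c : ℂ} {r : ℝ} (hr : 0 < r)
    (hf : DiffContOnCl ℂ f (ball c r)) (hh : ContinuousOn h (ball c r)ᶜ)
    (hd : DifferentiableOn ℂ h (closedBall c r)ᶜ)
    (h0 : Tendsto h (Bornology.cobounded ℂ) (𝓝 0)) :
    circleAverage (fun z => ‖h z‖ ^ 2) c r ≤ circleAverage (fun z => ‖f z - h z‖ ^ 2) c r := by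
  have horth := circleAverage_mul_conj_eq_zero hr hf hh hd h0
  have hfc : ContinuousOn f (sphere c r) := by
    have := hf.continuousOn
    rw [closure_ball c hr.ne'] at this
    exact this.mono sphere_subset_closedBall
  have hhc : ContinuousOn h (sphere c r) := hh.mono fun z hz => by
    have hz' : ‖z - c‖ = r := mem_sphere_iff_norm.1 hz
    rw [mem_compl_iff, mem_ball_iff_norm, hz']; exact lt_irrefl r
  have hmul : ContinuousOn (fun z => f z * starRingEnd ℂ (h z)) (sphere c r) :=
    hfc.mul (RCLike.continuous_conj.comp_continuousOn hhc)
  have hre : circleAverage (fun z => (f z * starRingEnd ℂ (h z)).re) c r = 0 := by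
    have := Complex.reCLM.circleAverage_comp_comm (hmul.circleIntegrable hr.le)
    rw [horth] at this
    simpa [Function.comp_def] using this
  have hsplit : (fun z => ‖f z - h z‖ ^ 2) =
      fun z => (‖f z‖ ^ 2 + ‖h z‖ ^ 2) - (2 : ℝ) • (f z * starRingEnd ℂ (h z)).re := by
    funext z
    rw [← Complex.normSq_eq_norm_sq, ← Complex.normSq_eq_norm_sq, ← Complex.normSq_eq_norm_sq,
      Complex.normSq_sub, smul_eq_mul]
  have i1 : CircleIntegrable (fun z => ‖f z‖ ^ 2) c r := (hfc.norm.pow 2).circleIntegrable hr.le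
  have i2 : CircleIntegrable (fun z => ‖h z‖ ^ 2) c r := (hhc.norm.pow 2).circleIntegrable hr.le
  have i12 : CircleIntegrable (fun z => ‖f z‖ ^ 2 + ‖h z‖ ^ 2) c r :=
    ((hfc.norm.pow 2).add (hhc.norm.pow 2)).circleIntegrable hr.le
  have i3 : CircleIntegrable (fun z => (2 : ℝ) • (f z * starRingEnd ℂ (h z)).re) c r :=
    ((Complex.continuous_re.comp_continuousOn hmul).const_smul (2 : ℝ)).circleIntegrable hr.le
  rw [hsplit, circleAverage_fun_sub i12 i3, circleAverage_fun_add i1 i2, circleAverage_fun_smul, hre]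
  have : 0 ≤ circleAverage (fun z => ‖f z‖ ^ 2) c r :=
    circleAverage_nonneg_of_nonneg fun z _ => by positivity
  simp; linarith

theorem sq_circleAverage_le {u : ℂ → ℝ} {c : ℂ} {r : ℝ} (hr : 0 ≤ r)
    (hu : ContinuousOn u (sphere c r)) :
    (circleAverage u c r) ^ 2 ≤ circleAverage (fun z => u z ^ 2) c r := by
  set m := circleAverage u c r with hm
  have h0 : 0 ≤ circleAverage (fun z => (u z - m) ^ 2) c r :=
    circleAverage_nonneg_of_nonneg fun z _ => by positivity
  have hsplit : (fun z => (u z - m) ^ 2) = fun z => (u z ^ 2 - (2 * m) • u z) + m ^ 2 := by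
    funext z; simp only [smul_eq_mul]; ring
  have i1 : CircleIntegrable (fun z => u z ^ 2) c r := (hu.pow 2).circleIntegrable hr
  have i2 : CircleIntegrable (fun z => (2 * m) • u z) c r :=
    ContinuousOn.circleIntegrable hr (hu.const_smul (2 * m))
  have i3 : CircleIntegrable (fun z => u z ^ 2 - (2 * m) • u z) c r :=
    ContinuousOn.circleIntegrable hr ((hu.pow 2).sub (hu.const_smul (2 * m)))
  rw [hsplit, circleAverage_fun_add i3 (circleIntegrable_const _ _ _), circleAverage_fun_sub i1 i2,
    circleAverage_fun_smul, circleAverage_const, ← hm, smul_eq_mul] at h0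
  nlinarith

/-! ### Cauchy integrals over a circle -/

/-- The Cauchy integral `(2πi)⁻¹ ∮ (ζ - z)⁻¹ u(ζ) dζ` of a density on a circle. -/
noncomputable def circleCauchy (u : ℂ → ℂ) (c : ℂ) (r : ℝ) (z : ℂ) : ℂ :=
  (2 * π * Complex.I)⁻¹ • ∮ ζ in C(c, r), (ζ - z)⁻¹ • u ζ

theorem norm_circleCauchy_sq_le {u : ℂ → ℂ} {c z : ℂ} {r d : ℝ} (hr : 0 < r) (hd : 0 < d)
    (hu : ContinuousOn u (sphere c r)) (hz : ∀ ζ ∈ sphere c r, d ≤ ‖ζ - z‖) :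
    ‖circleCauchy u c r z‖ ^ 2 ≤ (r / d) ^ 2 * circleAverage (fun ζ => ‖u ζ‖ ^ 2) c r := by
  have h1 : ‖circleCauchy u c r z‖ ≤ r / d * circleAverage (fun ζ => ‖u ζ‖) c r := by
    have hint : CircleIntegrable (fun ζ => ‖u ζ‖) c r := hu.norm.circleIntegrable hr.le
    have hb : ‖∮ ζ in C(c, r), (ζ - z)⁻¹ • u ζ‖ ≤
        ∫ θ in (0 : ℝ)..2 * π, (r / d) * ‖u (circleMap c r θ)‖ := by
      refine intervalIntegral.norm_integral_le_of_norm_le two_pi_pos.le ?_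
        (IntervalIntegrable.const_mul hint _)
      refine Eventually.of_forall fun θ _ => ?_
      have hs := circleMap_mem_sphere c hr.le θ
      rw [norm_smul, norm_smul, norm_inv, deriv_circleMap, norm_mul, norm_circleMap_zero,
        Complex.norm_I, mul_one, abs_of_pos hr, ← mul_assoc, div_eq_mul_inv]
      gcongr
      exact hz _ hs
    have h2 : ‖(2 * π * Complex.I : ℂ)⁻¹‖ = (2 * π)⁻¹ := by
      rw [norm_inv, norm_mul, Complex.norm_I, mul_one, norm_mul, Complex.norm_ofNat,
        Complex.norm_real, Real.norm_of_nonneg pi_pos.le]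
    rw [circleCauchy, norm_smul, h2, circleAverage_def, smul_eq_mul]
    rw [intervalIntegral.integral_const_mul] at hb
    calc (2 * π)⁻¹ * _ ≤ (2 * π)⁻¹ * _ := mul_le_mul_of_nonneg_left hb (by positivity)
      _ = _ := by ring
  calc ‖circleCauchy u c r z‖ ^ 2 ≤ (r / d * circleAverage (fun ζ => ‖u ζ‖) c r) ^ 2 := by gcongr
    _ = (r / d) ^ 2 * (circleAverage (fun ζ => ‖u ζ‖) c r) ^ 2 := by ring
    _ ≤ _ := mul_le_mul_of_nonneg_left (sq_circleAverage_le hr.le hu.norm) (by positivity)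

theorem differentiableOn_circleCauchy_ball {u : ℂ → ℂ} {c : ℂ} {r : ℝ} (hr : 0 < r)
    (hu : ContinuousOn u (sphere c r)) : DifferentiableOn ℂ (circleCauchy u c r) (ball c r) := by
  lift r to NNReal using hr.le
  have := (hasFPowerSeriesOn_cauchy_integral (hu.circleIntegrable hr.le) (by exact_mod_cast hr)).differentiableOn
  rwa [Metric.eball_coe] at this

theorem differentiableOn_circleCauchy_compl {u : ℂ → ℂ} {c : ℂ} {r : ℝ} (hr : 0 < r)
    (hu : ContinuousOn u (sphere c r)) :
    DifferentiableOn ℂ (circleCauchy u c r) (closedBall c r)ᶜ := by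
  intro z hz
  have hz' : r < ‖z - c‖ := by
    rw [mem_compl_iff, mem_closedBall_iff_norm, not_le] at hz; exact hz
  set d := (‖z - c‖ - r) / 2 with hd
  have hdpos : 0 < d := by rw [hd]; linarith
  have hlow : ∀ w ∈ ball z d, ∀ ζ ∈ sphere c r, d ≤ ‖ζ - w‖ := by
    intro w hw ζ hζ
    have h1 : ‖w - z‖ < d := mem_ball_iff_norm.1 hw
    have h2 : ‖ζ - c‖ = r := mem_sphere_iff_norm.1 hζ
    have h3 : ‖z - c‖ ≤ ‖ζ - w‖ + ‖w - z‖ + ‖ζ - c‖ := by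
      have : z - c = -(ζ - w) + -(w - z) + (ζ - c) := by ring
      rw [this]
      refine (norm_add_le _ _).trans (add_le_add_left ((norm_add_le _ _).trans ?_) _)
      rw [norm_neg, norm_neg]
    linarith
  obtain ⟨Bd, hBd⟩ := (isCompact_sphere c r).exists_bound_of_continuousOn hu
  have hcm : Continuous (circleMap c r) := continuous_circleMap c r
  have hms : ∀ θ, circleMap c r θ ∈ sphere c r := circleMap_mem_sphere c hr.le
  have huθ : Continuous fun θ => u (circleMap c r θ) :=
    hu.comp_continuous hcm hms
  have hdθ : Continuous (deriv (circleMap c r)) := by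
    have : deriv (circleMap c r) = fun θ => circleMap 0 r θ * Complex.I := by
      funext θ; exact deriv_circleMap c r θ
    rw [this]; exact (continuous_circleMap 0 r).mul continuous_const
  have hne : ∀ w ∈ ball z d, ∀ θ, circleMap c r θ - w ≠ 0 := fun w hw θ h0 => by
    have := hlow w hw _ (hms θ)
    rw [h0, norm_zero] at this; linarith
  have hF : ∀ w ∈ ball z d, Continuous fun θ =>
      deriv (circleMap c r) θ • (circleMap c r θ - w)⁻¹ • u (circleMap c r θ) := fun w hw =>
    hdθ.smul (((hcm.sub continuous_const).inv₀ (hne w hw)).smul huθ)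
  have hF' : Continuous fun θ =>
      deriv (circleMap c r) θ • ((circleMap c r θ - z) ^ 2)⁻¹ • u (circleMap c r θ) :=
    hdθ.smul ((((hcm.sub continuous_const).pow 2).inv₀ fun θ =>
      pow_ne_zero 2 (hne z (mem_ball_self hdpos) θ)).smul huθ)
  have key := intervalIntegral.hasDerivAt_integral_of_dominated_loc_of_deriv_le
    (μ := MeasureTheory.volume) (𝕜 := ℂ) (a := 0) (b := 2 * π)
    (F := fun w θ => deriv (circleMap c r) θ • (circleMap c r θ - w)⁻¹ • u (circleMap c r θ))
    (F' := fun w θ => deriv (circleMap c r) θ • ((circleMap c r θ - w) ^ 2)⁻¹ • u (circleMap c r θ))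
    (x₀ := z) (s := ball z d) (bound := fun _ => r * ((d ^ 2)⁻¹ * Bd)) (ball_mem_nhds z hdpos)
    (Filter.eventually_of_mem (ball_mem_nhds z hdpos) fun w hw =>
      (hF w hw).aestronglyMeasurable)
    ((hF z (mem_ball_self hdpos)).intervalIntegrable _ _)
    hF'.aestronglyMeasurable
    (Eventually.of_forall fun θ _ w hw => by
      rw [norm_smul, norm_smul, deriv_circleMap, norm_mul, norm_circleMap_zero, Complex.norm_I,
        mul_one, abs_of_pos hr, norm_inv, norm_pow]
      have := hBd _ (hms θ)
      have h2 := hlow w hw _ (hms θ)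
      gcongr)
    (by simp)
    (Eventually.of_forall fun θ _ w hw => by
      have h1 : HasDerivAt (fun w : ℂ => (circleMap c r θ - w)⁻¹)
          (((circleMap c r θ - w) ^ 2)⁻¹) w := by
        have := ((hasDerivAt_id w).const_sub (circleMap c r θ)).fun_inv (hne w hw θ)
        simpa [neg_div] using this
      exact (h1.smul_const (u (circleMap c r θ))).fun_const_smul (deriv (circleMap c r) θ))
  exact (key.2.differentiableAt.fun_const_smul (2 * π * Complex.I : ℂ)⁻¹).differentiableWithinAt

theorem tendsto_circleCauchy_cobounded {u : ℂ → ℂ} {c : ℂ} {r : ℝ} (hr : 0 < r)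
    (hu : ContinuousOn u (sphere c r)) :
    Tendsto (circleCauchy u c r) (Bornology.cobounded ℂ) (𝓝 0) := by
  have h1 : Tendsto (fun z : ℂ => ‖z‖ - (‖c‖ + r)) (Bornology.cobounded ℂ) atTop :=
    tendsto_atTop_add_const_right _ _ tendsto_norm_cobounded_atTop
  set S := circleAverage (fun ζ => ‖u ζ‖ ^ 2) c r
  have h2 : Tendsto (fun z : ℂ => (r / (‖z‖ - (‖c‖ + r))) ^ 2 * S) (Bornology.cobounded ℂ) (𝓝 0) := by
    have := ((tendsto_const_nhds (x := r)).div_atTop h1).pow 2 |>.mul_const S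
    simpa using this
  have h3 : Tendsto (fun z => ‖circleCauchy u c r z‖ ^ 2) (Bornology.cobounded ℂ) (𝓝 0) := by
    refine squeeze_zero' (Eventually.of_forall fun z => by positivity) ?_ h2
    filter_upwards [h1.eventually_gt_atTop 0] with z hz
    refine norm_circleCauchy_sq_le hr hz hu fun ζ hζ => ?_
    have hζ' : ‖ζ - c‖ = r := mem_sphere_iff_norm.1 hζ
    have : ‖z‖ ≤ ‖ζ - z‖ + ‖ζ - c‖ + ‖c‖ := by
      have e : z = -(ζ - z) + (ζ - c) + c := by ring
      calc ‖z‖ = ‖-(ζ - z) + (ζ - c) + c‖ := by rw [← e]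
        _ ≤ _ := norm_add₃_le
        _ = _ := by rw [norm_neg]
    linarith
  rw [tendsto_zero_iff_norm_tendsto_zero]
  have := h3.sqrt
  simpa using this

theorem continuousOn_sub_inv {z : ℂ} {s : Set ℂ} (hz : z ∉ s) :
    ContinuousOn (fun ζ : ℂ => (ζ - z)⁻¹) s := by
  refine ContinuousOn.inv₀ (by fun_prop) fun ζ hζ h0 => hz ?_
  rw [← sub_eq_zero.1 h0]; exact hζ

/-- Cauchy's formula for an annulus. -/
theorem circleCauchy_sub_circleCauchy {B : ℂ → ℂ} {c z : ℂ} {r R : ℝ} (hr : 0 < r)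
    (hB : ContinuousOn B (closedBall c R \ ball c r))
    (hBd : DifferentiableOn ℂ B (ball c R \ closedBall c r)) (hz : z ∈ ball c R \ closedBall c r) :
    circleCauchy B c R z - circleCauchy B c r z = B z := by
  have hzR : ‖z - c‖ < R := mem_ball_iff_norm.1 hz.1
  have hzr : r < ‖z - c‖ := by
    have := hz.2; rw [mem_closedBall_iff_norm, not_le] at this; exact this
  have hR : 0 < R := by linarith
  have hopen : IsOpen (ball c R \ closedBall c r) := isOpen_ball.sdiff isClosed_closedBall
  have hsub : ball c R \ closedBall c r ⊆ closedBall c R \ ball c r := fun w hw =>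
    ⟨ball_subset_closedBall hw.1, fun h => hw.2 (ball_subset_closedBall h)⟩
  have hnz : closedBall c R \ ball c r ∈ 𝓝 z := mem_of_superset (hopen.mem_nhds hz) hsub
  have hBz : DifferentiableAt ℂ B z := hBd.differentiableAt (hopen.mem_nhds hz)
  have hsc : ContinuousOn (dslope B z) (closedBall c R \ ball c r) :=
    (continuousOn_dslope hnz).2 ⟨hB, hBz⟩
  have hsd : ∀ w ∈ (ball c R \ closedBall c r) \ ∅, DifferentiableAt ℂ (dslope B z) w :=
    fun w hw => ((Complex.differentiableOn_dslope (hopen.mem_nhds hz)).2 hBd).differentiableAt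
      (hopen.mem_nhds hw.1)
  have heq := Complex.circleIntegral_eq_of_differentiable_on_annulus_off_countable hr
    (by linarith) countable_empty hsc hsd
  have hsR : sphere c R ⊆ closedBall c R \ ball c r := fun w hw => by
    have : ‖w - c‖ = R := mem_sphere_iff_norm.1 hw
    refine ⟨sphere_subset_closedBall hw, ?_⟩
    rw [mem_ball_iff_norm, this]; linarith
  have hsr : sphere c r ⊆ closedBall c R \ ball c r := fun w hw => by
    have : ‖w - c‖ = r := mem_sphere_iff_norm.1 hw
    refine ⟨?_, ?_⟩
    · rw [mem_closedBall_iff_norm, this]; linarith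
    · rw [mem_ball_iff_norm, this]; exact lt_irrefl r
  have hds : ∀ ρ, 0 < ρ → sphere c ρ ⊆ closedBall c R \ ball c r → z ∉ sphere c ρ →
      (∮ ζ in C(c, ρ), dslope B z ζ) =
        (∮ ζ in C(c, ρ), (ζ - z)⁻¹ • B ζ) - (∮ ζ in C(c, ρ), (ζ - z)⁻¹) • B z := by
    intro ρ hρ hs hzs
    have hinv := continuousOn_sub_inv hzs
    rw [← circleIntegral.integral_smul_const, ← circleIntegral.integral_sub
      (ContinuousOn.circleIntegrable hρ.le (f := fun ζ => (ζ - z)⁻¹ • B ζ) (hinv.smul (hB.mono hs)))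
      (ContinuousOn.circleIntegrable hρ.le (f := fun ζ => (ζ - z)⁻¹ • B z)
        (hinv.smul continuousOn_const))]
    refine circleIntegral.integral_congr hρ.le fun ζ hζ => ?_
    have : ζ ≠ z := by rintro rfl; exact hzs hζ
    rw [dslope_of_ne _ this, slope_def_module, smul_sub]
  have hzsR : z ∉ sphere c R := fun h => by
    have : ‖z - c‖ = R := mem_sphere_iff_norm.1 h
    linarith
  have hzsr : z ∉ sphere c r := fun h => by
    have : ‖z - c‖ = r := mem_sphere_iff_norm.1 h
    linarith
  rw [hds R hR hsR hzsR, hds r hr hsr hzsr, circleIntegral.integral_sub_inv_of_mem_ball hz.1] at heq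
  have hzero : (∮ ζ in C(c, r), (ζ - z)⁻¹) = 0 := by
    refine DiffContOnCl.circleIntegral_eq_zero hr.le (DifferentiableOn.diffContOnCl ?_)
    rw [closure_ball c hr.ne']
    intro ζ hζ
    have : ζ - z ≠ 0 := fun h0 => hz.2 (by rw [← sub_eq_zero.1 h0]; exact hζ)
    exact ((differentiableAt_id.sub (differentiableAt_const z)).inv this).differentiableWithinAt
  rw [hzero, zero_smul, sub_zero] at heq
  have h2 : (2 * π * Complex.I : ℂ) ≠ 0 := Complex.two_pi_I_ne_zero
  simp only [circleCauchy]
  rw [← heq, smul_sub, smul_smul, inv_mul_cancel₀ h2, one_smul]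
  ring

theorem circleCauchy_sub {u v : ℂ → ℂ} {c z : ℂ} {r : ℝ} (hr : 0 < r)
    (hu : ContinuousOn u (sphere c r)) (hv : ContinuousOn v (sphere c r)) (hz : z ∉ sphere c r) :
    circleCauchy (fun ζ => u ζ - v ζ) c r z = circleCauchy u c r z - circleCauchy v c r z := by
  have hinv := continuousOn_sub_inv hz
  simp only [circleCauchy, smul_sub]
  rw [circleIntegral.integral_sub
    (ContinuousOn.circleIntegrable hr.le (f := fun ζ => (ζ - z)⁻¹ • u ζ) (hinv.smul hu))
    (ContinuousOn.circleIntegrable hr.le (f := fun ζ => (ζ - z)⁻¹ • v ζ) (hinv.smul hv))]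
  simp [mul_sub]

theorem circleCauchy_eq_zero {A : ℂ → ℂ} {c z : ℂ} {r : ℝ} (hr : 0 < r)
    (hA : DiffContOnCl ℂ A (ball c r)) (hz : z ∉ closedBall c r) : circleCauchy A c r z = 0 := by
  have h1 : DiffContOnCl ℂ (fun ζ => (ζ - z)⁻¹) (ball c r) := by
    refine DifferentiableOn.diffContOnCl ?_
    rw [closure_ball c hr.ne']
    intro ζ hζ
    have : ζ - z ≠ 0 := fun h0 => hz (by rw [← sub_eq_zero.1 h0]; exact hζ)
    exact ((differentiableAt_id.sub (differentiableAt_const z)).inv this).differentiableWithinAt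
  rw [circleCauchy, DiffContOnCl.circleIntegral_eq_zero hr.le (h1.smul hA), smul_zero]

end Circle

/-! ### Small jumps on two disjoint circles -/

section TwoCircles

open Metric Real

/-- A function holomorphic inside and outside two disjoint circles, with different boundary values
`A₀`, `B` and `A₁`, `B` on them, is the sum of its value at infinity and the Cauchy integrals of its
two jumps. -/
theorem eq_add_circleCauchy {c₀ c₁ : ℂ} {r₀ r₁ : ℝ} (hr₀ : 0 < r₀) (hr₁ : 0 < r₁)
    (hdist : r₀ + r₁ < dist c₀ c₁) {A₀ A₁ B : ℂ → ℂ} {β : ℂ}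
    (hA₀ : DiffContOnCl ℂ A₀ (ball c₀ r₀)) (hA₁ : DiffContOnCl ℂ A₁ (ball c₁ r₁))
    (hB : ContinuousOn B (ball c₀ r₀ ∪ ball c₁ r₁)ᶜ)
    (hBd : DifferentiableOn ℂ B (closedBall c₀ r₀ ∪ closedBall c₁ r₁)ᶜ)
    (hlim : Tendsto B (Bornology.cobounded ℂ) (𝓝 β)) {z : ℂ}
    (hz : z ∈ (closedBall c₀ r₀ ∪ closedBall c₁ r₁)ᶜ) :
    B z = β + circleCauchy (fun ζ => A₀ ζ - B ζ) c₀ r₀ z +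
      circleCauchy (fun ζ => A₁ ζ - B ζ) c₁ r₁ z := by
  classical
  set δ := (dist c₀ c₁ - r₀ - r₁) / 2 with hδ
  have hδ0 : 0 < δ := by rw [hδ]; linarith
  -- on a concentric annulus, `B` minus the Cauchy integral of the jump continues inside
  have main : ∀ {c c' : ℂ} {r r' : ℝ} {A : ℂ → ℂ}, 0 < r → 0 < r' → r + r' + 2 * δ = dist c c' →
      DiffContOnCl ℂ A (ball c r) → ContinuousOn B (ball c r ∪ ball c' r')ᶜ →
      DifferentiableOn ℂ B (closedBall c r ∪ closedBall c' r')ᶜ →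
      ContinuousOn (fun ζ => A ζ - B ζ) (sphere c r) ∧ ∃ G : ℂ → ℂ,
        DifferentiableOn ℂ G (ball c (r + δ)) ∧ ∀ w ∈ ball c (r + δ) \ closedBall c r,
          G w = B w - circleCauchy (fun ζ => A ζ - B ζ) c r w := by
    intro c c' r r' A hr hr' hd hA hBc hBd'
    have hann : closedBall c (r + δ) \ ball c r ⊆ (ball c r ∪ ball c' r')ᶜ := by
      rintro w ⟨h1, h2⟩ (h | h)
      · exact h2 h
      · have := dist_triangle_left c c' w
        rw [mem_closedBall] at h1; rw [mem_ball] at h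
        linarith
    have hann' : ball c (r + δ) \ closedBall c r ⊆ (closedBall c r ∪ closedBall c' r')ᶜ := by
      rintro w ⟨h1, h2⟩ (h | h)
      · exact h2 h
      · have := dist_triangle_left c c' w
        rw [mem_ball] at h1; rw [mem_closedBall] at h
        linarith
    have hsph : sphere c r ⊆ closedBall c (r + δ) \ ball c r := fun w hw => by
      rw [mem_sphere] at hw
      rw [Set.mem_sdiff, mem_closedBall, mem_ball, hw]
      exact ⟨by linarith, lt_irrefl r⟩
    have hsph' : sphere c (r + δ) ⊆ closedBall c (r + δ) \ ball c r := fun w hw => by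
      rw [mem_sphere] at hw
      rw [Set.mem_sdiff, mem_closedBall, mem_ball, hw]
      exact ⟨le_rfl, by linarith⟩
    have hBs := hBc.mono (hsph.trans hann)
    have hAs : ContinuousOn A (sphere c r) := by
      have := hA.continuousOn
      rw [closure_ball c hr.ne'] at this
      exact this.mono sphere_subset_closedBall
    refine ⟨hAs.sub hBs, circleCauchy B c (r + δ),
      differentiableOn_circleCauchy_ball (by linarith) (hBc.mono (hsph'.trans hann)), ?_⟩
    intro w hw
    have h1 := circleCauchy_sub_circleCauchy hr (hBc.mono hann) (hBd'.mono hann') hw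
    rw [circleCauchy_sub hr hAs hBs fun h => hw.2 (sphere_subset_closedBall h),
      circleCauchy_eq_zero hr hA hw.2, ← h1]
    ring
  have hBsym : ContinuousOn B (ball c₁ r₁ ∪ ball c₀ r₀)ᶜ := by rwa [union_comm]
  have hBdsym : DifferentiableOn ℂ B (closedBall c₁ r₁ ∪ closedBall c₀ r₀)ᶜ := by rwa [union_comm]
  obtain ⟨hj₀, G₀, hG₀d, hG₀⟩ := main hr₀ hr₁ (by rw [hδ]; ring) hA₀ hB hBd
  obtain ⟨hj₁, G₁, hG₁d, hG₁⟩ := main hr₁ hr₀ (by rw [hδ, dist_comm c₁ c₀]; ring) hA₁ hBsym hBdsym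
  set J₀ := circleCauchy (fun ζ => A₀ ζ - B ζ) c₀ r₀ with hJ₀
  set J₁ := circleCauchy (fun ζ => A₁ ζ - B ζ) c₁ r₁ with hJ₁
  have hJ₀d : DifferentiableOn ℂ J₀ (closedBall c₀ r₀)ᶜ := differentiableOn_circleCauchy_compl hr₀ hj₀
  have hJ₁d : DifferentiableOn ℂ J₁ (closedBall c₁ r₁)ᶜ := differentiableOn_circleCauchy_compl hr₁ hj₁
  have hsep : ∀ w, w ∈ closedBall c₀ (r₀ + δ) → w ∉ ball c₁ (r₁ + δ) := by
    intro w h1 h2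
    have := dist_triangle_left c₀ c₁ w
    rw [mem_closedBall] at h1; rw [mem_ball] at h2
    have : dist c₀ c₁ = r₀ + r₁ + 2 * δ := by rw [hδ]; ring
    linarith
  set G : ℂ → ℂ := fun w => if w ∈ ball c₀ (r₀ + δ) then G₀ w - J₁ w
    else if w ∈ ball c₁ (r₁ + δ) then G₁ w - J₀ w else B w - J₀ w - J₁ w with hG
  have hGout : ∀ w ∈ (closedBall c₀ r₀ ∪ closedBall c₁ r₁)ᶜ, G w = B w - J₀ w - J₁ w := by
    intro w hw
    rw [mem_compl_iff, mem_union, not_or] at hw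
    simp only [hG]
    split_ifs with h1 h2
    · rw [hG₀ w ⟨h1, hw.1⟩]
    · rw [hG₁ w ⟨h2, hw.2⟩]; ring
    · rfl
  have hopen : IsOpen (closedBall c₀ r₀ ∪ closedBall c₁ r₁)ᶜ :=
    (isClosed_closedBall.union isClosed_closedBall).isOpen_compl
  have hGd : Differentiable ℂ G := by
    intro w
    by_cases h0 : w ∈ closedBall c₀ r₀
    · have hw0 : w ∈ ball c₀ (r₀ + δ) := closedBall_subset_ball (by linarith) h0
      have hw1 : w ∈ (closedBall c₁ r₁)ᶜ := fun h =>
        hsep w (ball_subset_closedBall hw0) (closedBall_subset_ball (by linarith) h)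
      have : DifferentiableAt ℂ (fun w => G₀ w - J₁ w) w :=
        (hG₀d.differentiableAt (isOpen_ball.mem_nhds hw0)).sub
          (hJ₁d.differentiableAt (isClosed_closedBall.isOpen_compl.mem_nhds hw1))
      refine this.congr_of_eventuallyEq ?_
      filter_upwards [isOpen_ball.mem_nhds hw0] with v hv
      simp only [hG, if_pos hv]
    by_cases h1 : w ∈ closedBall c₁ r₁
    · have hw1 : w ∈ ball c₁ (r₁ + δ) := closedBall_subset_ball (by linarith) h1
      have : DifferentiableAt ℂ (fun w => G₁ w - J₀ w) w :=
        (hG₁d.differentiableAt (isOpen_ball.mem_nhds hw1)).sub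
          (hJ₀d.differentiableAt (isClosed_closedBall.isOpen_compl.mem_nhds h0))
      refine this.congr_of_eventuallyEq ?_
      filter_upwards [isOpen_ball.mem_nhds hw1] with v hv
      have hv0 : v ∉ ball c₀ (r₀ + δ) := fun h => hsep v (ball_subset_closedBall h) hv
      simp only [hG, if_neg hv0, if_pos hv]
    · have hw : w ∈ (closedBall c₀ r₀ ∪ closedBall c₁ r₁)ᶜ := fun h => h.elim h0 h1
      have : DifferentiableAt ℂ (fun w => B w - J₀ w - J₁ w) w :=
        ((hBd.differentiableAt (hopen.mem_nhds hw)).sub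
          (hJ₀d.differentiableAt (isClosed_closedBall.isOpen_compl.mem_nhds h0))).sub
          (hJ₁d.differentiableAt (isClosed_closedBall.isOpen_compl.mem_nhds h1))
      refine this.congr_of_eventuallyEq ?_
      filter_upwards [hopen.mem_nhds hw] with v hv
      exact hGout v hv
  have hGlim : Tendsto G (cocompact ℂ) (𝓝 β) := by
    rw [← cobounded_eq_cocompact]
    have h1 : Tendsto (fun w => B w - J₀ w - J₁ w) (Bornology.cobounded ℂ) (𝓝 (β - 0 - 0)) :=
      (hlim.sub (tendsto_circleCauchy_cobounded hr₀ hj₀)).sub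
        (tendsto_circleCauchy_cobounded hr₁ hj₁)
    rw [sub_zero, sub_zero] at h1
    refine h1.congr' ?_
    have hb : Bornology.IsBounded (closedBall c₀ r₀ ∪ closedBall c₁ r₁) :=
      isBounded_closedBall.union isBounded_closedBall
    filter_upwards [Bornology.isBounded_def.1 hb] with w hw
    exact (hGout w hw).symm
  have := hGd.apply_eq_of_tendsto_cocompact z hGlim
  rw [hGout z hz] at this
  rw [← this]; ring

/-- The `L²` estimate on one of the two circles: the outer boundary values differ from the value at
infinity by at most the jumps. -/
theorem circleAverage_outer_le {c₀ c₁ : ℂ} {r₀ r₁ : ℝ} (hr₀ : 0 < r₀) (hr₁ : 0 < r₁)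
    (hdist : r₀ + r₁ < dist c₀ c₁) {A₀ A₁ B : ℂ → ℂ} {β : ℂ}
    (hA₀ : DiffContOnCl ℂ A₀ (ball c₀ r₀)) (hA₁ : DiffContOnCl ℂ A₁ (ball c₁ r₁))
    (hB : ContinuousOn B (ball c₀ r₀ ∪ ball c₁ r₁)ᶜ)
    (hBd : DifferentiableOn ℂ B (closedBall c₀ r₀ ∪ closedBall c₁ r₁)ᶜ)
    (hlim : Tendsto B (Bornology.cobounded ℂ) (𝓝 β)) :
    circleAverage (fun z => ‖B z - β‖ ^ 2) c₀ r₀ ≤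
      2 * circleAverage (fun z => ‖A₀ z - B z‖ ^ 2) c₀ r₀ +
      2 * (r₁ / (dist c₀ c₁ - r₀ - r₁)) ^ 2 *
        circleAverage (fun z => ‖A₁ z - B z‖ ^ 2) c₁ r₁ := by
  classical
  set d := dist c₀ c₁ - r₀ - r₁ with hd
  have hd0 : 0 < d := by rw [hd]; linarith
  have hnot : ∀ w ∈ closedBall c₀ r₀, w ∉ closedBall c₁ r₁ := by
    intro w h1 h2
    have := dist_triangle_left c₀ c₁ w
    rw [mem_closedBall] at h1 h2
    linarith
  have hs₀ : sphere c₀ r₀ ⊆ (ball c₀ r₀ ∪ ball c₁ r₁)ᶜ := by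
    rintro w hw (h | h)
    · exact (ne_of_lt (mem_ball.1 h)) (mem_sphere.1 hw)
    · exact hnot w (sphere_subset_closedBall hw) (ball_subset_closedBall h)
  have hs₁ : sphere c₁ r₁ ⊆ (ball c₀ r₀ ∪ ball c₁ r₁)ᶜ := by
    rintro w hw (h | h)
    · exact hnot w (ball_subset_closedBall h) (sphere_subset_closedBall hw)
    · exact (ne_of_lt (mem_ball.1 h)) (mem_sphere.1 hw)
  have hA₀c : ContinuousOn A₀ (closedBall c₀ r₀) := by
    have := hA₀.continuousOn; rwa [closure_ball c₀ hr₀.ne'] at this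
  have hA₁c : ContinuousOn A₁ (closedBall c₁ r₁) := by
    have := hA₁.continuousOn; rwa [closure_ball c₁ hr₁.ne'] at this
  have hj₀ : ContinuousOn (fun z => A₀ z - B z) (sphere c₀ r₀) :=
    (hA₀c.mono sphere_subset_closedBall).sub (hB.mono hs₀)
  have hj₁ : ContinuousOn (fun z => A₁ z - B z) (sphere c₁ r₁) :=
    (hA₁c.mono sphere_subset_closedBall).sub (hB.mono hs₁)
  set J₀ := circleCauchy (fun ζ => A₀ ζ - B ζ) c₀ r₀ with hJ₀
  set J₁ := circleCauchy (fun ζ => A₁ ζ - B ζ) c₁ r₁ with hJ₁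
  have hJ₀d : DifferentiableOn ℂ J₀ (closedBall c₀ r₀)ᶜ := differentiableOn_circleCauchy_compl hr₀ hj₀
  have hJ₁d : DifferentiableOn ℂ J₁ (closedBall c₁ r₁)ᶜ := differentiableOn_circleCauchy_compl hr₁ hj₁
  -- the outer function of the orthogonality relation: `B - β - J₁` on the circle, `J₀` beyond it
  set h : ℂ → ℂ := fun w => if w ∈ closedBall c₀ r₀ then B w - β - J₁ w else J₀ w with hh
  have hh1 : ∀ w ∈ (closedBall c₁ r₁)ᶜ, w ∈ (ball c₀ r₀)ᶜ → h w = B w - β - J₁ w := by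
    intro w hw1 hw0
    simp only [hh]
    split_ifs with hc
    · rfl
    · rw [eq_add_circleCauchy hr₀ hr₁ hdist hA₀ hA₁ hB hBd hlim (z := w) fun h => h.elim hc hw1]
      ring
  have hhd : DifferentiableOn ℂ h (closedBall c₀ r₀)ᶜ :=
    hJ₀d.congr fun w hw => by simp only [hh]; rw [if_neg hw]
  have hhc : ContinuousOn h (ball c₀ r₀)ᶜ := by
    intro w hw
    by_cases hc : w ∈ closedBall c₀ r₀
    · have hw1 : w ∈ (closedBall c₁ r₁)ᶜ := hnot w hc
      have hn : (closedBall c₁ r₁)ᶜ ∈ 𝓝 w := isClosed_closedBall.isOpen_compl.mem_nhds hw1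
      have hcont : ContinuousWithinAt (fun w => B w - β - J₁ w)
          ((ball c₀ r₀)ᶜ ∩ (closedBall c₁ r₁)ᶜ) w := by
        refine ContinuousWithinAt.sub (ContinuousWithinAt.sub ?_ continuousWithinAt_const) ?_
        · have hsub : (ball c₀ r₀)ᶜ ∩ (closedBall c₁ r₁)ᶜ ⊆ (ball c₀ r₀ ∪ ball c₁ r₁)ᶜ := by
            rintro v ⟨h1, h2⟩ (h | h)
            · exact h1 h
            · exact h2 (ball_subset_closedBall h)
          exact (hB.mono hsub) w ⟨hw, hw1⟩
        · exact (hJ₁d.differentiableAt hn).continuousAt.continuousWithinAt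
      refine (hcont.congr (fun v hv => hh1 v hv.2 hv.1) (hh1 w hw1 hw)).mono_of_mem_nhdsWithin ?_
      exact inter_mem self_mem_nhdsWithin (nhdsWithin_le_nhds hn)
    · exact (hhd.differentiableAt
        (isClosed_closedBall.isOpen_compl.mem_nhds hc)).continuousAt.continuousWithinAt
  have hh0 : Tendsto h (Bornology.cobounded ℂ) (𝓝 0) := by
    refine (tendsto_circleCauchy_cobounded hr₀ hj₀).congr' ?_
    filter_upwards [Bornology.isBounded_def.1 (isBounded_closedBall (x := c₀) (r := r₀))] with w hw
    simp only [hh]; rw [if_neg hw]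
  have hf : DiffContOnCl ℂ (fun w => A₀ w - β - J₁ w) (ball c₀ r₀) := by
    refine (hA₀.sub diffContOnCl_const).sub (DifferentiableOn.diffContOnCl ?_)
    rw [closure_ball c₀ hr₀.ne']
    exact hJ₁d.mono hnot
  have hL2 := circleAverage_norm_sq_le hr₀ hf hhc hhd hh0
  have hsh : ∀ w ∈ sphere c₀ r₀, h w = B w - β - J₁ w := fun w hw =>
    hh1 w (hnot w (sphere_subset_closedBall hw)) fun hb => (ne_of_lt (mem_ball.1 hb)) (mem_sphere.1 hw)
  have e1 : circleAverage (fun z => ‖A₀ z - β - J₁ z - h z‖ ^ 2) c₀ r₀ =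
      circleAverage (fun z => ‖A₀ z - B z‖ ^ 2) c₀ r₀ := by
    refine circleAverage_congr_sphere fun w hw => ?_
    rw [abs_of_pos hr₀] at hw
    simp only [hsh w hw]
    congr 2; ring
  rw [e1] at hL2
  set D₁ := circleAverage (fun z => ‖A₁ z - B z‖ ^ 2) c₁ r₁ with hD₁
  have hJ₁b : ∀ w ∈ sphere c₀ r₀, ‖J₁ w‖ ^ 2 ≤ (r₁ / d) ^ 2 * D₁ := by
    intro w hw
    refine norm_circleCauchy_sq_le hr₁ hd0 hj₁ fun ζ hζ => ?_
    rw [mem_sphere] at hw hζ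
    rw [← dist_eq_norm, hd]
    have h1 := dist_triangle4 c₀ w ζ c₁
    rw [dist_comm c₀ w, dist_comm w ζ] at h1
    linarith
  have hBs : ContinuousOn (fun z => ‖B z - β‖ ^ 2) (sphere c₀ r₀) :=
    ((hB.mono hs₀).sub continuousOn_const).norm.pow 2
  have hhs : ContinuousOn (fun z => ‖h z‖ ^ 2) (sphere c₀ r₀) := by
    refine (hhc.mono fun w hw hb => ?_).norm.pow 2
    exact (ne_of_lt (mem_ball.1 hb)) (mem_sphere.1 hw)
  calc circleAverage (fun z => ‖B z - β‖ ^ 2) c₀ r₀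
      ≤ circleAverage (fun z => (2 : ℝ) • ‖h z‖ ^ 2 + 2 * ((r₁ / d) ^ 2 * D₁)) c₀ r₀ := by
        refine circleAverage_mono (hBs.circleIntegrable hr₀.le)
          (ContinuousOn.circleIntegrable hr₀.le
            ((hhs.const_smul (2 : ℝ)).add continuousOn_const)) fun w hw => ?_
        rw [abs_of_pos hr₀] at hw
        have h1 : B w - β = h w + J₁ w := by rw [hsh w hw]; ring
        have h2 := hJ₁b w hw
        have h3 := norm_add_le (h w) (J₁ w)
        rw [h1, smul_eq_mul]
        have h4 : ‖h w + J₁ w‖ ^ 2 ≤ (‖h w‖ + ‖J₁ w‖) ^ 2 := by gcongr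
        nlinarith [sq_nonneg (‖h w‖ - ‖J₁ w‖)]
    _ = 2 * circleAverage (fun z => ‖h z‖ ^ 2) c₀ r₀ + 2 * ((r₁ / d) ^ 2 * D₁) := by
        rw [circleAverage_fun_add
          (ContinuousOn.circleIntegrable hr₀.le (f := fun z => (2 : ℝ) • ‖h z‖ ^ 2)
            (hhs.const_smul (2 : ℝ)))
          (circleIntegrable_const _ _ _), circleAverage_fun_smul, circleAverage_const, smul_eq_mul]
    _ ≤ _ := by linarith

theorem sum_mul_le_card_mul_sum_sq {ι : Type*} [Fintype ι] (a : ι → ℝ) :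
    (∑ k, a k) ^ 2 ≤ Fintype.card ι * ∑ k, a k ^ 2 := by
  simpa using sq_sum_le_card_mul_sum_sq (s := Finset.univ) (f := a)

/-- The jump of a family with relative jump `ε`, in `L²` on one circle. -/
theorem sum_circleAverage_jump_le {ι : Type*} [Fintype ι] {c : ℂ} {r ε : ℝ} (hr : 0 < r)
    {A B : ι → ℂ → ℂ} (β : ι → ℂ) (hA : ∀ i, ContinuousOn (A i) (sphere c r))
    (hB : ∀ i, ContinuousOn (B i) (sphere c r))
    (h : ∀ z ∈ sphere c r, ∀ i, ‖A i z - B i z‖ ≤ ε * ∑ k, ‖A k z‖) :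
    ∑ i, circleAverage (fun z => ‖A i z - B i z‖ ^ 2) c r ≤
      3 * (ε * Fintype.card ι) ^ 2 * (∑ i, circleAverage (fun z => ‖A i z - B i z‖ ^ 2) c r +
        ∑ i, circleAverage (fun z => ‖B i z - β i‖ ^ 2) c r + ∑ i, ‖β i‖ ^ 2) := by
  have c1 : ∀ i, ContinuousOn (fun z => ‖A i z - B i z‖ ^ 2) (sphere c r) := fun i =>
    ((hA i).sub (hB i)).norm.pow 2
  have c2 : ∀ i, ContinuousOn (fun z => ‖B i z - β i‖ ^ 2) (sphere c r) := fun i =>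
    ((hB i).sub continuousOn_const).norm.pow 2
  have c1' : ContinuousOn (fun z => ∑ i, ‖A i z - B i z‖ ^ 2) (sphere c r) :=
    continuousOn_finsetSum _ fun i _ => c1 i
  have c2' : ContinuousOn (fun z => ∑ i, ‖B i z - β i‖ ^ 2) (sphere c r) :=
    continuousOn_finsetSum _ fun i _ => c2 i
  rw [← circleAverage_fun_sum fun i _ => (c1 i).circleIntegrable hr.le,
    ← circleAverage_fun_sum fun i _ => (c2 i).circleIntegrable hr.le]
  set N : ℝ := (Fintype.card ι : ℝ)
  set b : ℝ := ∑ i, ‖β i‖ ^ 2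
  have hN : 0 ≤ N := Nat.cast_nonneg _
  calc circleAverage (fun z => ∑ i, ‖A i z - B i z‖ ^ 2) c r
      ≤ circleAverage (fun z => (3 * (ε * N) ^ 2) • ((∑ i, ‖A i z - B i z‖ ^ 2 +
          ∑ i, ‖B i z - β i‖ ^ 2) + b)) c r := by
        refine circleAverage_mono (c1'.circleIntegrable hr.le)
          (ContinuousOn.circleIntegrable hr.le
            (((c1'.add c2').add continuousOn_const).const_smul (3 * (ε * N) ^ 2))) fun z hz => ?_
        rw [abs_of_pos hr] at hz
        have s1 : ∑ i, ‖A i z - B i z‖ ^ 2 ≤ N * (ε ^ 2 * (N * ∑ k, ‖A k z‖ ^ 2)) := by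
          refine (Finset.sum_le_card_nsmul _ _ (ε ^ 2 * (N * ∑ k, ‖A k z‖ ^ 2))
            fun i _ => ?_).trans (by simp [N])
          calc ‖A i z - B i z‖ ^ 2 ≤ (ε * ∑ k, ‖A k z‖) ^ 2 := by gcongr; exact h z hz i
            _ = ε ^ 2 * (∑ k, ‖A k z‖) ^ 2 := by ring
            _ ≤ _ := by gcongr; exact sum_mul_le_card_mul_sum_sq _
        have s2 : ∑ k, ‖A k z‖ ^ 2 ≤ 3 * ((∑ i, ‖A i z - B i z‖ ^ 2 +
            ∑ i, ‖B i z - β i‖ ^ 2) + b) := by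
          simp only [b, ← Finset.sum_add_distrib, Finset.mul_sum]
          refine Finset.sum_le_sum fun k _ => ?_
          have e : A k z = (A k z - B k z) + (B k z - β k) + β k := by ring
          have h1 : ‖A k z‖ ≤ ‖A k z - B k z‖ + ‖B k z - β k‖ + ‖β k‖ := by
            conv_lhs => rw [e]
            exact norm_add₃_le
          have h2 : ‖A k z‖ ^ 2 ≤ (‖A k z - B k z‖ + ‖B k z - β k‖ + ‖β k‖) ^ 2 := by gcongr
          nlinarith [sq_nonneg (‖A k z - B k z‖ - ‖B k z - β k‖),
            sq_nonneg (‖A k z - B k z‖ - ‖β k‖), sq_nonneg (‖B k z - β k‖ - ‖β k‖)]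
        rw [smul_eq_mul]
        calc _ ≤ N * (ε ^ 2 * (N * ∑ k, ‖A k z‖ ^ 2)) := s1
          _ ≤ N * (ε ^ 2 * (N * (3 * ((∑ i, ‖A i z - B i z‖ ^ 2 +
            ∑ i, ‖B i z - β i‖ ^ 2) + b)))) := by gcongr
          _ = _ := by ring
    _ = _ := by
        rw [circleAverage_fun_smul, circleAverage_fun_add
          (ContinuousOn.circleIntegrable hr.le
            (f := fun z => ∑ i, ‖A i z - B i z‖ ^ 2 + ∑ i, ‖B i z - β i‖ ^ 2) (c1'.add c2'))
          (circleIntegrable_const _ _ _),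
          circleAverage_fun_add (c1'.circleIntegrable hr.le) (c2'.circleIntegrable hr.le),
          circleAverage_const, smul_eq_mul]

/-- A family of functions, holomorphic inside and outside two disjoint circles, whose jumps on the
circles are small relative to its inner boundary values, is close to its value at infinity at unit
distance from the disks. -/
theorem exists_norm_sub_le_of_small_jumps {ι : Type*} [Fintype ι] {c₀ c₁ : ℂ} {r₀ r₁ : ℝ}
    (hr₀ : 0 < r₀) (hr₁ : 0 < r₁) (hdist : r₀ + r₁ < dist c₀ c₁) (β : ι → ℂ) :
    ∃ C ε₀ : ℝ, 0 < C ∧ 0 < ε₀ ∧ ∀ (A₀ A₁ B : ι → ℂ → ℂ) (ε : ℝ), 0 ≤ ε → ε ≤ ε₀ →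
      (∀ i, DiffContOnCl ℂ (A₀ i) (ball c₀ r₀)) → (∀ i, DiffContOnCl ℂ (A₁ i) (ball c₁ r₁)) →
      (∀ i, ContinuousOn (B i) (ball c₀ r₀ ∪ ball c₁ r₁)ᶜ) →
      (∀ i, DifferentiableOn ℂ (B i) (closedBall c₀ r₀ ∪ closedBall c₁ r₁)ᶜ) →
      (∀ i, Tendsto (B i) (Bornology.cobounded ℂ) (𝓝 (β i))) →
      (∀ z ∈ sphere c₀ r₀, ∀ i, ‖A₀ i z - B i z‖ ≤ ε * ∑ k, ‖A₀ k z‖) →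
      (∀ z ∈ sphere c₁ r₁, ∀ i, ‖A₁ i z - B i z‖ ≤ ε * ∑ k, ‖A₁ k z‖) →
      ∀ z, r₀ + 1 ≤ dist z c₀ → r₁ + 1 ≤ dist z c₁ → ∀ i, ‖B i z - β i‖ ≤ C * ε := by
  set d := dist c₀ c₁ - r₀ - r₁ with hd
  have hd0 : 0 < d := by rw [hd]; linarith
  set κ := (r₀ / d) ^ 2 + (r₁ / d) ^ 2 with hκ
  have hκ0 : 0 ≤ κ := by positivity
  set N : ℝ := (Fintype.card ι : ℝ) with hN
  have hN0 : 0 ≤ N := Nat.cast_nonneg _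
  set b : ℝ := ∑ i, ‖β i‖ ^ 2 with hb
  have hb0 : 0 ≤ b := Finset.sum_nonneg fun i _ => by positivity
  set q : ℝ := 6 * (N + 1) ^ 2 * (3 + 2 * κ) with hq
  have hq0 : 0 < q := by positivity
  refine ⟨(r₀ + r₁) * √(12 * (N + 1) ^ 2 * (b + 1)), √(q⁻¹), by positivity, by positivity, ?_⟩
  intro A₀ A₁ B ε hε hεle hA₀ hA₁ hB hBd hlim hj₀ hj₁ z hz₀ hz₁ i
  have hnot : ∀ w ∈ closedBall c₀ r₀, w ∉ closedBall c₁ r₁ := by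
    intro w h1 h2
    have := dist_triangle_left c₀ c₁ w
    rw [mem_closedBall] at h1 h2
    linarith
  have hs₀ : sphere c₀ r₀ ⊆ (ball c₀ r₀ ∪ ball c₁ r₁)ᶜ := by
    rintro w hw (h | h)
    · exact (ne_of_lt (mem_ball.1 h)) (mem_sphere.1 hw)
    · exact hnot w (sphere_subset_closedBall hw) (ball_subset_closedBall h)
  have hs₁ : sphere c₁ r₁ ⊆ (ball c₀ r₀ ∪ ball c₁ r₁)ᶜ := by
    rintro w hw (h | h)
    · exact hnot w (ball_subset_closedBall h) (sphere_subset_closedBall hw)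
    · exact (ne_of_lt (mem_ball.1 h)) (mem_sphere.1 hw)
  have hA₀c : ∀ i, ContinuousOn (A₀ i) (sphere c₀ r₀) := fun i => by
    have := (hA₀ i).continuousOn
    rw [closure_ball c₀ hr₀.ne'] at this
    exact this.mono sphere_subset_closedBall
  have hA₁c : ∀ i, ContinuousOn (A₁ i) (sphere c₁ r₁) := fun i => by
    have := (hA₁ i).continuousOn
    rw [closure_ball c₁ hr₁.ne'] at this
    exact this.mono sphere_subset_closedBall
  set D₀ := ∑ i, circleAverage (fun z => ‖A₀ i z - B i z‖ ^ 2) c₀ r₀ with hD₀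
  set D₁ := ∑ i, circleAverage (fun z => ‖A₁ i z - B i z‖ ^ 2) c₁ r₁ with hD₁
  have hterm₀ : ∀ i, 0 ≤ circleAverage (fun z => ‖A₀ i z - B i z‖ ^ 2) c₀ r₀ := fun i =>
    circleAverage_nonneg_of_nonneg fun z _ => by positivity
  have hterm₁ : ∀ i, 0 ≤ circleAverage (fun z => ‖A₁ i z - B i z‖ ^ 2) c₁ r₁ := fun i =>
    circleAverage_nonneg_of_nonneg fun z _ => by positivity
  have hD₀0 : 0 ≤ D₀ := Finset.sum_nonneg fun i _ => hterm₀ i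
  have hD₁0 : 0 ≤ D₁ := Finset.sum_nonneg fun i _ => hterm₁ i
  have o₀ : ∑ i, circleAverage (fun z => ‖B i z - β i‖ ^ 2) c₀ r₀ ≤
      2 * D₀ + 2 * (r₁ / d) ^ 2 * D₁ := by
    rw [hD₀, hD₁, Finset.mul_sum, Finset.mul_sum, ← Finset.sum_add_distrib]
    exact Finset.sum_le_sum fun i _ =>
      circleAverage_outer_le hr₀ hr₁ hdist (hA₀ i) (hA₁ i) (hB i) (hBd i) (hlim i)
  have o₁ : ∑ i, circleAverage (fun z => ‖B i z - β i‖ ^ 2) c₁ r₁ ≤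
      2 * D₁ + 2 * (r₀ / d) ^ 2 * D₀ := by
    rw [hD₀, hD₁, Finset.mul_sum, Finset.mul_sum, ← Finset.sum_add_distrib]
    refine Finset.sum_le_sum fun i _ => ?_
    have hdd : d = dist c₁ c₀ - r₁ - r₀ := by rw [hd, dist_comm]; ring
    rw [hdd]
    exact circleAverage_outer_le hr₁ hr₀ (by rw [dist_comm]; linarith) (hA₁ i) (hA₀ i)
      (by rw [union_comm]; exact hB i) (by rw [union_comm]; exact hBd i) (hlim i)
  have j₀ := sum_circleAverage_jump_le hr₀ β hA₀c (fun i => (hB i).mono hs₀) hj₀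
  have j₁ := sum_circleAverage_jump_le hr₁ β hA₁c (fun i => (hB i).mono hs₁) hj₁
  rw [← hD₀, ← hb, ← hN] at j₀
  rw [← hD₁, ← hb, ← hN] at j₁
  set p := 3 * (ε * N) ^ 2 with hp
  have hp0 : 0 ≤ p := by positivity
  have hε2 : ε ^ 2 ≤ q⁻¹ := by
    calc ε ^ 2 ≤ √(q⁻¹) ^ 2 := by gcongr
      _ = q⁻¹ := Real.sq_sqrt (by positivity)
  have hpq : p * (3 + 2 * κ) ≤ 1 / 2 := by
    have h1 : p * (3 + 2 * κ) ≤ 3 * (N + 1) ^ 2 * (3 + 2 * κ) * ε ^ 2 := by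
      have : N ^ 2 ≤ (N + 1) ^ 2 := by gcongr; linarith
      calc p * (3 + 2 * κ) = 3 * N ^ 2 * (3 + 2 * κ) * ε ^ 2 := by rw [hp]; ring
        _ ≤ _ := by gcongr
    have h2 : 3 * (N + 1) ^ 2 * (3 + 2 * κ) * ε ^ 2 ≤ q / 2 * q⁻¹ := by
      have : q / 2 = 3 * (N + 1) ^ 2 * (3 + 2 * κ) := by rw [hq]; ring
      rw [this]; gcongr
    have h3 : q / 2 * q⁻¹ = 1 / 2 := by field_simp
    linarith
  -- the jump terms on the right are absorbed
  have hD : D₀ + D₁ ≤ 4 * p * b := by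
    have h1 : D₀ + D₁ ≤ p * ((3 + 2 * κ) * (D₀ + D₁) + 2 * b) := by
      have hx : (r₁ / d) ^ 2 * D₁ ≤ κ * D₁ := by
        gcongr; rw [hκ]; linarith [sq_nonneg (r₀ / d)]
      have hy : (r₀ / d) ^ 2 * D₀ ≤ κ * D₀ := by
        gcongr; rw [hκ]; linarith [sq_nonneg (r₁ / d)]
      calc D₀ + D₁ ≤ _ := add_le_add j₀ j₁
        _ = p * ((D₀ + D₁) + (∑ i, circleAverage (fun z => ‖B i z - β i‖ ^ 2) c₀ r₀ +
              ∑ i, circleAverage (fun z => ‖B i z - β i‖ ^ 2) c₁ r₁) + 2 * b) := by ring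
        _ ≤ _ := by
          refine mul_le_mul_of_nonneg_left ?_ hp0
          linarith
    have h2 : p * (3 + 2 * κ) * (D₀ + D₁) ≤ 1 / 2 * (D₀ + D₁) := by gcongr
    nlinarith
  have hzout : z ∈ (closedBall c₀ r₀ ∪ closedBall c₁ r₁)ᶜ := by
    rintro (h | h)
    · rw [mem_closedBall] at h; linarith
    · rw [mem_closedBall] at h; linarith
  have hfar : ∀ {c : ℂ} {r : ℝ}, r + 1 ≤ dist z c → ∀ ζ ∈ sphere c r, 1 ≤ ‖ζ - z‖ := by
    intro c r h ζ hζ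
    rw [mem_sphere] at hζ
    have := dist_triangle z ζ c
    rw [← dist_eq_norm, dist_comm]
    linarith
  have b₀ := norm_circleCauchy_sq_le hr₀ one_pos (((hA₀c i).sub ((hB i).mono hs₀))) (hfar hz₀)
  have b₁ := norm_circleCauchy_sq_le hr₁ one_pos (((hA₁c i).sub ((hB i).mono hs₁))) (hfar hz₁)
  rw [div_one] at b₀ b₁
  set s := √(12 * (N + 1) ^ 2 * (b + 1)) with hs
  have hDs : D₀ + D₁ ≤ (s * ε) ^ 2 := by
    rw [mul_pow, hs, Real.sq_sqrt (by positivity)]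
    refine hD.trans ?_
    have : N ^ 2 ≤ (N + 1) ^ 2 := by gcongr; linarith
    calc 4 * p * b = 12 * N ^ 2 * b * ε ^ 2 := by rw [hp]; ring
      _ ≤ 12 * (N + 1) ^ 2 * (b + 1) * ε ^ 2 := by gcongr; linarith
  have hi₀ : circleAverage (fun z => ‖A₀ i z - B i z‖ ^ 2) c₀ r₀ ≤ (s * ε) ^ 2 := by
    have := Finset.single_le_sum (fun k _ => hterm₀ k) (Finset.mem_univ i)
    rw [← hD₀] at this; linarith
  have hi₁ : circleAverage (fun z => ‖A₁ i z - B i z‖ ^ 2) c₁ r₁ ≤ (s * ε) ^ 2 := by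
    have := Finset.single_le_sum (fun k _ => hterm₁ k) (Finset.mem_univ i)
    rw [← hD₁] at this; linarith
  have n₀ : ‖circleCauchy (fun ζ => A₀ i ζ - B i ζ) c₀ r₀ z‖ ≤ r₀ * (s * ε) := by
    refine le_of_sq_le_sq ?_ (by positivity)
    rw [mul_pow]
    exact b₀.trans (mul_le_mul_of_nonneg_left hi₀ (by positivity))
  have n₁ : ‖circleCauchy (fun ζ => A₁ i ζ - B i ζ) c₁ r₁ z‖ ≤ r₁ * (s * ε) := by
    refine le_of_sq_le_sq ?_ (by positivity)
    rw [mul_pow]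
    exact b₁.trans (mul_le_mul_of_nonneg_left hi₁ (by positivity))
  rw [eq_add_circleCauchy hr₀ hr₁ hdist (hA₀ i) (hA₁ i) (hB i) (hBd i) (hlim i) hzout]
  calc _ = ‖circleCauchy (fun ζ => A₀ i ζ - B i ζ) c₀ r₀ z +
        circleCauchy (fun ζ => A₁ i ζ - B i ζ) c₁ r₁ z‖ := by congr 1; ring
    _ ≤ r₀ * (s * ε) + r₁ * (s * ε) := (norm_add_le _ _).trans (add_le_add n₀ n₁)
    _ = _ := by ring

end TwoCircles

/-! ### The solid Cauchy transform -/

section SolidCauchy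

open Metric Real MeasureTheory

/-- The Wirtinger derivative `∂f/∂z̄ = (∂f/∂x + i ∂f/∂y) / 2` of a function of a complex variable
with real derivative. -/
noncomputable def dbar {F : Type*} [NormedAddCommGroup F] [NormedSpace ℂ F] (f : ℂ → F) (z : ℂ) :
    F :=
  (2⁻¹ : ℂ) • (fderiv ℝ f z 1 + Complex.I • fderiv ℝ f z Complex.I)

theorem differentiableAt_complex_of_dbar_eq_zero {F : Type*} [NormedAddCommGroup F]
    [NormedSpace ℂ F] {f : ℂ → F} {z : ℂ} (hf : DifferentiableAt ℝ f z) (h : dbar f z = 0) :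
    DifferentiableAt ℂ f z := by
  rw [differentiableAt_complex_iff_differentiableAt_real]
  refine ⟨hf, ?_⟩
  have h1 : fderiv ℝ f z 1 + Complex.I • fderiv ℝ f z Complex.I = 0 := by
    rw [dbar, smul_eq_zero] at h
    exact h.resolve_left (by norm_num)
  rw [eq_neg_of_add_eq_zero_left h1, smul_neg, smul_smul, Complex.I_mul_I, neg_one_smul, neg_neg]

theorem dbar_eq_zero {F : Type*} [NormedAddCommGroup F]
    [NormedSpace ℂ F] {f : ℂ → F} {z : ℂ} (hf : DifferentiableAt ℂ f z) : dbar f z = 0 := by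
  rw [dbar, (differentiableAt_complex_iff_differentiableAt_real.1 hf).2, smul_smul,
    Complex.I_mul_I, neg_one_smul, add_neg_cancel, smul_zero]

/-- The fundamental solution `1 / (πz)` of the Wirtinger operator. -/
noncomputable def cauchyKernel (z : ℂ) : ℂ := ((π : ℂ) * z)⁻¹

theorem norm_cauchyKernel (z : ℂ) : ‖cauchyKernel z‖ = (π * ‖z‖)⁻¹ := by
  rw [cauchyKernel, norm_inv, norm_mul, Complex.norm_real, Real.norm_of_nonneg pi_pos.le]

theorem measurable_cauchyKernel : Measurable cauchyKernel :=
  (measurable_const.mul measurable_id).inv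

theorem integrableOn_cauchyKernel_ball : IntegrableOn cauchyKernel (ball 0 1) := by
  have h1 : Integrable (fun z : ℂ => (Iio (1 : ℝ)).indicator (fun y => (π * y)⁻¹) ‖z‖) := by
    rw [integrable_fun_norm_addHaar volume (f := (Iio (1 : ℝ)).indicator (fun y => (π * y)⁻¹))]
    have : IntegrableOn (fun _ : ℝ => (π)⁻¹) (Ioo 0 1) := by simp
    refine (this.congr_fun (fun y hy => ?_) measurableSet_Ioo).of_forall_sdiff_eq_zero
      measurableSet_Ioi fun y hy => ?_
    · have hy0 : y ≠ 0 := hy.1.ne'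
      rw [indicator_of_mem (show y ∈ Iio (1 : ℝ) from hy.2), Complex.finrank_real_complex]
      simp only [Nat.add_one_sub_one, pow_one, smul_eq_mul]
      field_simp
    · rw [indicator_of_notMem (show y ∉ Iio (1 : ℝ) from fun h => hy.2 ⟨hy.1, h⟩), smul_zero]
  refine (integrable_norm_iff measurable_cauchyKernel.aestronglyMeasurable).1 ?_
  refine (h1.integrableOn (s := ball 0 1)).congr_fun (fun z hz => ?_) measurableSet_ball
  have : ‖z‖ < 1 := by simpa using hz
  simp only [norm_cauchyKernel]
  rw [indicator_of_mem (show ‖z‖ ∈ Iio (1 : ℝ) from this)]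

theorem integrableOn_cauchyKernel {s : Set ℂ} (hs : MeasurableSet s) (hb : volume s ≠ ⊤) :
    IntegrableOn cauchyKernel s := by
  have h1 : IntegrableOn cauchyKernel (s ∩ ball 0 1) :=
    integrableOn_cauchyKernel_ball.mono_set inter_subset_right
  have h2 : IntegrableOn cauchyKernel (s \ ball 0 1) := by
    have hfin : volume (s \ ball 0 1) < ⊤ :=
      (measure_mono sdiff_subset).trans_lt hb.lt_top
    refine Measure.integrableOn_of_bounded (M := π⁻¹) hfin.ne
      measurable_cauchyKernel.aestronglyMeasurable ?_
    refine (ae_restrict_iff' (hs.diff measurableSet_ball)).2 (Eventually.of_forall fun z hz => ?_)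
    have : 1 ≤ ‖z‖ := by simpa using hz.2
    rw [norm_cauchyKernel]
    gcongr
    nlinarith [pi_pos]
  rw [← inter_union_sdiff s (ball 0 1)]
  exact h1.union h2

theorem locallyIntegrable_cauchyKernel : LocallyIntegrable cauchyKernel := fun z =>
  ⟨closedBall z 1, closedBall_mem_nhds z one_pos, integrableOn_cauchyKernel
    measurableSet_closedBall measure_closedBall_lt_top.ne⟩

/-- A bound for the mass of the Cauchy kernel on all disks of radius `R`. -/
noncomputable def cauchyMass (R : ℝ) : ℝ :=
  (∫ t in ball (0 : ℂ) 1, ‖cauchyKernel t‖) + π⁻¹ * volume.real (closedBall (0 : ℂ) R) + 1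

theorem cauchyMass_pos (R : ℝ) : 0 < cauchyMass R := by
  have : 0 ≤ ∫ t in ball (0 : ℂ) 1, ‖cauchyKernel t‖ := integral_nonneg fun _ => norm_nonneg _
  unfold cauchyMass; positivity

theorem volume_real_closedBall_center (z : ℂ) (R : ℝ) :
    volume.real (closedBall z R) = volume.real (closedBall (0 : ℂ) R) := by
  rw [Measure.real, Measure.real, Measure.addHaar_closedBall_center]

theorem setIntegral_norm_cauchyKernel_le {s : Set ℂ} (hs : MeasurableSet s) (hb : volume s ≠ ⊤)
    {a : ℝ} (ha : ∀ t ∈ s, (π * ‖t‖)⁻¹ ≤ a) :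
    ∫ t in s, ‖cauchyKernel t‖ ≤ a * volume.real s := by
  have h := setIntegral_mono_on (integrableOn_cauchyKernel hs hb).norm
    (integrableOn_const (C := a) hb) hs fun t ht => by
      rw [norm_cauchyKernel]; exact ha t ht
  rwa [setIntegral_const, smul_eq_mul, mul_comm] at h

theorem setIntegral_cauchyKernel_le_mass (z : ℂ) (R : ℝ) :
    ∫ t in closedBall z R, ‖cauchyKernel t‖ ≤ cauchyMass R := by
  have hb := (measure_closedBall_lt_top (μ := volume) (x := z) (r := R)).ne
  have hint := (integrableOn_cauchyKernel measurableSet_closedBall hb).norm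
  rw [← integral_inter_add_sdiff measurableSet_ball hint (t := ball 0 1)]
  have h1 : ∫ t in closedBall z R ∩ ball 0 1, ‖cauchyKernel t‖ ≤
      ∫ t in ball (0 : ℂ) 1, ‖cauchyKernel t‖ :=
    setIntegral_mono_set integrableOn_cauchyKernel_ball.norm
      (Eventually.of_forall fun _ => norm_nonneg _) inter_subset_right.eventuallyLE
  have hb' : volume (closedBall z R \ ball 0 1) ≠ ⊤ :=
    ((measure_mono sdiff_subset).trans_lt hb.lt_top).ne
  have h2 := setIntegral_norm_cauchyKernel_le (measurableSet_closedBall.diff measurableSet_ball) hb'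
    (a := π⁻¹) fun t ht => by
      have : 1 ≤ ‖t‖ := by simpa using ht.2
      gcongr
      nlinarith [pi_pos]
  have h3 : volume.real (closedBall z R \ ball 0 1) ≤ volume.real (closedBall (0 : ℂ) R) := by
    rw [← volume_real_closedBall_center z R]
    exact measureReal_mono sdiff_subset hb
  have h4 : π⁻¹ * volume.real (closedBall z R \ ball 0 1) ≤
      π⁻¹ * volume.real (closedBall (0 : ℂ) R) := by gcongr
  unfold cauchyMass; linarith

variable {F : Type*} [NormedAddCommGroup F] [NormedSpace ℂ F]

/-- The solid Cauchy transform, the convolution of a compactly supported function with the Cauchy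
kernel; it inverts the Wirtinger operator. -/
noncomputable def solidCauchy (f : ℂ → F) (z : ℂ) : F :=
  ∫ t, cauchyKernel t • f (z - t)

theorem norm_solidCauchy_le_setIntegral {f : ℂ → F} {M R : ℝ} (hf : ∀ z, ‖f z‖ ≤ M)
    (hs : ∀ z, R < ‖z‖ → f z = 0) (z : ℂ) :
    ‖solidCauchy f z‖ ≤ M * ∫ t in closedBall z R, ‖cauchyKernel t‖ := by
  have hoff : ∀ t, t ∉ closedBall z R → cauchyKernel t • f (z - t) = 0 := fun t ht => by
    rw [hs, smul_zero]
    rw [mem_closedBall, dist_eq_norm, not_le, norm_sub_rev] at ht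
    exact ht
  have : solidCauchy f z = ∫ t in closedBall z R, cauchyKernel t • f (z - t) :=
    (setIntegral_eq_integral_of_forall_compl_eq_zero hoff).symm
  rw [this, ← integral_const_mul]
  refine norm_integral_le_of_norm_le ?_ (Eventually.of_forall fun t => ?_)
  · exact ((integrableOn_cauchyKernel measurableSet_closedBall
      measure_closedBall_lt_top.ne).norm).const_mul M
  · rw [norm_smul, mul_comm]
    exact mul_le_mul_of_nonneg_right (hf _) (norm_nonneg _)

theorem norm_solidCauchy_le {f : ℂ → F} {M R : ℝ} (hf : ∀ z, ‖f z‖ ≤ M)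
    (hs : ∀ z, R < ‖z‖ → f z = 0) (z : ℂ) : ‖solidCauchy f z‖ ≤ cauchyMass R * M := by
  have hM : 0 ≤ M := (norm_nonneg _).trans (hf 0)
  rw [mul_comm]
  exact (norm_solidCauchy_le_setIntegral hf hs z).trans
    (mul_le_mul_of_nonneg_left (setIntegral_cauchyKernel_le_mass z R) hM)

theorem tendsto_solidCauchy_cobounded {f : ℂ → F} {M R : ℝ} (hf : ∀ z, ‖f z‖ ≤ M)
    (hs : ∀ z, R < ‖z‖ → f z = 0) :
    Tendsto (solidCauchy f) (Bornology.cobounded ℂ) (𝓝 0) := by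
  have hM : 0 ≤ M := (norm_nonneg _).trans (hf 0)
  have h1 : Tendsto (fun z : ℂ => ‖z‖ - R) (Bornology.cobounded ℂ) atTop :=
    tendsto_atTop_add_const_right _ _ tendsto_norm_cobounded_atTop
  set v := volume.real (closedBall (0 : ℂ) R)
  have h2 : Tendsto (fun z : ℂ => M * ((π * (‖z‖ - R))⁻¹ * v)) (Bornology.cobounded ℂ) (𝓝 0) := by
    have := ((h1.const_mul_atTop pi_pos).inv_tendsto_atTop.mul_const v).const_mul M
    simpa using this
  refine squeeze_zero_norm' ?_ h2
  filter_upwards [h1.eventually_gt_atTop 0] with z hz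
  refine (norm_solidCauchy_le_setIntegral hf hs z).trans (mul_le_mul_of_nonneg_left ?_ hM)
  have := setIntegral_norm_cauchyKernel_le (measurableSet_closedBall (x := z) (ε := R))
    measure_closedBall_lt_top.ne (a := (π * (‖z‖ - R))⁻¹) fun t ht => by
      have h3 : ‖z - t‖ ≤ R := by rw [← dist_eq_norm, dist_comm]; exact ht
      have h4 := norm_sub_norm_le z t
      gcongr
      linarith
  rwa [volume_real_closedBall_center] at this

theorem solidCauchy_eq_convolution (f : ℂ → F) :
    solidCauchy f = convolution cauchyKernel f (ContinuousLinearMap.lsmul ℝ ℂ) volume := rfl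

theorem contDiff_solidCauchy {f : ℂ → F} (hf : ContDiff ℝ 1 f)
    (hc : HasCompactSupport f) : ContDiff ℝ 1 (solidCauchy f) := by
  rw [solidCauchy_eq_convolution]
  exact hc.contDiff_convolution_right _ locallyIntegrable_cauchyKernel hf

theorem hasFDerivAt_solidCauchy {f : ℂ → F} (hf : ContDiff ℝ 1 f)
    (hc : HasCompactSupport f) (z : ℂ) :
    HasFDerivAt (solidCauchy f) (solidCauchy (fderiv ℝ f) z) z := by
  rw [solidCauchy_eq_convolution]
  exact hc.hasFDerivAt_convolution_right _ locallyIntegrable_cauchyKernel hf z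

theorem integrable_cauchyKernel_smul {f : ℂ → F} (hf : Continuous f) (hc : HasCompactSupport f)
    (z : ℂ) : Integrable fun t => cauchyKernel t • f (z - t) :=
  hc.convolutionExists_right (ContinuousLinearMap.lsmul ℝ ℂ) locallyIntegrable_cauchyKernel hf z

/-- The Cauchy–Pompeiu formula for compactly supported functions. In polar coordinates around `z`
the kernel cancels the Jacobian, the radial part of the derivative integrates to the value at the
centre and the angular part to zero. -/
theorem integral_cauchyKernel_smul_dbar [CompleteSpace F] {g : ℂ → F} (hg : ContDiff ℝ 1 g)
    (hc : HasCompactSupport g) (z : ℂ) : ∫ t, cauchyKernel t • dbar g (z - t) = g z := by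
  obtain ⟨R, hR⟩ : ∃ R, ∀ w, R < ‖w‖ → g w = 0 := by
    obtain ⟨R, hR⟩ := hc.isCompact.isBounded.subset_closedBall 0
    exact ⟨R, fun w hw => by
      by_contra h
      have := hR (subset_tsupport g h)
      rw [mem_closedBall_zero_iff] at this
      linarith⟩
  have hR' : ∀ w, R < ‖w‖ → fderiv ℝ g w = 0 := fun w hw => by
    have : g =ᶠ[𝓝 w] fun _ => 0 := by
      filter_upwards [(isOpen_lt continuous_const continuous_norm).mem_nhds hw] with v hv
      exact hR v hv
    rw [this.fderiv_eq]; simp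
  set e : ℝ → ℂ := fun θ => Complex.exp (θ * Complex.I) with he
  have hec : Continuous e := by fun_prop
  have hen : ∀ θ, ‖e θ‖ = 1 := fun θ => Complex.norm_exp_ofReal_mul_I θ
  have hde : ∀ θ, HasDerivAt e (Complex.I * e θ) θ := fun θ => by
    have h1 : HasDerivAt (fun θ : ℝ => (θ : ℂ) * Complex.I) (1 * Complex.I) θ :=
      (HasDerivAt.ofReal_comp (hasDerivAt_id θ)).mul_const Complex.I
    have := h1.cexp
    rwa [one_mul, mul_comm] at this
  set pt : ℝ × ℝ → ℂ := fun p => z - p.1 * e p.2 with hpt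
  have hptc : Continuous pt := by fun_prop
  have hDc : Continuous (fderiv ℝ g) := hg.continuous_fderiv one_ne_zero
  set P : ℝ × ℝ → F := fun p => fderiv ℝ g (pt p) (e p.2) with hP
  set Q : ℝ × ℝ → F := fun p => fderiv ℝ g (pt p) (Complex.I * e p.2) with hQ
  have hPc : Continuous P := (hDc.comp hptc).clm_apply (hec.comp continuous_snd)
  have hQc : Continuous Q :=
    (hDc.comp hptc).clm_apply (continuous_const.mul (hec.comp continuous_snd))
  set S : Set (ℝ × ℝ) := Ioi 0 ×ˢ Ioo (-π) π with hS
  have hSm : MeasurableSet S := measurableSet_Ioi.prod measurableSet_Ioo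
  set L := max R 0 + ‖z‖ + 1 with hL
  have hfar : ∀ p : ℝ × ℝ, L ≤ p.1 → R < ‖pt p‖ := by
    intro p hp
    have h1 : ‖(p.1 : ℂ) * e p.2‖ = p.1 := by
      rw [norm_mul, hen, mul_one, Complex.norm_real, Real.norm_of_nonneg]
      have := le_max_right R 0
      linarith [norm_nonneg z]
    have h2 := norm_sub_norm_le ((p.1 : ℂ) * e p.2) z
    rw [h1, norm_sub_rev] at h2
    have := le_max_left R 0
    simp only [hpt]; linarith
  have hint : ∀ G : ℝ × ℝ → F, Continuous G → (∀ p, L ≤ p.1 → G p = 0) → IntegrableOn G S := by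
    intro G hG h0
    have hcomp : IsCompact (Icc (0 : ℝ) L ×ˢ Icc (-π) π) := isCompact_Icc.prod isCompact_Icc
    refine (hG.continuousOn.integrableOn_compact hcomp).of_forall_sdiff_eq_zero hSm ?_
    rintro ⟨r, θ⟩ ⟨⟨h1, h2⟩, h3⟩
    refine h0 _ ?_
    by_contra hlt
    exact h3 ⟨⟨le_of_lt h1, (not_le.1 hlt).le⟩, Ioo_subset_Icc_self h2⟩
  have hPi : IntegrableOn P S := hint P hPc fun p hp => by simp [hP, hR' _ (hfar p hp)]
  have hQi : IntegrableOn Q S := hint Q hQc fun p hp => by simp [hQ, hR' _ (hfar p hp)]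
  have hvol : (volume : Measure (ℝ × ℝ)).restrict S =
      ((volume : Measure ℝ).restrict (Ioi 0)).prod ((volume : Measure ℝ).restrict (Ioo (-π) π)) := by
    rw [Measure.prod_restrict]; rfl
  -- the radial part
  have hPint : ∫ p in S, P p = (2 * π : ℝ) • g z := by
    have hPi' := hPi
    rw [IntegrableOn, hvol] at hPi'
    rw [hvol, integral_prod_symm _ hPi']
    have : ∀ θ : ℝ, ∫ r in Ioi (0 : ℝ), P (r, θ) = g z := by
      intro θ
      have hd : ∀ r ∈ Ici (0 : ℝ), HasDerivAt (fun r : ℝ => -g (pt (r, θ))) (P (r, θ)) r := by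
        intro r _
        have h1 : HasDerivAt (fun r : ℝ => pt (r, θ)) (-e θ) r := by
          have := ((HasDerivAt.ofReal_comp (hasDerivAt_id r)).mul_const (e θ)).const_sub z
          simpa [hpt] using this
        have h2 := ((hg.differentiable one_ne_zero (pt (r, θ))).hasFDerivAt.comp_hasDerivAt r h1).neg
        simp only [map_neg, neg_neg] at h2
        exact h2
      have hz : ∀ r, L ≤ r → P (r, θ) = 0 := fun r hr => by simp [hP, hR' _ (hfar (r, θ) hr)]
      have hi : IntegrableOn (fun r => P (r, θ)) (Ioi 0) := by
        have hcr : Continuous fun r => P (r, θ) := hPc.comp (by fun_prop)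
        refine (hcr.continuousOn.integrableOn_compact (isCompact_Icc (a := 0) (b := L)))
          |>.of_forall_sdiff_eq_zero measurableSet_Ioi ?_
        rintro r ⟨h1, h2⟩
        refine hz r ?_
        by_contra hlt
        exact h2 ⟨le_of_lt h1, (not_le.1 hlt).le⟩
      have ht : Tendsto (fun r : ℝ => -g (pt (r, θ))) atTop (𝓝 0) := by
        refine tendsto_const_nhds.congr' ?_
        filter_upwards [eventually_ge_atTop L] with r hr
        rw [hR _ (hfar (r, θ) hr), neg_zero]
      rw [integral_Ioi_of_hasDerivAt_of_tendsto' hd hi ht]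
      simp [hpt]
    simp only [this, integral_const]
    congr 1
    simp [Measure.real, two_mul]
    positivity
  -- the angular part
  have hQint : ∫ p in S, Q p = 0 := by
    have hQi' := hQi
    rw [IntegrableOn, hvol] at hQi'
    rw [hvol, integral_prod _ hQi']
    refine (setIntegral_congr_fun measurableSet_Ioi fun r hr => ?_).trans (integral_zero _ _)
    have hr : (0 : ℝ) < r := hr
    have hd : ∀ θ : ℝ, HasDerivAt (fun θ : ℝ => -(r⁻¹ • g (pt (r, θ)))) (Q (r, θ)) θ := by
      intro θ
      have h1 : HasDerivAt (fun θ : ℝ => pt (r, θ)) (-(r • (Complex.I * e θ))) θ := by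
        have := ((hde θ).const_mul (r : ℂ)).const_sub z
        simpa [hpt] using this
      have h2 := (((hg.differentiable one_ne_zero (pt (r, θ))).hasFDerivAt.comp_hasDerivAt θ
        h1).fun_const_smul r⁻¹).fun_neg
      rw [map_neg, map_smul, smul_neg, neg_neg, smul_smul, inv_mul_cancel₀ hr.ne', one_smul] at h2
      exact h2
    have hcθ : Continuous fun θ => Q (r, θ) := hQc.comp (by fun_prop)
    rw [← integral_Ioc_eq_integral_Ioo, ← intervalIntegral.integral_of_le (by linarith [pi_pos]),
      intervalIntegral.integral_eq_sub_of_hasDerivAt (fun θ _ => hd θ)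
        (hcθ.intervalIntegrable _ _)]
    have hpm : e π = e (-π) := by
      simp only [he]
      rw [Complex.exp_pi_mul_I]
      push_cast
      rw [neg_mul, Complex.exp_neg, Complex.exp_pi_mul_I]; norm_num
    simp [hpt, hpm]
  rw [← Complex.integral_comp_polarCoord_symm]
  have hpolar : ∀ p ∈ S, p.1 • (cauchyKernel (Complex.polarCoord.symm p) •
      dbar g (z - Complex.polarCoord.symm p)) =
      ((2 * π : ℝ)⁻¹ : ℝ) • (P p + Complex.I • Q p) := by
    rintro ⟨r, θ⟩ ⟨hr, -⟩
    have hr : (0 : ℝ) < r := hr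
    have hsymm : Complex.polarCoord.symm (r, θ) = r * e θ := by
      rw [Complex.polarCoord_symm_apply, he]
      simp only [Complex.exp_mul_I, Complex.ofReal_cos, Complex.ofReal_sin]
    have hpte : z - (r : ℂ) * e θ = pt (r, θ) := rfl
    rw [hsymm, hpte]
    simp only [hP, hQ, dbar]
    set D := fderiv ℝ g (pt (r, θ))
    have hreal : ∀ v : ℂ, D v = (v.re : ℂ) • D 1 + (v.im : ℂ) • D Complex.I := fun v => by
      conv_lhs => rw [← Complex.re_add_im v]
      rw [map_add]
      have h1 : (v.re : ℂ) = v.re • (1 : ℂ) := by simp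
      have h2 : (v.im : ℂ) * Complex.I = v.im • Complex.I := by simp
      rw [h2, map_smul, ← Complex.coe_smul v.im]
      nth_rewrite 1 [h1]
      rw [map_smul, ← Complex.coe_smul v.re]
    have hre : (e θ).re = Real.cos θ := Complex.exp_ofReal_mul_I_re θ
    have him : (e θ).im = Real.sin θ := Complex.exp_ofReal_mul_I_im θ
    rw [hreal (e θ), hreal (Complex.I * e θ)]
    have e1 : (Complex.I * e θ).re = -Real.sin θ := by simp [him]
    have e2 : (Complex.I * e θ).im = Real.cos θ := by simp [hre]
    rw [hre, him, e1, e2]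
    have hker : (r : ℂ) * cauchyKernel (r * e θ) =
        (π : ℂ)⁻¹ * ((Real.cos θ : ℂ) - Real.sin θ * Complex.I) := by
      have hinv : (e θ)⁻¹ = (Real.cos θ : ℂ) - Real.sin θ * Complex.I := by
        have : (e θ)⁻¹ = Complex.exp ((-θ : ℝ) * Complex.I) := by
          simp only [he]; rw [← Complex.exp_neg]; congr 1; push_cast; ring
        rw [this, Complex.exp_mul_I]
        simp [sub_eq_add_neg]
      have hr' : (r : ℂ) ≠ 0 := by exact_mod_cast hr.ne'
      rw [← hinv, cauchyKernel, mul_inv, mul_inv]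
      field_simp
    rw [← Complex.coe_smul r, smul_smul, hker, ← Complex.coe_smul (2 * π)⁻¹]
    push_cast
    simp only [smul_add, smul_smul, ← add_assoc]
    match_scalars
    · ring
    · linear_combination (-(1 / 2) * (π : ℂ)⁻¹ * Complex.sin θ) * Complex.I_mul_I
  have htarget : polarCoord.target = S := rfl
  have hQI : IntegrableOn (fun p => Complex.I • Q p) S := hQi.smul Complex.I
  rw [htarget, setIntegral_congr_fun hSm hpolar, integral_smul,
    integral_add hPi hQI, integral_smul, hPint, hQint, smul_zero, add_zero,
    smul_smul, inv_mul_cancel₀ (by positivity), one_smul]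

theorem dbar_solidCauchy [CompleteSpace F] {f : ℂ → F} (hf : ContDiff ℝ 1 f)
    (hc : HasCompactSupport f) (z : ℂ) : dbar (solidCauchy f) z = f z := by
  have hDc : Continuous (fderiv ℝ f) := hf.continuous_fderiv one_ne_zero
  have hI := integrable_cauchyKernel_smul hDc (hc.fderiv ℝ) z
  have hI1 := hI.apply_continuousLinearMap 1
  have hI2 : MeasureTheory.Integrable
      fun t => Complex.I • (cauchyKernel t • fderiv ℝ f (z - t)) Complex.I :=
    (hI.apply_continuousLinearMap Complex.I).smul Complex.I
  rw [dbar, (hasFDerivAt_solidCauchy hf hc z).fderiv, solidCauchy,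
    ContinuousLinearMap.integral_apply hI, ContinuousLinearMap.integral_apply hI,
    ← integral_smul, ← integral_add hI1 hI2, ← integral_smul,
    ← integral_cauchyKernel_smul_dbar hf hc z]
  congr 1
  funext t
  simp only [dbar, smul_apply]
  module

end SolidCauchy

/-! ### Small Wirtinger equations -/

section Wirtinger

open Metric

variable {𝔸 : Type*} [NormedRing 𝔸] [NormedAlgebra ℂ 𝔸]

theorem dbar_mul {f g : ℂ → 𝔸} {z : ℂ} (hf : DifferentiableAt ℝ f z)
    (hg : DifferentiableAt ℝ g z) :
    dbar (fun w => f w * g w) z = f z * dbar g z + dbar f z * g z := by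
  simp only [dbar]
  rw [fderiv_fun_mul' hf hg]
  simp only [add_apply, smul_apply, smul_eq_mul, op_smul_eq_mul, mul_add, add_mul,
    smul_add, smul_mul_assoc, mul_smul_comm]
  abel

/-- The iterates of the integral equation `V = 1 - 𝒞(W V)`, `𝒞` the solid Cauchy transform. -/
noncomputable def wirtingerIterate (W : ℂ → 𝔸) : ℕ → ℂ → 𝔸
  | 0 => fun _ => 1
  | k + 1 => fun z => -solidCauchy (fun w => W w * wirtingerIterate W k w) z

variable {W : ℂ → 𝔸} {R w : ℝ}

theorem hasCompactSupport_of_forall_norm_lt {F : Type*} [Zero F] {W : ℂ → F} {R : ℝ}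
    (hs : ∀ z, R < ‖z‖ → W z = 0) : HasCompactSupport W :=
  HasCompactSupport.intro (isCompact_closedBall (0 : ℂ) R) fun z hz => hs z (by
    simpa using hz)

theorem contDiff_wirtingerIterate (hW : ContDiff ℝ 1 W) (hs : ∀ z, R < ‖z‖ → W z = 0) (k : ℕ) :
    ContDiff ℝ 1 (wirtingerIterate W k) := by
  induction k with
  | zero => exact contDiff_const
  | succ k ih =>
    refine (contDiff_solidCauchy (hW.mul ih) ?_).neg
    exact hasCompactSupport_of_forall_norm_lt fun z hz => by rw [hs z hz, zero_mul]

theorem norm_wirtingerIterate_le (hw : ∀ z, ‖W z‖ ≤ w) (hs : ∀ z, R < ‖z‖ → W z = 0)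
    (k : ℕ) (z : ℂ) : ‖wirtingerIterate W k z‖ ≤ (cauchyMass R * w) ^ k * ‖(1 : 𝔸)‖ := by
  have hw0 : 0 ≤ w := (norm_nonneg _).trans (hw 0)
  have hK := (cauchyMass_pos R).le
  induction k generalizing z with
  | zero => simp [wirtingerIterate]
  | succ k ih =>
    rw [wirtingerIterate, norm_neg]
    refine (norm_solidCauchy_le (M := w * ((cauchyMass R * w) ^ k * ‖(1 : 𝔸)‖)) (fun v => ?_)
      (fun v hv => by rw [hs v hv, zero_mul]) z).trans (le_of_eq (by ring))
    exact (norm_mul_le _ _).trans (mul_le_mul (hw v) (ih v) (norm_nonneg _) hw0)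

/-- The derivatives of the iterates are geometrically summable; no smallness of the derivative of
`W` is needed. -/
theorem exists_norm_fderiv_wirtingerIterate_le (hW : ContDiff ℝ 1 W) (hw : ∀ z, ‖W z‖ ≤ w)
    (hs : ∀ z, R < ‖z‖ → W z = 0) (hsmall : cauchyMass R * w ≤ 1 / 4) :
    ∃ B : ℝ, ∀ k z, ‖fderiv ℝ (wirtingerIterate W k) z‖ ≤ B * (1 / 2) ^ k := by
  have hw0 : 0 ≤ w := (norm_nonneg _).trans (hw 0)
  have hK := cauchyMass_pos R
  have hWc := hasCompactSupport_of_forall_norm_lt hs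
  obtain ⟨w', hw'⟩ : ∃ w', ∀ z, ‖fderiv ℝ W z‖ ≤ w' :=
    (hW.continuous_fderiv one_ne_zero).bounded_above_of_compact_support (hWc.fderiv ℝ)
  have hw'0 : 0 ≤ w' := (norm_nonneg _).trans (hw' 0)
  set B := 4 * (cauchyMass R * (w' * ‖(1 : 𝔸)‖)) with hB
  have hB0 : 0 ≤ B := by positivity
  refine ⟨B, fun k => ?_⟩
  induction k with
  | zero =>
    intro z
    have : fderiv ℝ (wirtingerIterate W 0) z = 0 := by
      simp [wirtingerIterate]
    rw [this, norm_zero]; positivity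
  | succ k ih =>
    intro z
    have hVk := contDiff_wirtingerIterate hW hs k
    have hf : ContDiff ℝ 1 fun v => W v * wirtingerIterate W k v := hW.mul hVk
    have hc : HasCompactSupport fun v => W v * wirtingerIterate W k v :=
      hasCompactSupport_of_forall_norm_lt fun z hz => by rw [hs z hz, zero_mul]
    have h1 : fderiv ℝ (wirtingerIterate W (k + 1)) z =
        -solidCauchy (fderiv ℝ fun v => W v * wirtingerIterate W k v) z :=
      (hasFDerivAt_solidCauchy hf hc z).neg.fderiv
    rw [h1, norm_neg]
    have hM : ∀ v, ‖fderiv ℝ (fun v => W v * wirtingerIterate W k v) v‖ ≤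
        w * (B * (1 / 2) ^ k) + w' * ((1 / 4) ^ k * ‖(1 : 𝔸)‖) := by
      intro v
      rw [fderiv_fun_mul' (hW.differentiable one_ne_zero v) (hVk.differentiable one_ne_zero v)]
      refine (norm_add_le _ _).trans (add_le_add ?_ ?_)
      · refine ContinuousLinearMap.opNorm_le_bound _ (by positivity) fun u => ?_
        rw [smul_apply, smul_eq_mul, mul_assoc]
        refine (norm_mul_le _ _).trans (mul_le_mul (hw v) ?_ (norm_nonneg _) hw0)
        exact ((fderiv ℝ _ v).le_opNorm u).trans (mul_le_mul_of_nonneg_right (ih v) (norm_nonneg _))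
      · refine ContinuousLinearMap.opNorm_le_bound _ (by positivity) fun u => ?_
        rw [smul_apply, op_smul_eq_mul, mul_right_comm]
        refine (norm_mul_le _ _).trans (mul_le_mul ?_ ?_ (norm_nonneg _) (by positivity))
        · exact ((fderiv ℝ W v).le_opNorm u).trans
            (mul_le_mul_of_nonneg_right (hw' v) (norm_nonneg _))
        · refine (norm_wirtingerIterate_le hw hs k v).trans ?_
          gcongr
    have hs' : ∀ v, R < ‖v‖ → fderiv ℝ (fun v => W v * wirtingerIterate W k v) v = 0 := by
      intro v hv
      have : (fun v => W v * wirtingerIterate W k v) =ᶠ[𝓝 v] fun _ => 0 := by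
        filter_upwards [(isOpen_lt continuous_const continuous_norm).mem_nhds hv] with u hu
        rw [hs u hu, zero_mul]
      rw [this.fderiv_eq]; simp
    refine (norm_solidCauchy_le hM hs' z).trans ?_
    have h4 : ((1 : ℝ) / 4) ^ k ≤ (1 / 2) ^ k := by gcongr; norm_num
    calc cauchyMass R * (w * (B * (1 / 2) ^ k) + w' * ((1 / 4) ^ k * ‖(1 : 𝔸)‖))
        = cauchyMass R * w * (B * (1 / 2) ^ k) + B / 4 * (1 / 4) ^ k := by rw [hB]; ring
      _ ≤ 1 / 4 * (B * (1 / 2) ^ k) + B / 4 * (1 / 2) ^ k := by gcongr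
      _ = B * (1 / 2) ^ (k + 1) := by ring

/-- A Wirtinger equation `∂V/∂z̄ = -W V` with small compactly supported coefficient has a solution
close to `1`, normalized at infinity. -/
theorem exists_wirtinger_solution [CompleteSpace 𝔸] (hW : ContDiff ℝ 1 W) (hw : ∀ z, ‖W z‖ ≤ w)
    (hs : ∀ z, R < ‖z‖ → W z = 0) (hsmall : cauchyMass R * w ≤ 1 / 4) :
    ∃ V : ℂ → 𝔸, Differentiable ℝ V ∧ (∀ z, dbar V z = -(W z * V z)) ∧
      (∀ z, ‖V z - 1‖ ≤ 2 * (cauchyMass R * w) * ‖(1 : 𝔸)‖) ∧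
      Tendsto V (Bornology.cobounded ℂ) (𝓝 1) := by
  have hw0 : 0 ≤ w := (norm_nonneg _).trans (hw 0)
  set κ := cauchyMass R * w with hκ
  have hκ0 : 0 ≤ κ := mul_nonneg (cauchyMass_pos R).le hw0
  set V' := wirtingerIterate W with hV'
  have hn : ∀ k z, ‖V' k z‖ ≤ κ ^ k * ‖(1 : 𝔸)‖ := norm_wirtingerIterate_le hw hs
  have hgeom : Summable fun k : ℕ => κ ^ k * ‖(1 : 𝔸)‖ :=
    (summable_geometric_of_lt_one hκ0 (by linarith)).mul_right _
  have hsum : ∀ z, Summable fun k => V' k z := fun z =>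
    Summable.of_norm_bounded hgeom fun k => hn k z
  obtain ⟨B, hB⟩ := exists_norm_fderiv_wirtingerIterate_le hW hw hs hsmall
  have hBs : Summable fun k : ℕ => B * (1 / 2 : ℝ) ^ k :=
    (summable_geometric_of_lt_one (by norm_num) (by norm_num)).mul_left _
  have hdiff : ∀ k z, HasFDerivAt (V' k) (fderiv ℝ (V' k) z) z := fun k z =>
    ((contDiff_wirtingerIterate hW hs k).differentiable one_ne_zero z).hasFDerivAt
  have hV : ∀ z, HasFDerivAt (fun y => ∑' k, V' k y) (∑' k, fderiv ℝ (V' k) z) z :=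
    hasFDerivAt_tsum hBs hdiff hB (hsum 0)
  have hDs : ∀ z, Summable fun k => fderiv ℝ (V' k) z := fun z =>
    Summable.of_norm_bounded hBs fun k => hB k z
  have hsplit : ∀ z, ∑' k, V' k z = 1 + ∑' k, V' (k + 1) z := fun z => by
    rw [(hsum z).tsum_eq_zero_add]; rfl
  have hgeom1 : Summable fun k : ℕ => κ ^ (k + 1) * ‖(1 : 𝔸)‖ :=
    (summable_nat_add_iff (f := fun k : ℕ => κ ^ k * ‖(1 : 𝔸)‖) 1).2 hgeom
  refine ⟨fun z => ∑' k, V' k z, fun z => (hV z).differentiableAt, fun z => ?_, fun z => ?_, ?_⟩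
  · have happ : ∀ u : ℂ, (∑' k, fderiv ℝ (V' k) z) u = ∑' k, fderiv ℝ (V' k) z u := fun u =>
      (ContinuousLinearMap.apply ℝ 𝔸 u).map_tsum (hDs z)
    have hsu : ∀ u : ℂ, Summable fun k => fderiv ℝ (V' k) z u := fun u =>
      (ContinuousLinearMap.apply ℝ 𝔸 u).summable (hDs z)
    have hd : dbar (fun y => ∑' k, V' k y) z = ∑' k, dbar (V' k) z := by
      simp only [dbar]
      rw [(hV z).fderiv, happ, happ, ← (hsu Complex.I).tsum_const_smul,
        ← (hsu 1).tsum_add ((hsu Complex.I).const_smul _),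
        ← ((hsu 1).add ((hsu Complex.I).const_smul _)).tsum_const_smul]
    have hds : Summable fun k => dbar (V' k) z :=
      ((hsu 1).add ((hsu Complex.I).const_smul _)).const_smul _
    have h0 : dbar (V' 0) z = 0 := dbar_eq_zero (differentiableAt_const _)
    have hk : ∀ k, dbar (V' (k + 1)) z = -(W z * V' k z) := fun k => by
      have hVk := contDiff_wirtingerIterate hW hs k
      have hf : ContDiff ℝ 1 fun v => W v * V' k v := hW.mul hVk
      have hc : HasCompactSupport fun v => W v * V' k v :=
        hasCompactSupport_of_forall_norm_lt fun z hz => by rw [hs z hz, zero_mul]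
      have h1 := dbar_solidCauchy hf hc z
      have h2 : fderiv ℝ (V' (k + 1)) z = -fderiv ℝ (solidCauchy fun v => W v * V' k v) z :=
        ((hasFDerivAt_solidCauchy hf hc z).neg.fderiv).trans
          (by rw [(hasFDerivAt_solidCauchy hf hc z).fderiv])
      rw [← h1]
      simp only [dbar, h2, neg_apply, smul_neg, smul_add, neg_add]
    rw [hd, hds.tsum_eq_zero_add, h0, zero_add]
    simp only [hk]
    rw [tsum_neg, (hsum z).tsum_mul_left]
  · simp only [hsplit, add_sub_cancel_left]
    refine (tsum_of_norm_bounded hgeom1.hasSum fun k => hn (k + 1) z).trans ?_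
    have : ∑' k : ℕ, κ ^ (k + 1) * ‖(1 : 𝔸)‖ = κ * (1 - κ)⁻¹ * ‖(1 : 𝔸)‖ := by
      simp only [pow_succ']
      rw [tsum_mul_right, tsum_mul_left, tsum_geometric_of_lt_one hκ0 (by linarith)]
    rw [this]
    have h2 : (1 - κ)⁻¹ ≤ 2 := by
      rw [inv_le_comm₀ (by linarith) (by norm_num)]; linarith
    have h3 : κ * (1 - κ)⁻¹ ≤ 2 * κ := by
      rw [mul_comm]; exact mul_le_mul_of_nonneg_right h2 hκ0
    gcongr
  · have h1 : Tendsto (fun z => ∑' k, V' (k + 1) z) (Bornology.cobounded ℂ)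
        (𝓝 (∑' _ : ℕ, (0 : 𝔸))) := by
      refine tendsto_tsum_of_dominated_convergence hgeom1 (fun k => ?_)
        (Eventually.of_forall fun z k => hn (k + 1) z)
      have h3 : Tendsto (fun z => -solidCauchy (fun v => W v * V' k v) z)
          (Bornology.cobounded ℂ) (𝓝 (-0)) := by
        refine (tendsto_solidCauchy_cobounded (M := w * (κ ^ k * ‖(1 : 𝔸)‖)) (R := R)
          (fun v => ?_) fun v hv => by rw [hs v hv, zero_mul]).neg
        exact (norm_mul_le _ _).trans (mul_le_mul (hw v) (hn k v) (norm_nonneg _) hw0)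
      rwa [neg_zero] at h3
    have h2 := h1.const_add 1
    rw [tsum_zero, add_zero] at h2
    exact h2.congr fun z => (hsplit z).symm

end Wirtinger

/-! ### One-sided neighbourhoods of arcs -/

namespace TwoEdge

namespace Arc

variable (γ : Arc)

theorem continuous : Continuous γ.toFun := γ.contDiff.continuous

theorem isCompact_carrier : IsCompact γ.carrier := isCompact_Icc.image γ.continuous

theorem isClosed_carrier : IsClosed γ.carrier := γ.isCompact_carrier.isClosed

theorem openPart_subset_carrier : γ.openPart ⊆ γ.carrier := image_mono Ioo_subset_Icc_self

theorem contDiff_deriv : ContDiff ℝ 1 (deriv γ.toFun) :=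
  (contDiff_succ_iff_deriv (n := 1)).1 γ.contDiff |>.2.2

theorem exists_lipschitzOnWith : ∃ K : NNReal, LipschitzOnWith K γ.toFun (Icc 0 1) := by
  obtain ⟨C, hC⟩ := isCompact_Icc.exists_bound_of_continuousOn
    (γ.contDiff_deriv.continuous.continuousOn (s := Icc (0 : ℝ) 1))
  refine ⟨C.toNNReal, (convex_Icc 0 1).lipschitzOnWith_of_nnnorm_deriv_le
    (fun t _ => γ.contDiff.differentiable two_ne_zero t) fun t ht => ?_⟩
  rw [← NNReal.coe_le_coe, coe_nnnorm]
  exact (hC t ht).trans (Real.le_coe_toNNReal C)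

theorem dense_compl_carrier : Dense γ.carrierᶜ :=
  dense_compl_of_dimH_lt_finrank <| by
    have h1 : dimH γ.carrier ≤ 1 :=
      ((dimH_mono (image_subset_range _ _)).trans
        (γ.contDiff.of_le one_le_two).dimH_range_le).trans (by simp)
    refine h1.trans_lt ?_
    rw [Complex.finrank_real_complex]
    exact_mod_cast Nat.one_lt_two

theorem mem_openPart_or_of_joins {a b z : ℂ} (h : γ.Joins a b) (hz : z ∈ γ.carrier) :
    z ∈ γ.openPart ∨ z = a ∨ z = b := by
  obtain ⟨t, ht, rfl⟩ := hz
  rcases eq_or_lt_of_le ht.1 with h0 | h0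
  · rw [← h0]
    rcases h with h | h
    · exact Or.inr (Or.inl h.1)
    · exact Or.inr (Or.inr h.1)
  rcases eq_or_lt_of_le ht.2 with h1 | h1
  · rw [h1]
    rcases h with h | h
    · exact Or.inr (Or.inr h.2)
    · exact Or.inr (Or.inl h.2)
  · exact Or.inl ⟨t, ⟨h0, h1⟩, rfl⟩

theorem ne_of_mem_openPart {a b z : ℂ} (h : γ.Joins a b) (hz : z ∈ γ.openPart) :
    z ≠ a ∧ z ≠ b := by
  obtain ⟨t, ht, rfl⟩ := hz
  have h0 : γ.toFun t ≠ γ.toFun 0 := fun he =>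
    ht.1.ne' (γ.injOn (Ioo_subset_Icc_self ht) (by simp) he)
  have h1 : γ.toFun t ≠ γ.toFun 1 := fun he =>
    ht.2.ne (γ.injOn (Ioo_subset_Icc_self ht) (by simp) he)
  rcases h with ⟨ha, hb⟩ | ⟨hb, ha⟩
  · exact ⟨ha ▸ h0, hb ▸ h1⟩
  · exact ⟨ha ▸ h1, hb ▸ h0⟩

theorem joins_mem_carrier {a b : ℂ} (h : γ.Joins a b) : a ∈ γ.carrier ∧ b ∈ γ.carrier := by
  rcases h with ⟨ha, hb⟩ | ⟨hb, ha⟩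
  · exact ⟨⟨0, by simp, ha⟩, ⟨1, by simp, hb⟩⟩
  · exact ⟨⟨1, by simp, ha⟩, ⟨0, by simp, hb⟩⟩

/-- The coordinates `(t, s) ↦ γ(t) + i s γ'(t)` along and across the arc. -/
noncomputable def tube (p : ℝ × ℝ) : ℂ := γ.toFun p.1 + (p.2 : ℂ) * Complex.I * deriv γ.toFun p.1

theorem contDiff_tube : ContDiff ℝ 1 γ.tube := by
  have h1 : ContDiff ℝ 1 fun p : ℝ × ℝ => γ.toFun p.1 :=
    (γ.contDiff.of_le one_le_two).comp contDiff_fst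
  have h2 : ContDiff ℝ 1 fun p : ℝ × ℝ => deriv γ.toFun p.1 := γ.contDiff_deriv.comp contDiff_fst
  have h3 : ContDiff ℝ 1 fun p : ℝ × ℝ => (p.2 : ℂ) := Complex.ofRealCLM.contDiff.comp contDiff_snd
  exact h1.add ((h3.mul contDiff_const).mul h2)

theorem tube_zero (t : ℝ) : γ.tube (t, 0) = γ.toFun t := by simp [tube]

theorem map_tube_nhds {t : ℝ} (ht : t ∈ Icc (0 : ℝ) 1) : map γ.tube (𝓝 (t, 0)) = 𝓝 (γ.toFun t) := by
  have hs : HasStrictFDerivAt γ.tube (fderiv ℝ γ.tube (t, 0)) (t, 0) :=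
    γ.contDiff_tube.contDiffAt.hasStrictFDerivAt one_ne_zero
  have hd1 : fderiv ℝ γ.tube (t, 0) (1, 0) = deriv γ.toFun t := by
    have h1 : HasDerivAt (fun u : ℝ => ((u, 0) : ℝ × ℝ)) (1, 0) t :=
      (hasDerivAt_id t).prodMk (hasDerivAt_const t 0)
    have h2 := hs.hasFDerivAt.comp_hasDerivAt (f := fun u : ℝ => ((u, 0) : ℝ × ℝ)) t h1
    have h3 : (γ.tube ∘ fun u : ℝ => ((u, 0) : ℝ × ℝ)) = γ.toFun := by
      funext u; exact γ.tube_zero u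
    rw [h3] at h2
    exact h2.deriv.symm
  have hd2 : fderiv ℝ γ.tube (t, 0) (0, 1) = Complex.I * deriv γ.toFun t := by
    have h1 : HasDerivAt (fun u : ℝ => ((t, u) : ℝ × ℝ)) (0, 1) 0 :=
      (hasDerivAt_const (0 : ℝ) t).prodMk (hasDerivAt_id (0 : ℝ))
    have h2 := hs.hasFDerivAt.comp_hasDerivAt (f := fun u : ℝ => ((t, u) : ℝ × ℝ)) 0 h1
    have h3 : HasDerivAt (γ.tube ∘ fun u : ℝ => ((t, u) : ℝ × ℝ))
        (1 * Complex.I * deriv γ.toFun t) 0 :=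
      (((HasDerivAt.ofReal_comp (hasDerivAt_id (0 : ℝ))).mul_const Complex.I).mul_const
        (deriv γ.toFun t)).const_add (γ.toFun t)
    rw [one_mul] at h3
    exact h2.unique h3
  have hsurj : (fderiv ℝ γ.tube (t, 0)).range = ⊤ := by
    rw [LinearMap.range_eq_top]
    intro w
    have hne := γ.regular t ht
    refine ⟨((w / deriv γ.toFun t).re, (w / deriv γ.toFun t).im), ?_⟩
    set q := w / deriv γ.toFun t with hq
    have e : ((q.re, q.im) : ℝ × ℝ) = q.re • ((1, 0) : ℝ × ℝ) + q.im • ((0, 1) : ℝ × ℝ) := by simp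
    rw [e]
    rw [map_add, map_smul, map_smul]
    erw [hd1, hd2]
    rw [← Complex.coe_smul, ← Complex.coe_smul, smul_eq_mul, smul_eq_mul, ← mul_assoc, ← add_mul,
      Complex.re_add_im, hq, div_mul_cancel₀ _ hne]
  rw [hs.map_nhds_eq_of_surj hsurj, tube_zero]

theorem rightOf_eq (t : ℝ) : γ.rightOf t = map γ.tube (𝓝 t ×ˢ 𝓝[<] (0 : ℝ)) := by
  have h1 : 𝓝[<] (0 : ℝ) = map (fun s : ℝ => -s) (𝓝[>] (0 : ℝ)) := by
    simp
  rw [h1, rightOf]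
  nth_rewrite 2 [← map_id (f := 𝓝 t)]
  rw [prod_map_map_eq, map_map]
  congr 1
  funext p
  simp [tube, sub_eq_add_neg]

theorem leftOf_eq (t : ℝ) : γ.leftOf t = map γ.tube (𝓝 t ×ˢ 𝓝[>] (0 : ℝ)) := rfl

/-- A full neighbourhood of an interior point of an arc consists of the two one-sided
neighbourhoods and the arc itself. -/
theorem nhds_le {t : ℝ} (ht : t ∈ Ioo (0 : ℝ) 1) :
    𝓝 (γ.toFun t) ≤ γ.leftOf t ⊔ γ.rightOf t ⊔ 𝓟 γ.openPart := by
  have h0 : 𝓝 (0 : ℝ) = 𝓝[>] 0 ⊔ 𝓝[<] 0 ⊔ pure 0 := by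
    rw [sup_comm (𝓝[>] (0 : ℝ)), ← nhdsWithin_union, ← nhdsWithin_singleton, ← nhdsWithin_union,
      Iio_union_Ioi, compl_union_self, nhdsWithin_univ]
  rw [← γ.map_tube_nhds (Ioo_subset_Icc_self ht), nhds_prod_eq, h0, prod_sup, prod_sup, map_sup,
    map_sup, ← γ.rightOf_eq, ← γ.leftOf_eq]
  refine sup_le_sup_left ?_ _
  rw [le_principal_iff, mem_map, prod_pure, mem_map]
  filter_upwards [isOpen_Ioo.mem_nhds ht] with s hs
  exact ⟨s, hs, (γ.tube_zero s).symm⟩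

theorem map_tube_le (t : ℝ) {l : Filter ℝ} (hl : l ≤ 𝓝 0) :
    map γ.tube (𝓝 t ×ˢ l) ≤ 𝓝 (γ.toFun t) := by
  rw [← γ.tube_zero t]
  refine (map_mono (prod_mono_right _ hl)).trans ?_
  rw [← nhds_prod_eq]
  exact γ.contDiff_tube.continuous.continuousAt

theorem leftOf_le_nhds (t : ℝ) : γ.leftOf t ≤ 𝓝 (γ.toFun t) := γ.map_tube_le t nhdsWithin_le_nhds

theorem rightOf_le_nhds (t : ℝ) : γ.rightOf t ≤ 𝓝 (γ.toFun t) := by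
  rw [rightOf_eq]; exact γ.map_tube_le t nhdsWithin_le_nhds

theorem nhdsWithin_sdiff_le {t : ℝ} (ht : t ∈ Ioo (0 : ℝ) 1) {D A : Set ℂ} (hA : γ.openPart ⊆ A) :
    𝓝[D \ A] (γ.toFun t) ≤ (γ.leftOf t ⊓ 𝓟 D) ⊔ (γ.rightOf t ⊓ 𝓟 D) := by
  have h1 : 𝓝[D \ A] (γ.toFun t) ≤
      (γ.leftOf t ⊔ γ.rightOf t ⊔ 𝓟 γ.openPart) ⊓ 𝓟 (D \ A) :=
    inf_le_inf_right _ (γ.nhds_le ht)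
  refine h1.trans ?_
  rw [inf_sup_right, inf_sup_right]
  have h2 : 𝓟 γ.openPart ⊓ 𝓟 (D \ A) = ⊥ := by
    rw [inf_principal, principal_eq_bot_iff]
    exact (disjoint_sdiff_right.mono_left hA).inter_eq
  rw [h2, sup_bot_eq]
  exact sup_le_sup (inf_le_inf_left _ (principal_mono.2 sdiff_subset))
    (inf_le_inf_left _ (principal_mono.2 sdiff_subset))

end Arc

theorem tendsto_matrix_inv {l : Filter ℂ} {F : ℂ → Mat3} {A : Mat3} (hF : Tendsto F l (𝓝 A))
    (hA : IsUnit A) : Tendsto (fun z => (F z)⁻¹) l (𝓝 A⁻¹) := by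
  have hdet : A.det ≠ 0 := ((Matrix.isUnit_iff_isUnit_det A).1 hA).ne_zero
  simp only [Matrix.inv_def, Ring.inverse_eq_inv']
  have h1 : Tendsto (fun z => (F z).det) l (𝓝 A.det) :=
    ((continuous_id.matrix_det).tendsto A).comp hF
  have h2 : Tendsto (fun z => (F z).adjugate) l (𝓝 A.adjugate) :=
    ((continuous_id.matrix_adjugate).tendsto A).comp hF
  exact (h1.inv₀ hdet).smul h2

theorem mul_inv_mul_cancel_right {A B J : Mat3} (hB : IsUnit (B * J)) :
    A * J * (B * J)⁻¹ = A * B⁻¹ := by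
  have hJ : IsUnit J.det := by
    have := (Matrix.isUnit_iff_isUnit_det _).1 hB
    rw [Matrix.det_mul] at this
    exact isUnit_of_mul_isUnit_right this
  rw [Matrix.mul_inv_rev, ← mul_assoc, mul_assoc A, Matrix.mul_nonsing_inv _ hJ, mul_one]

/-- Two functions with the same jump have a quotient that is continuous across the arc. -/
theorem HasJump.tendsto_mul_inv {γ : Arc} {S F J : ℂ → Mat3} {D A : Set ℂ} (hF : HasJump F D γ J)
    {t : ℝ} (ht : t ∈ Ioo (0 : ℝ) 1) (hA : γ.openPart ⊆ A) (hcl : γ.toFun t ∈ closure D)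
    {Sp Sm : Mat3} (hp : Tendsto S (γ.leftOf t) (𝓝 Sp)) (hm : Tendsto S (γ.rightOf t) (𝓝 Sm))
    (hS : Sp = Sm * J (γ.toFun t)) :
    ∃ L, Tendsto (fun z => S z * (F z)⁻¹) (𝓝[D \ A] (γ.toFun t)) (𝓝 L) := by
  obtain ⟨Fp, Fm, hFp, hFm, hup, hum, hJ⟩ := hF t ht hcl
  refine ⟨Sm * Fm⁻¹, Tendsto.mono_left ?_ (γ.nhdsWithin_sdiff_le ht hA)⟩
  refine Tendsto.sup ?_ ?_
  · have := (hp.mono_left inf_le_left).mul (tendsto_matrix_inv hFp hup)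
    rw [hS, hJ, mul_inv_mul_cancel_right (hJ ▸ hup)] at this
    exact this
  · exact (hm.mono_left inf_le_left).mul (tendsto_matrix_inv hFm hum)

end TwoEdge

/-! ### The jumps of the lens-opened unknown -/

namespace TwoEdge

section Jumps

attribute [local instance] Matrix.linftyOpNormedRing Matrix.linftyOpNormedAlgebra

theorem differentiableAt_of_entries {F : ℂ → Mat3} {z : ℂ}
    (h : ∀ i j, DifferentiableAt ℂ (fun w => F w i j) z) : DifferentiableAt ℂ F z :=
  differentiableAt_pi.2 fun i => differentiableAt_pi.2 fun j => h i j

theorem differentiableAt_entry {F : ℂ → Mat3} {z : ℂ} (h : DifferentiableAt ℂ F z) (i j : Fin 3) :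
    DifferentiableAt ℂ (fun w => F w i j) z :=
  differentiableAt_pi.1 (differentiableAt_pi.1 h i) j

theorem differentiableAt_single {i j : Fin 3} {f : ℂ → ℂ} {z : ℂ} (hf : DifferentiableAt ℂ f z) :
    DifferentiableAt ℂ (fun w => (Matrix.single i j (f w) : Mat3)) z :=
  differentiableAt_of_entries fun i' j' => by
    by_cases h : i = i' ∧ j = j'
    · obtain ⟨rfl, rfl⟩ := h
      simpa using hf
    · simp [h]

theorem AnalyticMat.differentiableAt {F : ℂ → Mat3} {U : Set ℂ} (h : AnalyticMat F U)
    (hU : IsOpen U) {z : ℂ} (hz : z ∈ U) : DifferentiableAt ℂ F z :=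
  differentiableAt_of_entries fun i j => (h i j).differentiableAt (hU.mem_nhds hz)

theorem differentiableAt_matrix_inv {F : ℂ → Mat3} {z : ℂ} (hF : DifferentiableAt ℂ F z)
    (hz : IsUnit (F z)) : DifferentiableAt ℂ (fun w => (F w)⁻¹) z := by
  obtain ⟨u, hu⟩ := hz
  have h1 : DifferentiableAt ℂ Ring.inverse (F z) := by
    rw [← hu]; exact differentiableAt_inverse u.isUnit
  have h2 : (fun w => (F w)⁻¹) = fun w => Ring.inverse (F w) := by
    funext w; exact Matrix.nonsing_inv_eq_ringInverse _
  rw [h2]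
  exact h1.comp z hF

theorem single_mul_single_zero {k : Fin 3} (hk : k ≠ 0) (a b : ℂ) :
    (Matrix.single 0 k a * Matrix.single 0 k b : Mat3) = 0 ∧
      (Matrix.single k 0 a * Matrix.single k 0 b : Mat3) = 0 :=
  ⟨Matrix.single_mul_single_of_ne _ _ _ _ hk _, Matrix.single_mul_single_of_ne _ _ _ _ hk.symm _⟩

theorem inv_one_add_of_sq_zero {X : Mat3} (h : X * X = 0) : (1 + X)⁻¹ = 1 - X :=
  Matrix.inv_eq_right_inv (by rw [add_mul, mul_sub, mul_sub, h]; simp)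

theorem isUnit_one_add_of_sq_zero {X : Mat3} (h : X * X = 0) : IsUnit (1 + X) :=
  (Matrix.isUnit_iff_isUnit_det _).2 (Matrix.isUnit_det_of_right_inverse (B := 1 - X)
    (by rw [add_mul, mul_sub, mul_sub, h]; simp))

namespace Lens

variable {a b : ℂ} (L : Lens a b) (k : Fin 3) (n : ℕ)

open Classical in
/-- The nilpotent matrix by which the lens opening of one conductor differs from the identity: the
unknown is multiplied by `1 - L.factor k n z`. -/
noncomputable def factor (z : ℂ) : Mat3 :=
  if z ∈ L.domUp then Matrix.single 0 k (L.ampUp z * Complex.exp (-(n : ℂ) * L.phase z))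
  else if z ∈ L.domLo then -Matrix.single k 0 (L.ampLo z * Complex.exp (-(n : ℂ) * L.phase z))
  else 0

variable {k n}

theorem upper_inv (hk : k ≠ 0) (z : ℂ) : (L.upper k n z)⁻¹ =
    1 - Matrix.single 0 k (L.ampUp z * Complex.exp (-(n : ℂ) * L.phase z)) :=
  inv_one_add_of_sq_zero (single_mul_single_zero hk _ _).1

theorem isUnit_upper (hk : k ≠ 0) (z : ℂ) : IsUnit (L.upper k n z) :=
  isUnit_one_add_of_sq_zero (single_mul_single_zero hk _ _).1

theorem det_upper (hk : k ≠ 0) (z : ℂ) : (L.upper k n z).det = 1 := by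
  rw [upper]
  fin_cases k
  · exact absurd rfl hk
  · simp [Matrix.det_fin_three]
  · simp [Matrix.det_fin_three]

theorem factor_mul_self (hk : k ≠ 0) (z : ℂ) : L.factor k n z * L.factor k n z = 0 := by
  unfold factor
  split_ifs
  · exact (single_mul_single_zero hk _ _).1
  · rw [neg_mul_neg]; exact (single_mul_single_zero hk _ _).2
  · exact zero_mul 0

theorem differentiableAt_exp_phase {z : ℂ} (h : DifferentiableAt ℂ L.phase z) :
    DifferentiableAt ℂ (fun w => Complex.exp (-(n : ℂ) * L.phase w)) z :=
  (h.const_mul (-(n : ℂ))).cexp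

theorem differentiableAt_upperEntry {z : ℂ} (h : DifferentiableAt ℂ L.phase z)
    (hz : z ∈ closure L.domUp) (hz' : z ∉ L.arc.carrier) :
    DifferentiableAt ℂ (fun w => L.ampUp w * Complex.exp (-(n : ℂ) * L.phase w)) z :=
  (L.ampUp_analytic z ⟨hz, hz'⟩).differentiableAt.mul (L.differentiableAt_exp_phase h)

theorem differentiableAt_lowerEntry {z : ℂ} (h : DifferentiableAt ℂ L.phase z)
    (hz : z ∈ closure L.domLo) (hz' : z ∉ L.arc.carrier) :
    DifferentiableAt ℂ (fun w => L.ampLo w * Complex.exp (-(n : ℂ) * L.phase w)) z :=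
  (L.ampLo_analytic z ⟨hz, hz'⟩).differentiableAt.mul (L.differentiableAt_exp_phase h)

theorem differentiableAt_factor {z : ℂ} (h : DifferentiableAt ℂ L.phase z) (hz : z ∉ L.contour) :
    DifferentiableAt ℂ (L.factor k n) z := by
  simp only [contour, mem_union, not_or] at hz
  obtain ⟨⟨hza, hzu⟩, hzl⟩ := hz
  have hfu : z ∉ frontier L.domUp := by
    rw [L.frontier_domUp]; exact fun h => h.elim hza hzu
  have hfl : z ∉ frontier L.domLo := by
    rw [L.frontier_domLo]; exact fun h => h.elim hza hzl
  by_cases hu : z ∈ L.domUp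
  · have h1 : DifferentiableAt ℂ (fun w =>
        (Matrix.single 0 k (L.ampUp w * Complex.exp (-(n : ℂ) * L.phase w)) : Mat3)) z :=
      differentiableAt_single (L.differentiableAt_upperEntry h (subset_closure hu) hza)
    refine h1.congr_of_eventuallyEq ?_
    filter_upwards [L.isOpen_domUp.mem_nhds hu] with w hw
    simp only [factor, if_pos hw]
  have hu' : ∀ᶠ w in 𝓝 z, w ∉ L.domUp := by
    have : z ∉ closure L.domUp := fun hc => hfu ⟨hc, by rwa [L.isOpen_domUp.interior_eq]⟩
    filter_upwards [isClosed_closure.isOpen_compl.mem_nhds this] with w hw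
    exact fun h => hw (subset_closure h)
  by_cases hl : z ∈ L.domLo
  · have h1 : DifferentiableAt ℂ (fun w =>
        -(Matrix.single k 0 (L.ampLo w * Complex.exp (-(n : ℂ) * L.phase w)) : Mat3)) z :=
      (differentiableAt_single (L.differentiableAt_lowerEntry h (subset_closure hl) hza)).neg
    refine h1.congr_of_eventuallyEq ?_
    filter_upwards [L.isOpen_domLo.mem_nhds hl, hu'] with w hw hwu
    simp only [factor, if_neg hwu, if_pos hw]
  · have hl' : z ∉ closure L.domLo := fun hc => hfl ⟨hc, by rwa [L.isOpen_domLo.interior_eq]⟩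
    refine (differentiableAt_const (0 : Mat3)).congr_of_eventuallyEq ?_
    filter_upwards [isClosed_closure.isOpen_compl.mem_nhds hl', hu'] with w hw hwu
    have : w ∉ L.domLo := fun h => hw (subset_closure h)
    simp only [factor, if_neg hwu, if_neg this]

/-- `S` has the limits of the reduced jump `J0` on the conductor. -/
theorem opened_arc {J0 : Mat3} {T S : ℂ → Mat3} (hk : k ≠ 0)
    (hT : L.FactorizedJump k J0 n T)
    (hSu : ∀ z ∈ L.domUp, S z = T z * (L.upper k n z)⁻¹)
    (hSl : ∀ z ∈ L.domLo, S z = T z * L.lower k n z) {t : ℝ} (ht : t ∈ Ioo (0 : ℝ) 1) :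
    ∃ Sp Sm, Tendsto S (L.arc.leftOf t) (𝓝 Sp) ∧ Tendsto S (L.arc.rightOf t) (𝓝 Sm) ∧
      Sp = Sm * J0 := by
  obtain ⟨Tp, Tm, Ju, Jl, h1, h2, h3, h4, h5⟩ := hT t ht
  have hne : (L.arc.leftOf t).NeBot := by
    rw [L.arc.leftOf_eq]; infer_instance
  have hdet : Ju.det = 1 := by
    have hd : Tendsto (fun z => (L.upper k n z).det) (L.arc.leftOf t) (𝓝 Ju.det) :=
      ((continuous_id.matrix_det).tendsto Ju).comp h3
    simp only [L.det_upper hk] at hd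
    exact tendsto_nhds_unique hd tendsto_const_nhds |>.symm ▸ rfl
  have hJu : IsUnit Ju.det := by rw [hdet]; exact isUnit_one
  refine ⟨Tp * Ju⁻¹, Tm * Jl, ?_, ?_, ?_⟩
  · refine (h1.mul (tendsto_matrix_inv h3 ((Matrix.isUnit_iff_isUnit_det _).2 hJu))).congr' ?_
    filter_upwards [L.domUp_left_arc t ht] with z hz
    exact (hSu z hz).symm
  · refine (h2.mul h4).congr' ?_
    filter_upwards [L.domLo_right_arc t ht] with z hz
    exact (hSl z hz).symm
  · rw [h5, ← mul_assoc, mul_assoc _ Ju, Matrix.mul_nonsing_inv _ hJu, mul_one, mul_assoc]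

theorem opened_lipUp {T S : ℂ → Mat3} (hk : k ≠ 0) {t : ℝ} (ht : t ∈ Ioo (0 : ℝ) 1)
    (hT : DifferentiableAt ℂ T (L.lipUp.toFun t))
    (hφ : DifferentiableAt ℂ L.phase (L.lipUp.toFun t)) (hoff : L.lipUp.toFun t ∉ L.arc.carrier)
    (hSu : ∀ z ∈ L.domUp, S z = T z * (L.upper k n z)⁻¹)
    (hS : ∀ᶠ z in 𝓝 (L.lipUp.toFun t), z ∉ L.domUp → S z = T z) :
    ∃ Sp Sm, Tendsto S (L.lipUp.leftOf t) (𝓝 Sp) ∧ Tendsto S (L.lipUp.rightOf t) (𝓝 Sm) ∧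
      Sp = Sm * (L.upper k n (L.lipUp.toFun t))⁻¹ := by
  set p := L.lipUp.toFun t with hp
  have hcl : p ∈ closure L.domUp := frontier_subset_closure (by
    rw [L.frontier_domUp]; exact Or.inr ⟨t, Ioo_subset_Icc_self ht, rfl⟩)
  have hup : Tendsto (L.upper k n) (𝓝 p) (𝓝 (L.upper k n p)) :=
    ((differentiableAt_const (1 : Mat3)).add (differentiableAt_single
      (L.differentiableAt_upperEntry hφ hcl hoff))).continuousAt
  have hTc : Tendsto T (𝓝 p) (𝓝 (T p)) := hT.continuousAt
  refine ⟨T p * (L.upper k n p)⁻¹, T p, ?_, ?_, rfl⟩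
  · refine ((hTc.mul (tendsto_matrix_inv hup (L.isUnit_upper hk p))).mono_left
      (L.lipUp.leftOf_le_nhds t)).congr' ?_
    filter_upwards [(L.domUp_left_lip t ht).1] with z hz
    exact (hSu z hz).symm
  · refine (hTc.mono_left (L.lipUp.rightOf_le_nhds t)).congr' ?_
    filter_upwards [(L.domUp_left_lip t ht).2, L.lipUp.rightOf_le_nhds t hS] with z hz hz'
    exact (hz' hz).symm

theorem opened_lipLo {T S : ℂ → Mat3} {t : ℝ} (ht : t ∈ Ioo (0 : ℝ) 1)
    (hT : DifferentiableAt ℂ T (L.lipLo.toFun t))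
    (hφ : DifferentiableAt ℂ L.phase (L.lipLo.toFun t)) (hoff : L.lipLo.toFun t ∉ L.arc.carrier)
    (hSl : ∀ z ∈ L.domLo, S z = T z * L.lower k n z)
    (hS : ∀ᶠ z in 𝓝 (L.lipLo.toFun t), z ∉ L.domLo → S z = T z) :
    ∃ Sp Sm, Tendsto S (L.lipLo.leftOf t) (𝓝 Sp) ∧ Tendsto S (L.lipLo.rightOf t) (𝓝 Sm) ∧
      Sp = Sm * L.lower k n (L.lipLo.toFun t) := by
  set p := L.lipLo.toFun t with hp
  have hcl : p ∈ closure L.domLo := frontier_subset_closure (by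
    rw [L.frontier_domLo]; exact Or.inr ⟨t, Ioo_subset_Icc_self ht, rfl⟩)
  have hlo : Tendsto (L.lower k n) (𝓝 p) (𝓝 (L.lower k n p)) :=
    ((differentiableAt_const (1 : Mat3)).add (differentiableAt_single
      (L.differentiableAt_lowerEntry hφ hcl hoff))).continuousAt
  have hTc : Tendsto T (𝓝 p) (𝓝 (T p)) := hT.continuousAt
  refine ⟨T p * L.lower k n p, T p, ?_, ?_, rfl⟩
  · refine ((hTc.mul hlo).mono_left (L.lipLo.leftOf_le_nhds t)).congr' ?_
    filter_upwards [(L.domLo_left_lip t ht).1] with z hz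
    exact (hSl z hz).symm
  · refine (hTc.mono_left (L.lipLo.rightOf_le_nhds t)).congr' ?_
    filter_upwards [(L.domLo_left_lip t ht).2, L.lipLo.rightOf_le_nhds t hS] with z hz hz'
    exact (hz' hz).symm

end Lens

namespace Regime

variable (D : Regime)

theorem not_mem_carrier_of_disjoint {γ δ : Arc} {a b z : ℂ} (hγ : γ.Joins a b) (hδ : δ.Joins a b)
    (h : Disjoint γ.openPart δ.openPart) (hz : z ∈ γ.openPart) : z ∉ δ.carrier := fun hz' => by
  obtain ⟨h1, h2⟩ := γ.ne_of_mem_openPart hγ hz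
  rcases δ.mem_openPart_or_of_joins hδ hz' with h3 | h3 | h3
  · exact disjoint_left.1 h hz h3
  · exact h1 h3
  · exact h2 h3

theorem isClosed_conductors : IsClosed D.conductors :=
  D.Γ.arc.isClosed_carrier.union D.Δ.arc.isClosed_carrier

theorem isClosed_contour {a b : ℂ} (L : Lens a b) : IsClosed L.contour :=
  (L.arc.isClosed_carrier.union L.lipUp.isClosed_carrier).union L.lipLo.isClosed_carrier

theorem isClosed_contourS : IsClosed D.contourS :=
  (isClosed_contour D.Γ).union (isClosed_contour D.Δ)

theorem conductors_subset_contourS : D.conductors ⊆ D.contourS :=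
  union_subset_union (subset_union_left.trans subset_union_left)
    (subset_union_left.trans subset_union_left)

/-- A point of the contour that is not on the boundary of a lens domain cannot be approached from
that domain. -/
theorem eventually_not_mem_domain {Ω : Set ℂ}
    (hΩ : Ω ∈ [D.Γ.domUp, D.Γ.domLo, D.Δ.domUp, D.Δ.domLo]) (ho : IsOpen Ω) {z : ℂ} (hz : z ∈ D.contourS) (hf : z ∉ frontier Ω) : ∀ᶠ w in 𝓝 z, w ∉ Ω := by
  have h1 : z ∉ Ω := fun h => disjoint_left.1 (D.domains_off_contour Ω hΩ) h hz
  have h2 : z ∉ closure Ω := fun hc => hf ⟨hc, by rwa [ho.interior_eq]⟩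
  filter_upwards [isClosed_closure.isOpen_compl.mem_nhds h2] with w hw
  exact fun h => hw (subset_closure h)

theorem domains_pairwise :
    (Disjoint D.Γ.domUp D.Γ.domLo ∧ Disjoint D.Γ.domUp D.Δ.domUp ∧ Disjoint D.Γ.domUp D.Δ.domLo) ∧
    (Disjoint D.Γ.domLo D.Δ.domUp ∧ Disjoint D.Γ.domLo D.Δ.domLo) ∧
    Disjoint D.Δ.domUp D.Δ.domLo := by
  have := D.domains_disjoint
  simp only [List.pairwise_cons, List.mem_cons, List.not_mem_nil, or_false, forall_eq_or_imp,
    forall_eq] at this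
  exact ⟨this.1, this.2.1, this.2.2.1⟩

/-- The nilpotent correction `Y` with `S = T (1 - Y)`. -/
noncomputable def factor (n : ℕ) (z : ℂ) : Mat3 := D.Γ.factor 2 n z + D.Δ.factor 1 n z

theorem Γ_factor_eq_zero {n : ℕ} {z : ℂ} (h : z ∉ D.Γ.domUp) (h' : z ∉ D.Γ.domLo) :
    D.Γ.factor 2 n z = 0 := by rw [Lens.factor, if_neg h, if_neg h']

theorem Δ_factor_eq_zero {n : ℕ} {z : ℂ} (h : z ∉ D.Δ.domUp) (h' : z ∉ D.Δ.domLo) :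
    D.Δ.factor 1 n z = 0 := by rw [Lens.factor, if_neg h, if_neg h']

theorem factor_eq (n : ℕ) (z : ℂ) :
    D.factor n z = D.Γ.factor 2 n z ∧ D.Δ.factor 1 n z = 0 ∨
      D.factor n z = D.Δ.factor 1 n z ∧ D.Γ.factor 2 n z = 0 := by
  obtain ⟨⟨-, h1, h2⟩, ⟨h3, h4⟩, -⟩ := D.domains_pairwise
  by_cases h : z ∈ D.Γ.domUp ∨ z ∈ D.Γ.domLo
  · have hz : D.Δ.factor 1 n z = 0 := by
      rcases h with h | h
      · exact D.Δ_factor_eq_zero (disjoint_left.1 h1 h) (disjoint_left.1 h2 h)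
      · exact D.Δ_factor_eq_zero (disjoint_left.1 h3 h) (disjoint_left.1 h4 h)
    exact Or.inl ⟨by rw [factor, hz, add_zero], hz⟩
  · rw [not_or] at h
    have hz := D.Γ_factor_eq_zero (n := n) h.1 h.2
    exact Or.inr ⟨by rw [factor, hz, zero_add], hz⟩

theorem factor_mul_self (n : ℕ) (z : ℂ) : D.factor n z * D.factor n z = 0 := by
  rcases D.factor_eq n z with ⟨h, -⟩ | ⟨h, -⟩
  · rw [h]; exact D.Γ.factor_mul_self (by decide) z
  · rw [h]; exact D.Δ.factor_mul_self (by decide) z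

theorem lensOpening_eq (n : ℕ) (T : ℂ → Mat3) (z : ℂ) :
    D.lensOpening n T z = T z * (1 - D.factor n z) := by
  obtain ⟨⟨h0, h1, h2⟩, ⟨h3, h4⟩, h5⟩ := D.domains_pairwise
  unfold lensOpening
  split_ifs with c1 c2 c3 c4
  · rw [factor, D.Δ_factor_eq_zero (disjoint_left.1 h1 c1) (disjoint_left.1 h2 c1), Lens.factor,
      if_pos c1, add_zero, D.Γ.upper_inv (by decide)]
  · rw [factor, D.Δ_factor_eq_zero (disjoint_left.1 h3 c2) (disjoint_left.1 h4 c2), Lens.factor,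
      if_neg c1, if_pos c2, add_zero, sub_neg_eq_add]; rfl
  · rw [factor, D.Γ_factor_eq_zero c1 c2, Lens.factor, if_pos c3, zero_add,
      D.Δ.upper_inv (by decide)]
  · rw [factor, D.Γ_factor_eq_zero c1 c2, Lens.factor, if_neg c3, if_pos c4, zero_add,
      sub_neg_eq_add]; rfl
  · rw [factor, D.Γ_factor_eq_zero c1 c2, D.Δ_factor_eq_zero c3 c4, add_zero, sub_zero, mul_one]

theorem differentiableAt_phases {z : ℂ} (hz : z ∉ D.conductors) :
    DifferentiableAt ℂ D.Γ.phase z ∧ DifferentiableAt ℂ D.Δ.phase z :=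
  ⟨D.phaseΓ_analytic.differentiableAt (D.isClosed_conductors.isOpen_compl.mem_nhds hz),
    D.phaseΔ_analytic.differentiableAt (D.isClosed_conductors.isOpen_compl.mem_nhds hz)⟩

theorem differentiableAt_factor (n : ℕ) {z : ℂ} (hz : z ∉ D.contourS) :
    DifferentiableAt ℂ (D.factor n) z := by
  obtain ⟨h1, h2⟩ := D.differentiableAt_phases fun h => hz (D.conductors_subset_contourS h)
  exact (D.Γ.differentiableAt_factor h1 fun h => hz (Or.inl h)).add
    (D.Δ.differentiableAt_factor h2 fun h => hz (Or.inr h))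

theorem differentiableAt_lensOpening {n : ℕ} {T : ℂ → Mat3} (hT : D.IsT n T) {z : ℂ}
    (hz : z ∉ D.contourS) : DifferentiableAt ℂ (D.lensOpening n T) z := by
  have h1 : D.lensOpening n T = fun z => T z * (1 - D.factor n z) :=
    funext (D.lensOpening_eq n T)
  rw [h1]
  exact (hT.analytic.differentiableAt D.isClosed_conductors.isOpen_compl
    fun h => hz (D.conductors_subset_contourS h)).mul
    ((differentiableAt_const _).sub (D.differentiableAt_factor n hz))

theorem lensOpening_Γ (n : ℕ) (T : ℂ → Mat3) :
    (∀ z ∈ D.Γ.domUp, D.lensOpening n T z = T z * (D.Γ.upper 2 n z)⁻¹) ∧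
      ∀ z ∈ D.Γ.domLo, D.lensOpening n T z = T z * D.Γ.lower 2 n z := by
  obtain ⟨⟨h0, -⟩, -⟩ := D.domains_pairwise
  refine ⟨fun z hz => ?_, fun z hz => ?_⟩
  · rw [lensOpening, if_pos hz]
  · rw [lensOpening, if_neg (disjoint_right.1 h0 hz), if_pos hz]

theorem lensOpening_Δ (n : ℕ) (T : ℂ → Mat3) :
    (∀ z ∈ D.Δ.domUp, D.lensOpening n T z = T z * (D.Δ.upper 1 n z)⁻¹) ∧
      ∀ z ∈ D.Δ.domLo, D.lensOpening n T z = T z * D.Δ.lower 1 n z := by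
  obtain ⟨⟨-, h1, h2⟩, ⟨h3, h4⟩, h5⟩ := D.domains_pairwise
  refine ⟨fun z hz => ?_, fun z hz => ?_⟩
  · rw [lensOpening, if_neg (disjoint_right.1 h1 hz), if_neg (disjoint_right.1 h3 hz), if_pos hz]
  · rw [lensOpening, if_neg (disjoint_right.1 h2 hz), if_neg (disjoint_right.1 h4 hz),
      if_neg (disjoint_right.1 h5 hz), if_pos hz]

theorem lensOpening_of_not_mem {n : ℕ} {T : ℂ → Mat3} {z : ℂ} (h1 : z ∉ D.Γ.domUp)
    (h2 : z ∉ D.Γ.domLo) (h3 : z ∉ D.Δ.domUp) (h4 : z ∉ D.Δ.domLo) : D.lensOpening n T z = T z := by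
  rw [lensOpening, if_neg h1, if_neg h2, if_neg h3, if_neg h4]

/-- Away from the edges, the quotient of the lens-opened unknown and a function with the same jumps
is continuous across the contour. -/
theorem tendsto_lensOpening_mul_inv {n : ℕ} {T F : ℂ → Mat3} {U : Set ℂ} (hT : D.IsT n T)
    (hΓ : D.Γ.HasLensJumps 2 P13 n F U) (hΔ : D.Δ.HasLensJumps 1 P12 n F U) {z : ℂ}
    (hz : z ∈ D.contourS) (hz0 : z ≠ 0) (hz1 : z ≠ (D.x₀ : ℂ)) (hcl : z ∈ closure U) :
    ∃ A, Tendsto (fun w => D.lensOpening n T w * (F w)⁻¹) (𝓝[U \ D.contourS] z) (𝓝 A) := by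
  have hd := D.arcs_disjoint
  simp only [List.pairwise_cons, List.mem_cons, List.not_mem_nil, or_false, forall_eq_or_imp,
    forall_eq] at hd
  obtain ⟨⟨h12, h13, h14, h15, h16⟩, ⟨h23, h24, h25, h26⟩, ⟨h34, h35, h36⟩, ⟨h45, h46⟩, h56, -⟩ := hd
  have sub : ∀ {γ : Arc}, γ.carrier ⊆ D.contourS → γ.openPart ⊆ D.contourS := fun h =>
    (Arc.openPart_subset_carrier _).trans h
  have s1 : D.Γ.arc.carrier ⊆ D.contourS := fun w h => Or.inl (Or.inl (Or.inl h))
  have s2 : D.Γ.lipUp.carrier ⊆ D.contourS := fun w h => Or.inl (Or.inl (Or.inr h))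
  have s3 : D.Γ.lipLo.carrier ⊆ D.contourS := fun w h => Or.inl (Or.inr h)
  have s4 : D.Δ.arc.carrier ⊆ D.contourS := fun w h => Or.inr (Or.inl (Or.inl h))
  have s5 : D.Δ.lipUp.carrier ⊆ D.contourS := fun w h => Or.inr (Or.inl (Or.inr h))
  have s6 : D.Δ.lipLo.carrier ⊆ D.contourS := fun w h => Or.inr (Or.inr h)
  have j1 := D.Γ.arc_joins
  have j2 := D.Γ.lipUp_joins
  have j3 := D.Γ.lipLo_joins
  have j4 := D.Δ.arc_joins
  have j5 := D.Δ.lipUp_joins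
  have j6 := D.Δ.lipLo_joins
  have out := @not_mem_carrier_of_disjoint
  have dT : ∀ {w}, w ∉ D.Γ.arc.carrier → w ∉ D.Δ.arc.carrier → DifferentiableAt ℂ T w :=
    fun h h' => hT.analytic.differentiableAt D.isClosed_conductors.isOpen_compl
      fun hc => hc.elim h h'
  have dφ : ∀ {w}, w ∉ D.Γ.arc.carrier → w ∉ D.Δ.arc.carrier →
      DifferentiableAt ℂ D.Γ.phase w ∧ DifferentiableAt ℂ D.Δ.phase w :=
    fun h h' => D.differentiableAt_phases fun hc => hc.elim h h'
  have e1 := D.eventually_not_mem_domain (by simp) D.Γ.isOpen_domUp hz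
  have e2 := D.eventually_not_mem_domain (by simp) D.Γ.isOpen_domLo hz
  have e3 := D.eventually_not_mem_domain (by simp) D.Δ.isOpen_domUp hz
  have e4 := D.eventually_not_mem_domain (by simp) D.Δ.isOpen_domLo hz
  rw [D.Γ.frontier_domUp] at e1
  rw [D.Γ.frontier_domLo] at e2
  rw [D.Δ.frontier_domUp] at e3
  rw [D.Δ.frontier_domLo] at e4
  have open_of : ∀ {γ : Arc}, γ.Joins 0 (D.x₀ : ℂ) → z ∈ γ.carrier → z ∈ γ.openPart := by
    intro γ hj h
    rcases γ.mem_openPart_or_of_joins hj h with h | h | h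
    · exact h
    · exact absurd h hz0
    · exact absurd h hz1
  obtain ⟨hΓ1, hΓ2, hΓ3⟩ := hΓ
  obtain ⟨hΔ1, hΔ2, hΔ3⟩ := hΔ
  obtain ⟨oΓu, oΓl⟩ := D.lensOpening_Γ n T
  obtain ⟨oΔu, oΔl⟩ := D.lensOpening_Δ n T
  rcases hz with ((h | h) | h) | ((h | h) | h)
  · obtain ⟨t, ht, rfl⟩ := open_of j1 h
    obtain ⟨Sp, Sm, hp, hm, hS⟩ := D.Γ.opened_arc (by decide) hT.jumpΓ oΓu oΓl ht
    exact hΓ1.tendsto_mul_inv ht (sub s1) hcl hp hm hS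
  · have ho := open_of j2 h
    have n1 := out j2 j1 h12.symm ho
    have n4 := out j2 j4 h24 ho
    have ev : ∀ᶠ w in 𝓝 z, w ∉ D.Γ.domUp → D.lensOpening n T w = T w := by
      filter_upwards [e2 fun h => h.elim n1 (out j2 j3 h23 ho),
        e3 fun h => h.elim n4 (out j2 j5 h25 ho),
        e4 fun h => h.elim n4 (out j2 j6 h26 ho)] with w w2 w3 w4 w1
      exact D.lensOpening_of_not_mem w1 w2 w3 w4
    obtain ⟨t, ht, rfl⟩ := ho
    obtain ⟨Sp, Sm, hp, hm, hS⟩ := D.Γ.opened_lipUp (by decide) ht (dT n1 n4) (dφ n1 n4).1 n1 oΓu ev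
    exact hΓ2.tendsto_mul_inv ht (sub s2) hcl hp hm hS
  · have ho := open_of j3 h
    have n1 := out j3 j1 h13.symm ho
    have n4 := out j3 j4 h34 ho
    have ev : ∀ᶠ w in 𝓝 z, w ∉ D.Γ.domLo → D.lensOpening n T w = T w := by
      filter_upwards [e1 fun h => h.elim n1 (out j3 j2 h23.symm ho),
        e3 fun h => h.elim n4 (out j3 j5 h35 ho),
        e4 fun h => h.elim n4 (out j3 j6 h36 ho)] with w w1 w3 w4 w2
      exact D.lensOpening_of_not_mem w1 w2 w3 w4
    obtain ⟨t, ht, rfl⟩ := ho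
    obtain ⟨Sp, Sm, hp, hm, hS⟩ := D.Γ.opened_lipLo ht (dT n1 n4) (dφ n1 n4).1 n1 oΓl ev
    exact hΓ3.tendsto_mul_inv ht (sub s3) hcl hp hm hS
  · obtain ⟨t, ht, rfl⟩ := open_of j4 h
    obtain ⟨Sp, Sm, hp, hm, hS⟩ := D.Δ.opened_arc (by decide) hT.jumpΔ oΔu oΔl ht
    exact hΔ1.tendsto_mul_inv ht (sub s4) hcl hp hm hS
  · have ho := open_of j5 h
    have n1 := out j5 j1 h15.symm ho
    have n4 := out j5 j4 h45.symm ho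
    have ev : ∀ᶠ w in 𝓝 z, w ∉ D.Δ.domUp → D.lensOpening n T w = T w := by
      filter_upwards [e1 fun h => h.elim n1 (out j5 j2 h25.symm ho),
        e2 fun h => h.elim n1 (out j5 j3 h35.symm ho),
        e4 fun h => h.elim n4 (out j5 j6 h56 ho)] with w w1 w2 w4 w3
      exact D.lensOpening_of_not_mem w1 w2 w3 w4
    obtain ⟨t, ht, rfl⟩ := ho
    obtain ⟨Sp, Sm, hp, hm, hS⟩ := D.Δ.opened_lipUp (by decide) ht (dT n1 n4) (dφ n1 n4).2 n4 oΔu ev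
    exact hΔ2.tendsto_mul_inv ht (sub s5) hcl hp hm hS
  · have ho := open_of j6 h
    have n1 := out j6 j1 h16.symm ho
    have n4 := out j6 j4 h46.symm ho
    have ev : ∀ᶠ w in 𝓝 z, w ∉ D.Δ.domLo → D.lensOpening n T w = T w := by
      filter_upwards [e1 fun h => h.elim n1 (out j6 j2 h26.symm ho),
        e2 fun h => h.elim n1 (out j6 j3 h36.symm ho),
        e3 fun h => h.elim n4 (out j6 j5 h56.symm ho)] with w w1 w2 w3 w4
      exact D.lensOpening_of_not_mem w1 w2 w3 w4
    obtain ⟨t, ht, rfl⟩ := ho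
    obtain ⟨Sp, Sm, hp, hm, hS⟩ := D.Δ.opened_lipLo ht (dT n1 n4) (dφ n1 n4).2 n4 oΔl ev
    exact hΔ3.tendsto_mul_inv ht (sub s6) hcl hp hm hS

/-- Away from the edges, `S N⁻¹` is continuous across the conductors. -/
theorem tendsto_lensOpening_mul_outer_inv {n : ℕ} {T N : ℂ → Mat3} (hT : D.IsT n T)
    (hN : D.IsOuter N) {z : ℂ} (hz : z ∈ D.conductors) (hz0 : z ≠ 0) (hz1 : z ≠ (D.x₀ : ℂ)) :
    ∃ A, Tendsto (fun w => D.lensOpening n T w * (N w)⁻¹) (𝓝[D.conductorsᶜ] z) (𝓝 A) := by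
  have open_of : ∀ {γ : Arc}, γ.Joins 0 (D.x₀ : ℂ) → z ∈ γ.carrier → z ∈ γ.openPart := by
    intro γ hj h
    rcases γ.mem_openPart_or_of_joins hj h with h | h | h
    · exact h
    · exact absurd h hz0
    · exact absurd h hz1
  obtain ⟨oΓu, oΓl⟩ := D.lensOpening_Γ n T
  obtain ⟨oΔu, oΔl⟩ := D.lensOpening_Δ n T
  rw [compl_eq_univ_sdiff]
  rcases hz with h | h
  · obtain ⟨t, ht, rfl⟩ := open_of D.Γ.arc_joins h
    obtain ⟨Sp, Sm, hp, hm, hS⟩ := D.Γ.opened_arc (by decide) hT.jumpΓ oΓu oΓl ht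
    exact hN.jumpΓ.tendsto_mul_inv ht (D.Γ.arc.openPart_subset_carrier.trans subset_union_left)
      (by simp) hp hm hS
  · obtain ⟨t, ht, rfl⟩ := open_of D.Δ.arc_joins h
    obtain ⟨Sp, Sm, hp, hm, hS⟩ := D.Δ.opened_arc (by decide) hT.jumpΔ oΔu oΔl ht
    exact hN.jumpΔ.tendsto_mul_inv ht (D.Δ.arc.openPart_subset_carrier.trans subset_union_right)
      (by simp) hp hm hS

end Regime

end Jumps

end TwoEdge

/-! ### The error matrix inside the endpoint disks -/

namespace TwoEdge

section Inner

attribute [local instance] Matrix.linftyOpNormedRing Matrix.linftyOpNormedAlgebra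

theorem norm_entry_le (A : Mat3) (i j : Fin 3) : ‖A i j‖ ≤ ‖A‖ := by
  have h1 : ∑ j, ‖A i j‖₊ ≤ Finset.univ.sup fun i => ∑ j, ‖A i j‖₊ :=
    Finset.le_sup (f := fun i => ∑ j, ‖A i j‖₊) (Finset.mem_univ i)
  have h2 : ‖A i j‖₊ ≤ ∑ j, ‖A i j‖₊ :=
    Finset.single_le_sum (f := fun j => ‖A i j‖₊) (fun _ _ => zero_le) (Finset.mem_univ j)
  rw [Matrix.linfty_opNorm_def]
  exact_mod_cast h2.trans h1

theorem norm_le_sum_entries (A : Mat3) : ‖A‖ ≤ ∑ p : Fin 3 × Fin 3, ‖A p.1 p.2‖ := by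
  rw [Matrix.linfty_opNorm_def]
  have h : (Finset.univ.sup fun i => ∑ j, ‖A i j‖₊) ≤ ∑ p : Fin 3 × Fin 3, ‖A p.1 p.2‖₊ := by
    refine Finset.sup_le fun i _ => ?_
    rw [Fintype.sum_prod_type]
    exact Finset.single_le_sum (f := fun i => ∑ j, ‖A i j‖₊) (fun _ _ => zero_le)
      (Finset.mem_univ i)
  exact_mod_cast h

theorem norm_le_of_entries_le {A : Mat3} {m : ℝ} (h : ∀ i j, ‖A i j‖ ≤ m) : ‖A‖ ≤ 9 * m := by
  refine (norm_le_sum_entries A).trans ((Finset.sum_le_sum fun p _ => h p.1 p.2).trans ?_)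
  simp

namespace Regime

variable (D : Regime)

theorem isOpen_compl_contourS : IsOpen D.contourSᶜ := D.isClosed_contourS.isOpen_compl

theorem dense_compl_contour {a b : ℂ} (L : Lens a b) : Dense L.contourᶜ := by
  rw [Lens.contour, compl_union, compl_union]
  exact (L.arc.dense_compl_carrier.inter_of_isOpen_left L.lipUp.dense_compl_carrier
    L.arc.isClosed_carrier.isOpen_compl).inter_of_isOpen_right L.lipLo.dense_compl_carrier
    L.lipLo.isClosed_carrier.isOpen_compl

theorem dense_compl_contourS : Dense D.contourSᶜ := by
  rw [contourS, compl_union]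
  exact (dense_compl_contour D.Γ).inter_of_isOpen_left (dense_compl_contour D.Δ)
    (isClosed_contour D.Γ).isOpen_compl

theorem dense_compl_conductors : Dense D.conductorsᶜ :=
  D.dense_compl_contourS.mono (compl_subset_compl.2 D.conductors_subset_contourS)

/-- Painlevé's theorem for the six arcs of the contour. -/
theorem differentiableOn_of_contourS {f : ℂ → Mat3} {U : Set ℂ} (hU : IsOpen U)
    (hf : ContinuousOn f U) (hd : DifferentiableOn ℂ f (U \ D.contourS)) :
    DifferentiableOn ℂ f U := by
  refine differentiableOn_of_lipschitz_arcs [D.Γ.arc.toFun, D.Γ.lipUp.toFun, D.Γ.lipLo.toFun,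
    D.Δ.arc.toFun, D.Δ.lipUp.toFun, D.Δ.lipLo.toFun] ?_ hU hf (hd.mono ?_)
  · intro γ hγ
    simp only [List.mem_cons, List.not_mem_nil, or_false] at hγ
    rcases hγ with rfl | rfl | rfl | rfl | rfl | rfl <;> exact Arc.exists_lipschitzOnWith _
  · refine sdiff_subset_sdiff_right fun z hz => ?_
    simp only [mem_ofPred_eq, List.mem_cons, List.not_mem_nil, or_false, exists_eq_or_imp,
      exists_eq_left]
    rcases hz with ((h | h) | h) | ((h | h) | h)
    · exact Or.inl h
    · exact Or.inr (Or.inl h)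
    · exact Or.inr (Or.inr (Or.inl h))
    · exact Or.inr (Or.inr (Or.inr (Or.inl h)))
    · exact Or.inr (Or.inr (Or.inr (Or.inr (Or.inl h))))
    · exact Or.inr (Or.inr (Or.inr (Or.inr (Or.inr h))))

/-- In an endpoint disk, `S P⁻¹` extends analytically across the contour and the edge: it is
continuous across the open arcs, so these are removable by Painlevé's theorem, and at the edge it
is less singular than a simple pole. -/
theorem exists_inner_extension {n : ℕ} {T N P : ℂ → Mat3} {M r : ℝ} {e : ℂ} (hr : 0 < r)
    (hT : D.IsT n T) (hP : D.IsLocal N n T M e r P)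
    (he : ∀ z ∈ Metric.closedBall e r, z ≠ e → z ≠ 0 ∧ z ≠ (D.x₀ : ℂ)) (hec : e ∈ D.contourS) :
    ∃ A : ℂ → Mat3, ContinuousOn A (Metric.closedBall e r) ∧
      DifferentiableOn ℂ A (Metric.ball e r) ∧
      ∀ z ∈ Metric.closedBall e r \ D.contourS, A z = D.lensOpening n T z * (P z)⁻¹ := by
  have : CompleteSpace Mat3 := FiniteDimensional.complete ℂ Mat3
  set f : ℂ → Mat3 := fun z => D.lensOpening n T z * (P z)⁻¹ with hf
  set s : Set ℂ := Metric.ball e r \ D.contourS with hs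
  have hso : IsOpen s := Metric.isOpen_ball.sdiff D.isClosed_contourS
  have hcb : closure (Metric.ball e r) = Metric.closedBall e r := closure_ball e hr.ne'
  have hcl : Metric.closedBall e r ⊆ closure s := by
    rw [← hcb]
    exact closure_minimal (D.dense_compl_contourS.open_subset_closure_inter Metric.isOpen_ball)
      isClosed_closure
  have hlim : ∀ z ∈ Metric.closedBall e r \ D.contourS, Tendsto f (𝓝[s] z) (𝓝 (f z)) := by
    intro z hz
    have h1 : Tendsto P (𝓝[s] z) (𝓝 (P z)) := (hP.continuous_boundary z hz).mono_left
      (nhdsWithin_mono _ (sdiff_subset_sdiff_left Metric.ball_subset_closedBall))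
    have h2 : Tendsto (D.lensOpening n T) (𝓝[s] z) (𝓝 (D.lensOpening n T z)) :=
      (D.differentiableAt_lensOpening hT hz.2).continuousAt.tendsto.mono_left nhdsWithin_le_nhds
    exact h2.mul (tendsto_matrix_inv h1 (hP.invertible z hz))
  set G := extendFrom s f with hG
  have hGf : ∀ z ∈ Metric.closedBall e r \ D.contourS, G z = f z := fun z hz =>
    extendFrom_eq (hcl hz.1) (hlim z hz)
  have hGc : ContinuousOn G (Metric.closedBall e r \ {e}) := by
    refine continuousOn_extendFrom (sdiff_subset.trans hcl) fun z hz => ?_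
    by_cases hzc : z ∈ D.contourS
    · obtain ⟨h0, h1⟩ := he z hz.1 hz.2
      exact D.tendsto_lensOpening_mul_inv hT hP.jumpsΓ hP.jumpsΔ hzc h0 h1 (hcb ▸ hz.1)
    · exact ⟨_, hlim z ⟨hz.1, hzc⟩⟩
  have hGd : DifferentiableOn ℂ G (Metric.ball e r \ {e}) := by
    refine D.differentiableOn_of_contourS (Metric.isOpen_ball.sdiff isClosed_singleton)
      (hGc.mono (sdiff_subset_sdiff_left Metric.ball_subset_closedBall)) fun z hz => ?_
    have hzs : z ∈ s := ⟨hz.1.1, hz.2⟩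
    have h1 : DifferentiableAt ℂ f z :=
      (D.differentiableAt_lensOpening hT hz.2).mul (differentiableAt_matrix_inv
        (hP.analytic.differentiableAt hso hzs)
        (hP.invertible z ⟨Metric.ball_subset_closedBall hzs.1, hzs.2⟩))
    refine (h1.congr_of_eventuallyEq ?_).differentiableWithinAt
    filter_upwards [hso.mem_nhds hzs] with w hw
    exact hGf w ⟨Metric.ball_subset_closedBall hw.1, hw.2⟩
  have hfo : f =o[𝓝[D.contourSᶜ] e] fun z => (z - e)⁻¹ := by
    have h1 : (fun z => ∑ p : Fin 3 × Fin 3, ‖f z p.1 p.2‖) =o[𝓝[D.contourSᶜ] e]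
        fun z => (z - e)⁻¹ := by
      rw [← Finset.sum_fn]
      exact IsLittleO.sum fun (p : Fin 3 × Fin 3) _ => (hP.edge p.1 p.2).norm_left
    refine (IsBigO.of_norm_le fun z => norm_le_sum_entries (f z)).trans_isLittleO h1
  have hGo : (fun z => G z - G e) =o[𝓝[≠] e] fun z => (z - e)⁻¹ := by
    refine IsLittleO.sub ?_ ?_
    · refine IsLittleO.of_bound fun ε hε => ?_
      have h1 := hfo.bound hε
      rw [eventually_nhdsWithin_iff, Metric.eventually_nhds_iff_ball] at h1
      obtain ⟨δ, hδ, h1⟩ := h1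
      rw [eventually_nhdsWithin_iff, Metric.eventually_nhds_iff_ball]
      refine ⟨min δ r, lt_min hδ hr, fun z hz hze => ?_⟩
      set O : Set ℂ := Metric.ball e (min δ r) \ {e} with hO
      have hOo : IsOpen O := Metric.isOpen_ball.sdiff isClosed_singleton
      have hzO : z ∈ O := ⟨hz, hze⟩
      have hOb : O ⊆ Metric.ball e r \ {e} :=
        sdiff_subset_sdiff_left (Metric.ball_subset_ball (min_le_right _ _))
      have hc1 : ContinuousAt (fun w => ‖G w‖) z :=
        ((hGd.mono hOb).differentiableAt (hOo.mem_nhds hzO)).continuousAt.norm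
      have hc2 : ContinuousAt (fun w => ε * ‖(w - e)⁻¹‖) z :=
        ((continuousAt_id.sub continuousAt_const).inv₀ (sub_ne_zero.2 hze)).norm.const_mul ε
      refine hc1.continuousWithinAt.closure_le
        (D.dense_compl_contourS.open_subset_closure_inter hOo hzO) hc2.continuousWithinAt
        fun w hw => ?_
      rw [hGf w ⟨Metric.ball_subset_closedBall (hOb hw.1).1, hw.2⟩]
      exact h1 w (Metric.ball_subset_ball (min_le_left _ _) hw.1.1) hw.2
    · refine (isLittleO_const_left.2 (Or.inr ?_))
      have h2 : Tendsto (fun z : ℂ => z - e) (𝓝[≠] e) (𝓝[≠] 0) := by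
        refine tendsto_nhdsWithin_iff.2 ⟨?_, ?_⟩
        · have : Tendsto (fun z : ℂ => z - e) (𝓝 e) (𝓝 (e - e)) :=
            (continuous_id.sub continuous_const).tendsto e
          rw [sub_self] at this
          exact this.mono_left nhdsWithin_le_nhds
        · filter_upwards [self_mem_nhdsWithin] with z hz
          exact sub_ne_zero.2 hz
      exact tendsto_norm_cobounded_atTop.comp (tendsto_inv₀_nhdsNE_zero.comp h2)
  have hAd := Complex.differentiableOn_update_limUnder_of_isLittleO
    (Metric.ball_mem_nhds e hr) hGd hGo
  refine ⟨Function.update G e (limUnder (𝓝[≠] e) G), fun z hz => ?_, hAd, fun z hz => ?_⟩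
  · by_cases hze : z = e
    · subst hze
      exact (hAd.differentiableAt (Metric.ball_mem_nhds z hr)).continuousAt.continuousWithinAt
    · have h1 : ContinuousWithinAt G (Metric.closedBall e r) z :=
        ((hGc z ⟨hz, hze⟩).mono_of_mem_nhdsWithin
          (inter_mem self_mem_nhdsWithin (nhdsWithin_le_nhds (isOpen_ne.mem_nhds hze))))
      exact (continuousWithinAt_update_of_ne hze).2 h1
  · have hze : z ≠ e := fun h => hz.2 (h ▸ hec)
    rw [Function.update_of_ne hze]
    exact hGf z hz

end Regime

end Inner

end TwoEdge

/-! ### Cutoffs near the lips -/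

namespace TwoEdge

/-- A smooth cutoff between two disjoint closed sets, one of them bounded. -/
theorem exists_cutoff {s t : Set ℂ} (hs : IsClosed s) (ht : IsClosed t) (hst : Disjoint s t) :
    ∃ f : ℂ → ℝ, ContDiff ℝ 2 f ∧ (∀ z ∈ s, ∀ᶠ w in 𝓝 z, f w = 0) ∧
      (∀ z ∈ t, ∀ᶠ w in 𝓝 z, f w = 1) ∧ ∀ z, f z ∈ Icc (0 : ℝ) 1 := by
  obtain ⟨f, h0, h1, hf⟩ := exists_contMDiffMap_zero_one_nhds_of_isClosed
    (modelWithCornersSelf ℝ ℂ) (n := 2) hs ht hst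
  exact ⟨f, f.contMDiff.contDiff, fun z hz => eventually_nhdsSet_iff_forall.1 h0 z hz,
    fun z hz => eventually_nhdsSet_iff_forall.1 h1 z hz, hf⟩

/-- A pair of cutoffs that spreads the jumps on the lips over a neighbourhood. The function `χ`
lives where the exponentials are small, and equals `1` near the lips outside the endpoint disks.
The function `θ` equals `1` outside these disks, and vanishes near those points of the lips where
`χ` is not `1`, so that `θ ∂̄χ` vanishes near all of the contour. -/
structure LensCutoff (D : Regime) where
  χ : ℂ → ℝ
  θ : ℂ → ℝ
  contDiff_χ : ContDiff ℝ 2 χ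
  contDiff_θ : ContDiff ℝ 2 θ
  χ_mem : ∀ z, χ z ∈ Icc (0 : ℝ) 1
  θ_mem : ∀ z, θ z ∈ Icc (0 : ℝ) 1
  compact : HasCompactSupport χ
  off_conductors : ∀ z ∈ tsupport χ, z ∉ D.conductors
  signΓ : ∀ z ∈ tsupport χ, z ∈ closure D.Γ.domUp ∪ closure D.Γ.domLo → D.c / 2 ≤ (D.Γ.phase z).re
  signΔ : ∀ z ∈ tsupport χ, z ∈ closure D.Δ.domUp ∪ closure D.Δ.domLo → D.c / 2 ≤ (D.Δ.phase z).re
  θ_one : ∀ z, z ∉ D.U0 ∪ D.U1 → ∀ᶠ w in 𝓝 z, θ w = 1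
  lips : ∀ z ∈ D.contourS, z ∉ D.conductors → (∀ᶠ w in 𝓝 z, χ w = 1) ∨ ∀ᶠ w in 𝓝 z, θ w = 0

namespace Regime

variable (D : Regime)

theorem edges_mem_disks : (0 : ℂ) ∈ D.U0 ∪ D.U1 ∧ (D.x₀ : ℂ) ∈ D.U0 ∪ D.U1 :=
  ⟨Or.inl (Metric.mem_ball_self D.r₀_pos), Or.inr (Metric.mem_ball_self D.r₁_pos)⟩

/-- The four lips. -/
def lipSet : Set ℂ :=
  (D.Γ.lipUp.carrier ∪ D.Γ.lipLo.carrier) ∪ (D.Δ.lipUp.carrier ∪ D.Δ.lipLo.carrier)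

theorem isCompact_lipSet : IsCompact D.lipSet :=
  (D.Γ.lipUp.isCompact_carrier.union D.Γ.lipLo.isCompact_carrier).union
    (D.Δ.lipUp.isCompact_carrier.union D.Δ.lipLo.isCompact_carrier)

theorem mem_lipSet_of_mem_contourS {z : ℂ} (h : z ∈ D.contourS) (hz : z ∉ D.conductors) :
    z ∈ D.lipSet := by
  rcases h with ((h | h) | h) | ((h | h) | h)
  · exact absurd (Or.inl h) hz
  · exact Or.inl (Or.inl h)
  · exact Or.inl (Or.inr h)
  · exact absurd (Or.inr h) hz
  · exact Or.inr (Or.inl h)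
  · exact Or.inr (Or.inr h)

/-- The region in which the factors attached to one conductor are absent or exponentially small. -/
def smallRegion (L : Lens 0 (D.x₀ : ℂ)) : Set ℂ :=
  (closure L.domUp ∪ closure L.domLo)ᶜ ∪ (D.conductorsᶜ ∩ {z | D.c / 2 < (L.phase z).re})

theorem isOpen_smallRegion {L : Lens 0 (D.x₀ : ℂ)}
    (h : DifferentiableOn ℂ L.phase D.conductorsᶜ) : IsOpen (D.smallRegion L) := by
  refine (isClosed_closure.union isClosed_closure).isOpen_compl.union ?_
  exact (Complex.continuous_re.comp_continuousOn h.continuousOn).isOpen_inter_preimage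
    D.isClosed_conductors.isOpen_compl isOpen_Ioi

theorem lips_subset_region : D.lipSet \ (D.U0 ∪ D.U1) ⊆
    D.conductorsᶜ ∩ (D.smallRegion D.Γ ∩ D.smallRegion D.Δ) := by
  rintro z ⟨hz, hzU⟩
  have hd := D.arcs_disjoint
  simp only [List.pairwise_cons, List.mem_cons, List.not_mem_nil, or_false, forall_eq_or_imp,
    forall_eq] at hd
  obtain ⟨⟨h12, h13, h14, h15, h16⟩, ⟨h23, h24, h25, h26⟩, ⟨h34, h35, h36⟩, ⟨h45, h46⟩, h56, -⟩ := hd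
  have open_of : ∀ {γ : Arc}, γ.Joins 0 (D.x₀ : ℂ) → z ∈ γ.carrier → z ∈ γ.openPart := by
    intro γ hj h
    rcases γ.mem_openPart_or_of_joins hj h with h | h | h
    · exact h
    · exact absurd (h ▸ D.edges_mem_disks.1) hzU
    · exact absurd (h ▸ D.edges_mem_disks.2) hzU
  have j1 := D.Γ.arc_joins
  have j2 := D.Γ.lipUp_joins
  have j3 := D.Γ.lipLo_joins
  have j4 := D.Δ.arc_joins
  have j5 := D.Δ.lipUp_joins
  have j6 := D.Δ.lipLo_joins
  have out := @not_mem_carrier_of_disjoint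
  have hzS : z ∈ D.contourS := by
    rcases hz with (h | h) | (h | h)
    · exact Or.inl (Or.inl (Or.inr h))
    · exact Or.inl (Or.inr h)
    · exact Or.inr (Or.inl (Or.inr h))
    · exact Or.inr (Or.inr h)
  have not_cl : ∀ {Ω : Set ℂ}, Ω ∈ [D.Γ.domUp, D.Γ.domLo, D.Δ.domUp, D.Δ.domLo] → IsOpen Ω →
      z ∉ frontier Ω → z ∉ closure Ω := fun hΩ ho hf hc =>
    hf ⟨hc, by
      rw [ho.interior_eq]
      exact fun h => disjoint_left.1 (D.domains_off_contour _ hΩ) h hzS⟩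
  have c1 := not_cl (by simp) D.Γ.isOpen_domUp
  have c2 := not_cl (by simp) D.Γ.isOpen_domLo
  have c3 := not_cl (by simp) D.Δ.isOpen_domUp
  have c4 := not_cl (by simp) D.Δ.isOpen_domLo
  rw [D.Γ.frontier_domUp] at c1
  rw [D.Γ.frontier_domLo] at c2
  rw [D.Δ.frontier_domUp] at c3
  rw [D.Δ.frontier_domLo] at c4
  have hc2 := half_lt_self D.c_pos
  have caseΓ : ∀ γ : Arc, z ∈ γ.openPart → γ.Joins 0 (D.x₀ : ℂ) →
      Disjoint γ.openPart D.Γ.arc.openPart → Disjoint γ.openPart D.Δ.arc.openPart →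
      Disjoint γ.openPart D.Δ.lipUp.openPart → Disjoint γ.openPart D.Δ.lipLo.openPart →
      D.c ≤ (D.Γ.phase z).re →
      z ∈ D.conductorsᶜ ∩ (D.smallRegion D.Γ ∩ D.smallRegion D.Δ) := by
    intro γ ho hj d1 d4 d5 d6 hc
    have n : z ∉ D.conductors := fun h => h.elim (out hj j1 d1 ho) (out hj j4 d4 ho)
    refine ⟨n, Or.inr ⟨n, hc2.trans_le hc⟩, Or.inl fun h => ?_⟩
    exact h.elim (c3 fun h => h.elim (out hj j4 d4 ho) (out hj j5 d5 ho))
      (c4 fun h => h.elim (out hj j4 d4 ho) (out hj j6 d6 ho))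
  have caseΔ : ∀ γ : Arc, z ∈ γ.openPart → γ.Joins 0 (D.x₀ : ℂ) →
      Disjoint γ.openPart D.Γ.arc.openPart → Disjoint γ.openPart D.Δ.arc.openPart →
      Disjoint γ.openPart D.Γ.lipUp.openPart → Disjoint γ.openPart D.Γ.lipLo.openPart →
      D.c ≤ (D.Δ.phase z).re →
      z ∈ D.conductorsᶜ ∩ (D.smallRegion D.Γ ∩ D.smallRegion D.Δ) := by
    intro γ ho hj d1 d4 d2 d3 hc
    have n : z ∉ D.conductors := fun h => h.elim (out hj j1 d1 ho) (out hj j4 d4 ho)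
    refine ⟨n, Or.inl fun h => ?_, Or.inr ⟨n, hc2.trans_le hc⟩⟩
    exact h.elim (c1 fun h => h.elim (out hj j1 d1 ho) (out hj j2 d2 ho))
      (c2 fun h => h.elim (out hj j1 d1 ho) (out hj j3 d3 ho))
  rcases hz with hl | hl
  · have hc := D.signΓ z ⟨hl, hzU⟩
    rcases hl with h | h
    · exact caseΓ _ (open_of j2 h) j2 h12.symm h24 h25 h26 hc
    · exact caseΓ _ (open_of j3 h) j3 h13.symm h34 h35 h36 hc
  · have hc := D.signΔ z ⟨hl, hzU⟩
    rcases hl with h | h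
    · exact caseΔ _ (open_of j5 h) j5 h15.symm h45.symm h25.symm h35.symm hc
    · exact caseΔ _ (open_of j6 h) j6 h16.symm h46.symm h26.symm h36.symm hc

theorem isOpen_disks : IsOpen (D.U0 ∪ D.U1) := Metric.isOpen_ball.union Metric.isOpen_ball

theorem nonempty_lensCutoff : Nonempty (LensCutoff D) := by
  set O : Set ℂ := D.conductorsᶜ ∩ (D.smallRegion D.Γ ∩ D.smallRegion D.Δ) with hO
  have hOo : IsOpen O := D.isClosed_conductors.isOpen_compl.inter
    ((D.isOpen_smallRegion D.phaseΓ_analytic).inter (D.isOpen_smallRegion D.phaseΔ_analytic))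
  have hKc : IsCompact (D.lipSet \ (D.U0 ∪ D.U1)) := D.isCompact_lipSet.diff D.isOpen_disks
  obtain ⟨R, hR⟩ := hKc.isBounded.subset_ball 0
  obtain ⟨χ, hχ, hχ0, hχ1, hχm⟩ := exists_cutoff
    (hOo.isClosed_compl.union (Metric.isOpen_ball (x := (0 : ℂ)) (ε := R)).isClosed_compl)
    hKc.isClosed (by
      rw [← compl_inter, disjoint_compl_left_iff_subset]
      exact subset_inter D.lips_subset_region hR)
  obtain ⟨θ, hθ, hθ0, hθ1, hθm⟩ := exists_cutoff
    (s := D.lipSet \ interior {z | χ z = 1}) (t := (D.U0 ∪ D.U1)ᶜ)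
    (D.isCompact_lipSet.diff isOpen_interior).isClosed D.isOpen_disks.isClosed_compl (by
      rw [disjoint_left]
      rintro z ⟨hz, hz'⟩ hzU
      exact hz' (mem_interior_iff_mem_nhds.2 (hχ1 z ⟨hz, hzU⟩)))
  have hts : ∀ z ∈ tsupport χ, z ∈ O := by
    intro z hz
    by_contra h
    exact notMem_tsupport_iff_eventuallyEq.2 (hχ0 z (Or.inl h)) hz
  have sub : ∀ {L : Lens 0 (D.x₀ : ℂ)} {z}, z ∈ D.smallRegion L →
      z ∈ closure L.domUp ∪ closure L.domLo → D.c / 2 ≤ (L.phase z).re := by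
    intro L z hz hc
    rcases hz with h | h
    · exact absurd hc h
    · exact h.2.le
  refine ⟨⟨χ, θ, hχ, hθ, hχm, hθm, ?_, fun z hz => (hts z hz).1, fun z hz => sub (hts z hz).2.1,
    fun z hz => sub (hts z hz).2.2, hθ1, fun z hz hzc => ?_⟩⟩
  · refine HasCompactSupport.of_support_subset_isCompact (isCompact_closedBall (0 : ℂ) R)
      fun z hz => ?_
    by_contra h
    exact hz (hχ0 z (Or.inr fun h' => h (Metric.ball_subset_closedBall h'))).self_of_nhds
  · by_cases h : z ∈ interior {z | χ z = 1}
    · exact Or.inl (mem_interior_iff_mem_nhds.1 h)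
    · exact Or.inr (hθ0 z ⟨D.mem_lipSet_of_mem_contourS hz hzc, h⟩)

end Regime

end TwoEdge

/-! ### The smoothed lens opening -/

namespace TwoEdge

section Smoothing

attribute [local instance] Matrix.linftyOpNormedRing Matrix.linftyOpNormedAlgebra

theorem norm_single_le (i j : Fin 3) (a : ℂ) : ‖(Matrix.single i j a : Mat3)‖ ≤ 9 * ‖a‖ :=
  norm_le_of_entries_le fun i' j' => by
    rw [Matrix.single_apply]
    split_ifs
    · exact le_rfl
    · simp

theorem norm_exp_phase_le {n : ℕ} {φ : ℂ} {c : ℝ} (h : c ≤ φ.re) :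
    ‖Complex.exp (-(n : ℂ) * φ)‖ ≤ Real.exp (-(c * n)) := by
  rw [Complex.norm_exp, Real.exp_le_exp]
  have : (-(n : ℂ) * φ).re = -(φ.re * n) := by
    simp [mul_comm]
  rw [this, neg_le_neg_iff]
  gcongr

theorem Lens.exists_norm_factor_le {a b : ℂ} (L : Lens a b) {K : Set ℂ} (hK : IsCompact K)
    (hoff : ∀ z ∈ K, z ∉ L.arc.carrier) {c : ℝ}
    (hsign : ∀ z ∈ K, z ∈ closure L.domUp ∪ closure L.domLo → c ≤ (L.phase z).re) :
    ∃ C : ℝ, 0 ≤ C ∧ ∀ (k : Fin 3) (n : ℕ), ∀ z ∈ K, ‖L.factor k n z‖ ≤ C * Real.exp (-(c * n)) := by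
  obtain ⟨Cu, hu⟩ := (hK.inter_right isClosed_closure).exists_bound_of_continuousOn
    (L.ampUp_analytic.continuousOn.mono fun z (hz : z ∈ K ∩ closure L.domUp) => ⟨hz.2, hoff z hz.1⟩)
  obtain ⟨Cl, hl⟩ := (hK.inter_right isClosed_closure).exists_bound_of_continuousOn
    (L.ampLo_analytic.continuousOn.mono fun z (hz : z ∈ K ∩ closure L.domLo) => ⟨hz.2, hoff z hz.1⟩)
  refine ⟨9 * max (max Cu Cl) 0, by positivity, fun k n z hz => ?_⟩
  unfold factor
  split_ifs with h1 h2
  · refine (norm_single_le _ _ _).trans ?_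
    rw [norm_mul, mul_assoc]
    have h3 := hu z ⟨hz, subset_closure h1⟩
    have h4 := norm_exp_phase_le (n := n) (hsign z hz (Or.inl (subset_closure h1)))
    gcongr
    exact h3.trans ((le_max_left _ _).trans (le_max_left _ _))
  · rw [norm_neg]
    refine (norm_single_le _ _ _).trans ?_
    rw [norm_mul, mul_assoc]
    have h3 := hl z ⟨hz, subset_closure h2⟩
    have h4 := norm_exp_phase_le (n := n) (hsign z hz (Or.inr (subset_closure h2)))
    gcongr
    exact h3.trans ((le_max_right _ _).trans (le_max_left _ _))
  · rw [norm_zero]; positivity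

theorem exp_neg_mul_le {c : ℝ} (hc : 0 < c) {n : ℕ} (hn : 1 ≤ n) :
    Real.exp (-(c * n)) ≤ c⁻¹ / n := by
  have hn' : (0 : ℝ) < n := by exact_mod_cast hn
  rw [Real.exp_neg, div_eq_mul_inv, ← mul_inv]
  refine inv_anti₀ (by positivity) ?_
  linarith [Real.add_one_le_exp (c * n)]

theorem contDiff_dbar {f : ℂ → ℂ} (hf : ContDiff ℝ 2 f) : ContDiff ℝ 1 (dbar f) := by
  have h1 : ContDiff ℝ 1 (fderiv ℝ f) := hf.fderiv_right (by norm_num)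
  exact ((h1.clm_apply contDiff_const).add
    ((h1.clm_apply contDiff_const).const_smul Complex.I)).const_smul (2⁻¹ : ℂ)

theorem dbar_congr {F : Type*} [NormedAddCommGroup F] [NormedSpace ℂ F] {f g : ℂ → F} {z : ℂ}
    (h : f =ᶠ[𝓝 z] g) : dbar f z = dbar g z := by
  rw [dbar, dbar, h.fderiv_eq]

theorem dbar_const {F : Type*} [NormedAddCommGroup F] [NormedSpace ℂ F] (a : F) (z : ℂ) :
    dbar (fun _ => a) z = 0 := dbar_eq_zero (differentiableAt_const a)

/-- The nilpotent correction of the lens opening, conjugated by the outer parametrix. -/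
noncomputable def Regime.conjFactor (D : Regime) (N : ℂ → Mat3) (n : ℕ) (z : ℂ) : Mat3 :=
  N z * D.factor n z * (N z)⁻¹

namespace Regime

variable {D : Regime} {N : ℂ → Mat3}

theorem IsOuter.isUnit_det (hN : D.IsOuter N) {z : ℂ} (hz : z ∉ D.conductors) :
    IsUnit (N z).det := (Matrix.isUnit_iff_isUnit_det _).1 (hN.invertible z hz)

theorem IsOuter.differentiableAt (hN : D.IsOuter N) {z : ℂ} (hz : z ∉ D.conductors) :
    DifferentiableAt ℂ N z := hN.analytic.differentiableAt D.isClosed_conductors.isOpen_compl hz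

theorem IsOuter.differentiableAt_inv (hN : D.IsOuter N) {z : ℂ} (hz : z ∉ D.conductors) :
    DifferentiableAt ℂ (fun w => (N w)⁻¹) z :=
  differentiableAt_matrix_inv (hN.differentiableAt hz) (hN.invertible z hz)

theorem conjFactor_mul_self (hN : D.IsOuter N) (n : ℕ) {z : ℂ} (hz : z ∉ D.conductors) :
    D.conjFactor N n z * D.conjFactor N n z = 0 := by
  have h := hN.isUnit_det hz
  calc D.conjFactor N n z * D.conjFactor N n z
      = N z * (D.factor n z * ((N z)⁻¹ * N z) * D.factor n z) * (N z)⁻¹ := by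
        simp only [conjFactor, mul_assoc]
    _ = 0 := by rw [Matrix.nonsing_inv_mul _ h, mul_one, D.factor_mul_self, mul_zero, zero_mul]

theorem differentiableAt_conjFactor (hN : D.IsOuter N) (n : ℕ) {z : ℂ} (hz : z ∉ D.contourS) :
    DifferentiableAt ℂ (D.conjFactor N n) z := by
  have hc : z ∉ D.conductors := fun h => hz (D.conductors_subset_contourS h)
  exact ((hN.differentiableAt hc).mul (D.differentiableAt_factor n hz)).mul
    (hN.differentiableAt_inv hc)

end Regime

namespace LensCutoff

variable {D : Regime} (κ : LensCutoff D) {N : ℂ → Mat3}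

theorem eventually_χ_eq_zero {z : ℂ} (hz : z ∉ tsupport κ.χ) : ∀ᶠ w in 𝓝 z, κ.χ w = 0 :=
  notMem_tsupport_iff_eventuallyEq.1 hz

/-- The derivative `∂̄χ`. -/
noncomputable def dχ : ℂ → ℂ := dbar fun z => (κ.χ z : ℂ)

theorem contDiff_ofReal_χ : ContDiff ℝ 2 fun z => (κ.χ z : ℂ) :=
  Complex.ofRealCLM.contDiff.comp κ.contDiff_χ

theorem contDiff_dχ : ContDiff ℝ 1 κ.dχ := contDiff_dbar κ.contDiff_ofReal_χ

theorem dχ_eq_zero_of_eventually {z : ℂ} {a : ℝ} (h : ∀ᶠ w in 𝓝 z, κ.χ w = a) : κ.dχ z = 0 := by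
  rw [dχ, dbar_congr (g := fun _ => (a : ℂ)) (by filter_upwards [h] with w hw; rw [hw]), dbar_const]

theorem dχ_eq_zero {z : ℂ} (hz : z ∉ tsupport κ.χ) : κ.dχ z = 0 :=
  κ.dχ_eq_zero_of_eventually (κ.eventually_χ_eq_zero hz)

theorem exists_norm_dχ_le : ∃ C : ℝ, ∀ z, ‖κ.dχ z‖ ≤ C := by
  have h : HasCompactSupport κ.dχ := HasCompactSupport.intro κ.compact fun z hz => κ.dχ_eq_zero hz
  exact κ.contDiff_dχ.continuous.bounded_above_of_compact_support h

theorem exists_norm_conjFactor_le (hN : D.IsOuter N) : ∃ C : ℝ, 0 < C ∧ ∀ n : ℕ, 1 ≤ n →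
    ∀ z ∈ tsupport κ.χ, ‖D.conjFactor N n z‖ ≤ C / n := by
  have hK : IsCompact (tsupport κ.χ) := κ.compact
  obtain ⟨C1, h1, hC1⟩ := D.Γ.exists_norm_factor_le hK
    (fun z hz h => κ.off_conductors z hz (Or.inl h)) κ.signΓ
  obtain ⟨C2, h2, hC2⟩ := D.Δ.exists_norm_factor_le hK
    (fun z hz h => κ.off_conductors z hz (Or.inr h)) κ.signΔ
  obtain ⟨C3, hC3⟩ := hK.exists_bound_of_continuousOn (f := N) fun z hz =>
    (hN.differentiableAt (κ.off_conductors z hz)).continuousAt.continuousWithinAt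
  obtain ⟨C4, hC4⟩ := hK.exists_bound_of_continuousOn (f := fun z => (N z)⁻¹) fun z hz =>
    (hN.differentiableAt_inv (κ.off_conductors z hz)).continuousAt.continuousWithinAt
  have hc := half_pos D.c_pos
  refine ⟨|C3| * ((C1 + C2) * (D.c / 2)⁻¹) * |C4| + 1, by positivity, fun n hn z hz => ?_⟩
  have hn' : (0 : ℝ) < n := by exact_mod_cast hn
  have e := exp_neg_mul_le hc hn
  have hf : ‖D.factor n z‖ ≤ (C1 + C2) * ((D.c / 2)⁻¹ / n) := by
    refine (norm_add_le _ _).trans ?_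
    calc _ ≤ C1 * Real.exp (-(D.c / 2 * n)) + C2 * Real.exp (-(D.c / 2 * n)) :=
          add_le_add (hC1 2 n z hz) (hC2 1 n z hz)
      _ = (C1 + C2) * Real.exp (-(D.c / 2 * n)) := by ring
      _ ≤ _ := by gcongr
  calc ‖D.conjFactor N n z‖ ≤ ‖N z‖ * ‖D.factor n z‖ * ‖(N z)⁻¹‖ :=
        (norm_mul_le _ _).trans (by gcongr; exact norm_mul_le _ _)
    _ ≤ |C3| * ((C1 + C2) * ((D.c / 2)⁻¹ / n)) * |C4| := by
        gcongr
        · exact (hC3 z hz).trans (le_abs_self _)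
        · exact (hC4 z hz).trans (le_abs_self _)
    _ = |C3| * ((C1 + C2) * (D.c / 2)⁻¹) * |C4| / n := by ring
    _ ≤ _ := by gcongr; linarith

/-- The coefficient of the Wirtinger equation of the smoothed unknown. -/
noncomputable def coeff (N : ℂ → Mat3) (n : ℕ) (z : ℂ) : Mat3 :=
  ((κ.θ z : ℂ) * κ.dχ z) • D.conjFactor N n z

theorem contDiff_coeff (hN : D.IsOuter N) (n : ℕ) : ContDiff ℝ 1 (κ.coeff N n) := by
  have : CompleteSpace Mat3 := FiniteDimensional.complete ℂ Mat3
  rw [contDiff_iff_contDiffAt]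
  intro z
  by_cases hz : z ∈ D.contourS
  · have h0 : ∀ᶠ w in 𝓝 z, κ.coeff N n w = 0 := by
      by_cases hc : z ∈ D.conductors
      · have : z ∉ tsupport κ.χ := fun h => κ.off_conductors z h hc
        filter_upwards [(isClosed_tsupport κ.χ).isOpen_compl.mem_nhds this] with w hw
        rw [coeff, κ.dχ_eq_zero hw, mul_zero, zero_smul]
      · rcases κ.lips z hz hc with h | h
        · filter_upwards [eventually_eventually_nhds.2 h] with w hw
          rw [coeff, κ.dχ_eq_zero_of_eventually hw, mul_zero, zero_smul]
        · filter_upwards [h] with w hw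
          rw [coeff, hw, Complex.ofReal_zero, zero_mul, zero_smul]
    exact (contDiffAt_const (c := (0 : Mat3))).congr_of_eventuallyEq h0
  · have h1 : DifferentiableOn ℂ (D.conjFactor N n) D.contourSᶜ := fun w hw =>
      (Regime.differentiableAt_conjFactor hN n hw).differentiableWithinAt
    have h2 : ContDiffAt ℂ 1 (D.conjFactor N n) z :=
      (h1.contDiffOn D.isOpen_compl_contourS).contDiffAt (D.isOpen_compl_contourS.mem_nhds hz)
    have h3 : ContDiffAt ℝ 1 (fun z => (κ.θ z : ℂ) * κ.dχ z) z :=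
      ((Complex.ofRealCLM.contDiff.comp (κ.contDiff_θ.of_le one_le_two)).mul
        κ.contDiff_dχ).contDiffAt
    exact h3.smul (h2.restrict_scalars ℝ)

/-- The Wirtinger equation is solved close to the identity when `n` is large. -/
theorem exists_wirtinger_factor (hN : D.IsOuter N) : ∃ (C : ℝ) (n₀ : ℕ), 0 < C ∧ ∀ n : ℕ, n₀ ≤ n →
    ∃ V : ℂ → Mat3, Differentiable ℝ V ∧ (∀ z, dbar V z = -(κ.coeff N n z * V z)) ∧
      (∀ z, ‖V z - 1‖ ≤ C / n) ∧ Tendsto V (Bornology.cobounded ℂ) (𝓝 1) := by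
  have : CompleteSpace Mat3 := FiniteDimensional.complete ℂ Mat3
  obtain ⟨C1, h1, hC1⟩ := κ.exists_norm_conjFactor_le hN
  obtain ⟨C2, hC2⟩ := κ.exists_norm_dχ_le
  have hC2' : 0 ≤ C2 := (norm_nonneg _).trans (hC2 0)
  obtain ⟨R, hR⟩ := (show IsCompact (tsupport κ.χ) from κ.compact).isBounded.subset_closedBall 0
  set m := cauchyMass R with hm
  have hm0 : 0 < m := cauchyMass_pos R
  obtain ⟨n₀, hn₀⟩ := exists_nat_ge (4 * (m * (C2 * C1)))
  refine ⟨2 * (m * (C2 * C1)) * ‖(1 : Mat3)‖ + 1, n₀ + 1, by positivity, fun n hn => ?_⟩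
  have hn1 : 1 ≤ n := by omega
  have hn' : (0 : ℝ) < n := by exact_mod_cast hn1
  have hw : ∀ z, ‖κ.coeff N n z‖ ≤ C2 * C1 / n := by
    intro z
    by_cases hz : z ∈ tsupport κ.χ
    · rw [coeff, norm_smul, norm_mul, Complex.norm_real, Real.norm_eq_abs,
        abs_of_nonneg (κ.θ_mem z).1, mul_div_assoc]
      refine mul_le_mul ?_ (hC1 n hn1 z hz) (norm_nonneg _) hC2'
      calc _ ≤ 1 * C2 := mul_le_mul (κ.θ_mem z).2 (hC2 z) (norm_nonneg _) zero_le_one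
        _ = C2 := one_mul _
    · rw [coeff, κ.dχ_eq_zero hz, mul_zero, zero_smul, norm_zero]
      positivity
  obtain ⟨V, hV1, hV2, hV3, hV4⟩ := exists_wirtinger_solution (R := R) (κ.contDiff_coeff hN n) hw
    (fun z hz => by
      rw [coeff, κ.dχ_eq_zero, mul_zero, zero_smul]
      intro h
      have := hR h
      rw [mem_closedBall_zero_iff] at this
      linarith) (by
      rw [← mul_div_assoc, div_le_iff₀ hn']
      have : (n₀ : ℝ) + 1 ≤ n := by exact_mod_cast hn
      linarith)
  refine ⟨V, hV1, hV2, fun z => (hV3 z).trans ?_, hV4⟩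
  rw [← mul_div_assoc, ← mul_div_assoc, div_mul_eq_mul_div]
  gcongr
  linarith

end LensCutoff

end Smoothing

end TwoEdge

/-! ### The unknown outside the endpoint disks -/

namespace TwoEdge

theorem dbar_smul {F : Type*} [NormedAddCommGroup F] [NormedSpace ℂ F] {a : ℂ → ℂ} {g : ℂ → F}
    {z : ℂ} (ha : DifferentiableAt ℝ a z) (hg : DifferentiableAt ℝ g z) :
    dbar (fun w => a w • g w) z = dbar a z • g z + a z • dbar g z := by
  simp only [dbar]
  rw [fderiv_fun_smul ha hg]
  simp only [add_apply, smul_apply, ContinuousLinearMap.smulRight_apply, smul_eq_mul]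
  module

section Outside

attribute [local instance] Matrix.linftyOpNormedRing Matrix.linftyOpNormedAlgebra

namespace Regime

variable (D : Regime)

theorem eventually_cobounded_of_isBounded {s : Set ℂ} (hs : Bornology.IsBounded s) :
    ∀ᶠ z in Bornology.cobounded ℂ, z ∉ s := Bornology.isBounded_def.1 hs

theorem isBounded_contour {a b : ℂ} (L : Lens a b) : Bornology.IsBounded L.contour :=
  ((L.arc.isCompact_carrier.union L.lipUp.isCompact_carrier).union
    L.lipLo.isCompact_carrier).isBounded

theorem isBounded_contourS : Bornology.IsBounded D.contourS :=
  (isBounded_contour D.Γ).union (isBounded_contour D.Δ)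

/-- Outside a large disk there are neither arcs nor lenses. -/
theorem eventually_cobounded : ∀ᶠ z in Bornology.cobounded ℂ,
    z ∉ D.contourS ∧ z ∉ D.U0 ∪ D.U1 ∧ (∀ n, D.factor n z = 0) := by
  filter_upwards [eventually_cobounded_of_isBounded D.isBounded_contourS,
    eventually_cobounded_of_isBounded
      ((Metric.isBounded_ball (x := (0 : ℂ)) (r := D.r₀)).union
        (Metric.isBounded_ball (x := (D.x₀ : ℂ)) (r := D.r₁))),
    eventually_cobounded_of_isBounded D.Γ.isBounded_domUp,
    eventually_cobounded_of_isBounded D.Γ.isBounded_domLo,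
    eventually_cobounded_of_isBounded D.Δ.isBounded_domUp,
    eventually_cobounded_of_isBounded D.Δ.isBounded_domLo] with z h1 h2 h3 h4 h5 h6
  exact ⟨h1, h2, fun n => by
    rw [factor, D.Γ_factor_eq_zero h3 h4, D.Δ_factor_eq_zero h5 h6, add_zero]⟩

theorem tendsto_one_of_normalized {F : ℂ → Mat3} (h : NormalizedAtInfinity F) :
    Tendsto F (Bornology.cobounded ℂ) (𝓝 1) := by
  have h1 : ∀ i j, Tendsto (fun z => F z i j) (Bornology.cobounded ℂ) (𝓝 ((1 : Mat3) i j)) := by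
    intro i j
    have h2 : Tendsto (fun z => (F z - 1) i j) (Bornology.cobounded ℂ) (𝓝 0) :=
      (h i j).trans_tendsto tendsto_inv₀_cobounded
    have h3 := h2.add_const ((1 : Mat3) i j)
    simpa using h3
  exact tendsto_pi_nhds.2 fun i => tendsto_pi_nhds.2 fun j => h1 i j

end Regime

namespace LensCutoff

variable {D : Regime} (κ : LensCutoff D) {N T : ℂ → Mat3} {n : ℕ}

/-- The quotient `S N⁻¹` with the lens opening undone smoothly where `χ ≠ 0`. -/
noncomputable def smoothed (N : ℂ → Mat3) (n : ℕ) (T : ℂ → Mat3) (z : ℂ) : Mat3 :=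
  D.lensOpening n T z * (N z)⁻¹ * (1 + (κ.χ z : ℂ) • D.conjFactor N n z)

/-- Where `χ = 1` the lens is not opened. -/
theorem smoothed_of_χ_eq_one (hN : D.IsOuter N) {z : ℂ} (hz : z ∉ D.conductors)
    (h : κ.χ z = 1) : κ.smoothed N n T z = T z * (N z)⁻¹ := by
  have hu := hN.isUnit_det hz
  rw [smoothed, h, Complex.ofReal_one, one_smul, D.lensOpening_eq]
  calc T z * (1 - D.factor n z) * (N z)⁻¹ * (1 + N z * D.factor n z * (N z)⁻¹)
      = T z * (1 - D.factor n z) * ((N z)⁻¹ + ((N z)⁻¹ * N z) * D.factor n z * (N z)⁻¹) := by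
        noncomm_ring
    _ = T z * (1 - D.factor n z * D.factor n z) * (N z)⁻¹ := by
        rw [Matrix.nonsing_inv_mul _ hu]; noncomm_ring
    _ = _ := by rw [D.factor_mul_self, sub_zero, mul_one]

theorem smoothed_dbar (hN : D.IsOuter N) (hT : D.IsT n T) {z : ℂ} (hz : z ∉ D.conductors)
    (hθ : ∀ᶠ w in 𝓝 z, κ.θ w = 1) : DifferentiableAt ℝ (κ.smoothed N n T) z ∧
      dbar (κ.smoothed N n T) z = κ.smoothed N n T z * κ.coeff N n z := by
  by_cases hc : z ∈ D.contourS
  · have hχ : ∀ᶠ w in 𝓝 z, κ.χ w = 1 := by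
      refine (κ.lips z hc hz).resolve_right fun h => ?_
      have := hθ.self_of_nhds
      rw [h.self_of_nhds] at this
      exact zero_ne_one this
    have h1 : DifferentiableAt ℂ (fun w => T w * (N w)⁻¹) z :=
      (hT.analytic.differentiableAt D.isClosed_conductors.isOpen_compl hz).mul
        (hN.differentiableAt_inv hz)
    have h2 : DifferentiableAt ℂ (κ.smoothed N n T) z := by
      refine h1.congr_of_eventuallyEq ?_
      filter_upwards [hχ, D.isClosed_conductors.isOpen_compl.mem_nhds hz] with w hw hwc
      exact κ.smoothed_of_χ_eq_one hN hwc hw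
    refine ⟨h2.restrictScalars ℝ, ?_⟩
    rw [dbar_eq_zero h2, coeff, κ.dχ_eq_zero_of_eventually hχ, mul_zero, zero_smul, mul_zero]
  · have h1 : DifferentiableAt ℂ (fun w => D.lensOpening n T w * (N w)⁻¹) z :=
      (D.differentiableAt_lensOpening hT hc).mul (hN.differentiableAt_inv hz)
    have h2 := Regime.differentiableAt_conjFactor hN n hc
    have h3 : DifferentiableAt ℝ (fun w => (κ.χ w : ℂ)) z :=
      κ.contDiff_ofReal_χ.differentiable two_ne_zero z
    have h4 : DifferentiableAt ℝ (fun w => (κ.χ w : ℂ) • D.conjFactor N n w) z :=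
      h3.smul (h2.restrictScalars ℝ)
    have h5 : DifferentiableAt ℝ (fun w => 1 + (κ.χ w : ℂ) • D.conjFactor N n w) z :=
      (differentiableAt_const _).add h4
    have hd : dbar (fun w => 1 + (κ.χ w : ℂ) • D.conjFactor N n w) z
        = κ.dχ z • D.conjFactor N n z := by
      have e1 : dbar (fun w => 1 + (κ.χ w : ℂ) • D.conjFactor N n w) z
          = dbar (fun w => (κ.χ w : ℂ) • D.conjFactor N n w) z := by
        rw [dbar, dbar, fderiv_const_add]
      rw [e1, dbar_smul h3 (h2.restrictScalars ℝ), dbar_eq_zero h2, smul_zero, add_zero, dχ]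
    have e : κ.smoothed N n T = fun w => (D.lensOpening n T w * (N w)⁻¹) *
        (1 + (κ.χ w : ℂ) • D.conjFactor N n w) := rfl
    rw [e]
    refine ⟨(h1.restrictScalars ℝ).mul h5, ?_⟩
    rw [dbar_mul (h1.restrictScalars ℝ) h5, dbar_eq_zero h1, zero_mul, add_zero, hd, coeff,
      hθ.self_of_nhds, Complex.ofReal_one, one_mul]
    -- the square of the nilpotent factor drops out
    have hQ := Regime.conjFactor_mul_self hN n hz
    rw [mul_assoc (D.lensOpening n T z * (N z)⁻¹), add_mul, one_mul, smul_mul_smul_comm, hQ, smul_zero, add_zero]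

end LensCutoff

namespace Regime

variable {D : Regime} {N : ℂ → Mat3}

/-- Outside the endpoint disks the smoothed unknown, corrected by the solution of the Wirtinger
equation, is analytic across the contour and close to `S N⁻¹`. -/
theorem exists_outer_extension (hN : D.IsOuter N) : ∃ (C : ℝ) (n₀ : ℕ), 0 < C ∧ 1 ≤ n₀ ∧
    ∀ n : ℕ, n₀ ≤ n → ∀ T : ℂ → Mat3, D.IsT n T →
    ∃ B q V : ℂ → Mat3, ContinuousOn B (D.U0 ∪ D.U1)ᶜ ∧
      DifferentiableOn ℂ B (Metric.closedBall 0 D.r₀ ∪ Metric.closedBall (D.x₀ : ℂ) D.r₁)ᶜ ∧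
      Tendsto B (Bornology.cobounded ℂ) (𝓝 1) ∧
      (∀ z, z ∉ D.U0 ∪ D.U1 → z ∉ D.contourS →
        B z = D.lensOpening n T z * (N z)⁻¹ * (1 + q z) * V z) ∧
      (∀ z, ‖q z‖ ≤ C / n) ∧ (∀ z, ‖V z - 1‖ ≤ C / n) ∧
      ∀ z, D.factor n z = 0 → q z = 0 := by
  obtain ⟨κ⟩ := D.nonempty_lensCutoff
  obtain ⟨C1, hC1, hq⟩ := κ.exists_norm_conjFactor_le hN
  obtain ⟨C2, n₀, hC2, hV⟩ := κ.exists_wirtinger_factor hN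
  refine ⟨C1 + C2, n₀ + 1, by positivity, by omega, fun n hn T hT => ?_⟩
  have hn1 : 1 ≤ n := by omega
  have hn' : (0 : ℝ) < n := by exact_mod_cast hn1
  obtain ⟨V, hVd, hVe, hVb, hVt⟩ := hV n (by omega)
  set f : ℂ → Mat3 := fun z => κ.smoothed N n T z * V z with hf
  have hfe : ∀ z, f z = D.lensOpening n T z * (N z)⁻¹ *
      (1 + (κ.χ z : ℂ) • D.conjFactor N n z) * V z := fun z => rfl
  set B := extendFrom D.conductorsᶜ f with hB
  have hcl : ∀ z : ℂ, z ∈ closure D.conductorsᶜ := fun z => D.dense_compl_conductors z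
  have hfd : ∀ z, z ∉ D.U0 ∪ D.U1 → z ∉ D.conductors → DifferentiableAt ℂ f z := by
    intro z hz hzc
    obtain ⟨h1, h2⟩ := κ.smoothed_dbar hN hT hzc (κ.θ_one z hz)
    refine differentiableAt_complex_of_dbar_eq_zero (h1.mul (hVd z)) ?_
    rw [dbar_mul h1 (hVd z), h2, hVe, mul_neg, mul_assoc, neg_add_cancel]
  have hlim : ∀ z, z ∉ D.U0 ∪ D.U1 → z ∉ D.conductors →
      Tendsto f (𝓝[D.conductorsᶜ] z) (𝓝 (f z)) := fun z hz hzc =>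
    (hfd z hz hzc).continuousAt.tendsto.mono_left nhdsWithin_le_nhds
  have hBf : ∀ z, z ∉ D.U0 ∪ D.U1 → z ∉ D.conductors → B z = f z := fun z hz hzc =>
    extendFrom_eq (hcl z) (hlim z hz hzc)
  have hBc : ContinuousOn B (D.U0 ∪ D.U1)ᶜ := by
    refine continuousOn_extendFrom (fun z _ => hcl z) fun z hz => ?_
    by_cases hzc : z ∈ D.conductors
    · obtain ⟨A, hA⟩ := D.tendsto_lensOpening_mul_outer_inv hT hN hzc
        (fun h => hz (h ▸ D.edges_mem_disks.1)) (fun h => hz (h ▸ D.edges_mem_disks.2))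
      refine ⟨A * V z, (hA.mul ((hVd z).continuousAt.tendsto.mono_left
        nhdsWithin_le_nhds)).congr' ?_⟩
      have h1 := κ.eventually_χ_eq_zero fun h => κ.off_conductors z h hzc
      filter_upwards [nhdsWithin_le_nhds h1] with w hw
      rw [hfe, hw, Complex.ofReal_zero, zero_smul, add_zero, mul_one]
    · exact ⟨_, hlim z hz hzc⟩
  have hsub : (Metric.closedBall 0 D.r₀ ∪ Metric.closedBall (D.x₀ : ℂ) D.r₁)ᶜ ⊆
      (D.U0 ∪ D.U1)ᶜ := compl_subset_compl.2
    (union_subset_union Metric.ball_subset_closedBall Metric.ball_subset_closedBall)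
  have hop : IsOpen (Metric.closedBall 0 D.r₀ ∪ Metric.closedBall (D.x₀ : ℂ) D.r₁)ᶜ :=
    (Metric.isClosed_closedBall.union Metric.isClosed_closedBall).isOpen_compl
  have hBd : DifferentiableOn ℂ B
      (Metric.closedBall 0 D.r₀ ∪ Metric.closedBall (D.x₀ : ℂ) D.r₁)ᶜ := by
    refine D.differentiableOn_of_contourS hop (hBc.mono hsub) fun z hz => ?_
    have hzc : z ∉ D.conductors := fun h => hz.2 (D.conductors_subset_contourS h)
    refine ((hfd z (hsub hz.1) hzc).congr_of_eventuallyEq ?_).differentiableWithinAt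
    filter_upwards [hop.mem_nhds hz.1, D.isClosed_conductors.isOpen_compl.mem_nhds hzc] with w h1 h2
    exact hBf w (hsub h1) h2
  refine ⟨B, fun z => (κ.χ z : ℂ) • D.conjFactor N n z, V, hBc, hBd, ?_, ?_, ?_, ?_, ?_⟩
  · have h1 : Tendsto (fun z => T z * (N z)⁻¹ * V z) (Bornology.cobounded ℂ) (𝓝 (1 * 1⁻¹ * 1)) :=
      ((tendsto_one_of_normalized hT.infinity).mul (tendsto_matrix_inv
        (tendsto_one_of_normalized hN.infinity) isUnit_one)).mul hVt
    rw [inv_one, mul_one, mul_one] at h1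
    refine h1.congr' ?_
    filter_upwards [D.eventually_cobounded] with z ⟨h2, h3, h4⟩
    rw [hBf z h3 fun h => h2 (D.conductors_subset_contourS h), hfe, D.lensOpening_eq,
      conjFactor, h4, mul_zero, zero_mul, smul_zero, sub_zero, add_zero, mul_one, mul_one]
  · intro z hz hzc
    rw [hBf z hz fun h => hzc (D.conductors_subset_contourS h), hfe]
  · intro z
    by_cases hz : z ∈ tsupport κ.χ
    · calc ‖(κ.χ z : ℂ) • D.conjFactor N n z‖ ≤ 1 * (C1 / n) := by
            rw [norm_smul, Complex.norm_real, Real.norm_eq_abs, abs_of_nonneg (κ.χ_mem z).1]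
            exact mul_le_mul (κ.χ_mem z).2 (hq n hn1 z hz) (norm_nonneg _) zero_le_one
        _ ≤ _ := by rw [one_mul]; gcongr; linarith
    · beta_reduce
      rw [(κ.eventually_χ_eq_zero hz).self_of_nhds, Complex.ofReal_zero, zero_smul, norm_zero]
      positivity
  · exact fun z => (hVb z).trans (by gcongr; linarith)
  · intro z hz
    simp only [conjFactor, hz, mul_zero, zero_mul, smul_zero]

end Regime

end Outside

end TwoEdge

/-! ### Expansion at infinity -/

/-- The first Laurent coefficient at infinity of a function close to its limit is small, and so is
the remainder: this is the Schwarz lemma, applied twice in the variable `1 / z`. -/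
theorem exists_laurent_coefficient {E : Type*} [NormedAddCommGroup E] [NormedSpace ℂ E]
    [CompleteSpace E] {F : ℂ → E} {a : E} {r δ : ℝ} (hr : 0 < r)
    (hF : DifferentiableOn ℂ F {z | r < ‖z‖}) (hb : ∀ z, r < ‖z‖ → ‖F z - a‖ ≤ δ)
    (ha : Tendsto F (Bornology.cobounded ℂ) (𝓝 a)) :
    ∃ R₁ : E, ‖R₁‖ ≤ r * δ ∧ ∀ z, r < ‖z‖ → ‖F z - a - z⁻¹ • R₁‖ ≤ 2 * r ^ 2 * δ / ‖z‖ ^ 2 := by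
  set g : ℂ → E := Function.update (fun w => F w⁻¹ - a) 0 0 with hg
  have hδ : 0 ≤ δ := (norm_nonneg _).trans (hb ((r + 1 : ℝ) : ℂ) (by
    rw [Complex.norm_real, Real.norm_eq_abs, abs_of_pos (by linarith)]; linarith))
  have hg0 : g 0 = 0 := Function.update_self _ _ _
  have hgw : ∀ w, w ≠ 0 → g w = F w⁻¹ - a := fun w hw => Function.update_of_ne hw _ _
  have hinv : ∀ w ∈ Metric.ball (0 : ℂ) r⁻¹, w ≠ 0 → r < ‖w⁻¹‖ := fun w hw h0 => by
    rw [norm_inv, lt_inv_comm₀ hr (norm_pos_iff.2 h0)]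
    exact mem_ball_zero_iff.1 hw
  have hgd : DifferentiableOn ℂ g (Metric.ball 0 r⁻¹) := by
    refine (Complex.differentiableOn_compl_singleton_and_continuousAt_iff
      (Metric.ball_mem_nhds 0 (inv_pos.2 hr))).1 ⟨?_, ?_⟩
    · have h1 : DifferentiableOn ℂ (fun w => F w⁻¹ - a) (Metric.ball 0 r⁻¹ \ {0}) :=
        (hF.comp (fun w hw => (differentiableAt_inv hw.2).differentiableWithinAt)
          fun w hw => hinv w hw.1 hw.2).sub_const a
      exact h1.congr fun w hw => hgw w hw.2
    · rw [hg, continuousAt_update_same]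
      have h1 : Tendsto (fun w : ℂ => F w⁻¹) (𝓝[≠] 0) (𝓝 a) :=
        ha.comp tendsto_inv₀_nhdsNE_zero
      simpa using h1.sub_const a
  have hmaps : MapsTo g (Metric.ball 0 r⁻¹) (Metric.closedBall (g 0) δ) := fun w hw => by
    rw [hg0, mem_closedBall_zero_iff]
    by_cases h : w = 0
    · rw [h, hg0, norm_zero]; exact hδ
    · rw [hgw w h]; exact hb _ (hinv w hw h)
  set h := dslope g 0 with hh
  have hhd : DifferentiableOn ℂ h (Metric.ball 0 r⁻¹) :=
    (Complex.differentiableOn_dslope (Metric.ball_mem_nhds 0 (inv_pos.2 hr))).2 hgd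
  have hhb : ∀ w ∈ Metric.ball (0 : ℂ) r⁻¹, ‖h w‖ ≤ r * δ := fun w hw =>
    (Complex.norm_dslope_le_div_of_mapsTo_ball hgd hmaps hw).trans_eq (by
      rw [div_inv_eq_mul, mul_comm])
  have h0 : (0 : ℂ) ∈ Metric.ball (0 : ℂ) r⁻¹ := Metric.mem_ball_self (inv_pos.2 hr)
  have hmaps2 : MapsTo h (Metric.ball 0 r⁻¹) (Metric.closedBall (h 0) (2 * (r * δ))) :=
    fun w hw => by
      rw [mem_closedBall_iff_norm]
      linarith [norm_sub_le (h w) (h 0), hhb w hw, hhb 0 h0]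
  refine ⟨h 0, hhb 0 h0, fun z hz => ?_⟩
  have hz0 : z ≠ 0 := norm_pos_iff.1 (hr.trans hz)
  have hw : z⁻¹ ∈ Metric.ball (0 : ℂ) r⁻¹ := by
    rw [mem_ball_zero_iff, norm_inv]
    exact inv_strictAnti₀ hr hz
  have e1 : F z - a = z⁻¹ • h z⁻¹ := by
    have := sub_smul_dslope g 0 z⁻¹
    rw [sub_zero, hg0, sub_zero, hgw _ (inv_ne_zero hz0), inv_inv] at this
    exact this.symm
  have e2 := sub_smul_dslope h 0 z⁻¹
  rw [sub_zero] at e2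
  rw [e1, ← smul_sub, ← e2, norm_smul, norm_smul, norm_inv]
  have e3 := Complex.norm_dslope_le_div_of_mapsTo_ball hhd hmaps2 hw
  calc ‖z‖⁻¹ * (‖z‖⁻¹ * ‖dslope h 0 z⁻¹‖) ≤ ‖z‖⁻¹ * (‖z‖⁻¹ * (2 * (r * δ) / r⁻¹)) := by gcongr
    _ = _ := by rw [div_inv_eq_mul]; ring

namespace TwoEdge

/-- A circle without finitely many points is dense in the circle. -/
theorem sphere_subset_closure_sdiff {c : ℂ} {r : ℝ} (hr : 0 < r) {s : Set ℂ}
    (hs : (Metric.sphere c r ∩ s).Finite) :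
    Metric.sphere c r ⊆ closure (Metric.sphere c r \ s) := by
  have hnt : (Metric.sphere c r).Nontrivial := by
    refine ⟨c + r, by simp [abs_of_pos hr], c - r, by simp [abs_of_pos hr], fun h => ?_⟩
    have h1 : (r : ℂ) = 0 := by linear_combination h / 2
    exact hr.ne' (by exact_mod_cast h1)
  have hpre := (isPreconnected_sphere (by rw [Complex.rank_real_complex]; norm_num)
    c r).preperfect_of_nontrivial hnt
  intro z hz
  rw [mem_closure_iff_frequently]
  have h1 := accPt_iff_frequently.1 (hpre z hz)
  have h2 : ∀ᶠ w in 𝓝 z, w ∉ (Metric.sphere c r ∩ s) \ {z} :=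
    (hs.subset sdiff_subset).isClosed.isOpen_compl.mem_nhds fun h => h.2 rfl
  refine (h1.and_eventually h2).mono fun w hw => ⟨hw.1.2, fun h => hw.2 ⟨⟨hw.1.2, h⟩, hw.1.1⟩⟩

theorem norm_mul_mul_sub_one_le {𝔸 : Type*} [NormedRing 𝔸] {a b c : 𝔸} {δ : ℝ} (h1 : δ ≤ 1)
    (ha : ‖a - 1‖ ≤ δ) (hb : ‖b‖ ≤ δ) (hc : ‖c - 1‖ ≤ δ) :
    ‖a * (1 + b) * c - 1‖ ≤ 7 * δ := by
  have h0 : 0 ≤ δ := (norm_nonneg _).trans hb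
  have m2 : ∀ {x y : 𝔸}, ‖x‖ ≤ δ → ‖y‖ ≤ δ → ‖x * y‖ ≤ δ := fun hx hy =>
    (norm_mul_le _ _).trans ((mul_le_mul hx hy (norm_nonneg _) h0).trans
      (mul_le_of_le_one_right h0 h1))
  set x := a - 1
  set y := c - 1
  have e : a * (1 + b) * c - 1 = x + b + y + x * b + x * y + b * y + x * b * y := by
    simp only [x, y]; noncomm_ring
  rw [e]
  have k1 := norm_add_le (x + b + y + x * b + x * y + b * y) (x * b * y)
  have k2 := norm_add_le (x + b + y + x * b + x * y) (b * y)
  have k3 := norm_add_le (x + b + y + x * b) (x * y)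
  have k4 := norm_add_le (x + b + y) (x * b)
  have k5 := norm_add_le (x + b) y
  have k6 := norm_add_le x b
  linarith [m2 (m2 ha hb) hc, m2 hb hc, m2 ha hc, m2 ha hb]

section Conclusion

attribute [local instance] Matrix.linftyOpNormedRing Matrix.linftyOpNormedAlgebra

namespace Regime

variable {D : Regime} {N : ℂ → Mat3}

theorem finite_sphere_inter_contourS {e : ℂ} {r : ℝ}
    (h : ∀ γ ∈ [D.Γ.arc, D.Γ.lipUp, D.Γ.lipLo, D.Δ.arc, D.Δ.lipUp, D.Δ.lipLo],
      γ.CrossesOnce e r) : (Metric.sphere e r ∩ D.contourS).Finite := by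
  have key : ∀ γ : Arc, γ.CrossesOnce e r → (Metric.sphere e r ∩ γ.carrier).Finite := by
    rintro γ ⟨⟨t, -, ht⟩, -⟩
    refine (finite_singleton (γ.toFun t)).subset ?_
    rintro z ⟨hz, s, hs, rfl⟩
    rw [ht s ⟨hs, by rw [← dist_eq_norm]; exact hz⟩]
    exact mem_singleton _
  simp only [List.mem_cons, List.not_mem_nil, or_false, forall_eq_or_imp, forall_eq] at h
  obtain ⟨h1, h2, h3, h4, h5, h6⟩ := h
  rw [contourS, Lens.contour, Lens.contour, inter_union_distrib_left, inter_union_distrib_left,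
    inter_union_distrib_left, inter_union_distrib_left, inter_union_distrib_left]
  exact (((key _ h1).union (key _ h2)).union (key _ h3)).union
    (((key _ h4).union (key _ h5)).union (key _ h6))

/-- On the boundary of an endpoint disk the inner and the outer function are close to each other,
by the matching of the parametrices. -/
theorem jump_le {n : ℕ} {T P A B q V : ℂ → Mat3} {M r δ : ℝ} {e : ℂ}
    (hr : 0 < r) (hP : D.IsLocal N n T M e r P)
    (hfin : (Metric.sphere e r ∩ D.contourS).Finite)
    (hE : Metric.sphere e r ⊆ (D.U0 ∪ D.U1)ᶜ)
    (hA : ContinuousOn A (Metric.closedBall e r))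
    (hAe : ∀ z ∈ Metric.closedBall e r \ D.contourS, A z = D.lensOpening n T z * (P z)⁻¹)
    (hB : ContinuousOn B (D.U0 ∪ D.U1)ᶜ)
    (hBe : ∀ z, z ∉ D.U0 ∪ D.U1 → z ∉ D.contourS →
      B z = D.lensOpening n T z * (N z)⁻¹ * (1 + q z) * V z)
    (hδ : δ ≤ 1) (hM : 9 * (M / n) ≤ δ) (hq : ∀ z, ‖q z‖ ≤ δ) (hV : ∀ z, ‖V z - 1‖ ≤ δ)
    {z : ℂ} (hz : z ∈ Metric.sphere e r) : ‖A z - B z‖ ≤ 7 * δ * ‖A z‖ := by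
  have hcA : ContinuousWithinAt A (Metric.sphere e r \ D.contourS) z :=
    (hA z (Metric.sphere_subset_closedBall hz)).mono
      (sdiff_subset.trans Metric.sphere_subset_closedBall)
  have hcB : ContinuousWithinAt B (Metric.sphere e r \ D.contourS) z :=
    (hB z (hE hz)).mono (sdiff_subset.trans hE)
  -- by continuity it is enough to compare off the contour, which meets the circle in finitely many
  -- points
  refine (hcA.sub hcB).norm.closure_le (sphere_subset_closure_sdiff hr hfin hz)
    (hcA.norm.const_mul (7 * δ)) fun w hw => ?_
  have hwc : w ∈ Metric.closedBall e r \ D.contourS :=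
    ⟨Metric.sphere_subset_closedBall hw.1, hw.2⟩
  have hPu : IsUnit (P w).det := (Matrix.isUnit_iff_isUnit_det _).1 (hP.invertible w hwc)
  have e1 : A w - B w = -(A w * (P w * (N w)⁻¹ * (1 + q w) * V w - 1)) := by
    have e2 : A w * P w = D.lensOpening n T w := by
      rw [hAe w hwc, mul_assoc, Matrix.nonsing_inv_mul _ hPu, mul_one]
    rw [hBe w (hE hw.1) hw.2, mul_sub, mul_one, neg_sub, ← e2]
    simp only [mul_assoc]
  have hm : ‖P w * (N w)⁻¹ - 1‖ ≤ δ :=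
    (norm_le_of_entries_le (hP.matching w hw)).trans hM
  rw [Pi.sub_apply, e1, norm_neg]
  refine (norm_mul_le _ _).trans ?_
  rw [mul_comm]
  gcongr
  exact norm_mul_mul_sub_one_le hδ hm (hq w) (hV w)

theorem dist_edges : dist (0 : ℂ) (D.x₀ : ℂ) = D.x₀ := by
  rw [dist_zero_left, Complex.norm_real, Real.norm_eq_abs, abs_of_pos D.x₀_pos]

theorem sphere_subset_outside : Metric.sphere (0 : ℂ) D.r₀ ⊆ (D.U0 ∪ D.U1)ᶜ ∧
    Metric.sphere (D.x₀ : ℂ) D.r₁ ⊆ (D.U0 ∪ D.U1)ᶜ := by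
  have hd := D.dist_edges
  have h := D.disks_disjoint
  constructor <;> rintro z hz (h1 | h1)
  · exact (Metric.mem_ball.1 h1).ne hz
  · have h2 := dist_triangle_left (0 : ℂ) (D.x₀ : ℂ) z
    rw [Metric.mem_sphere.1 hz] at h2
    linarith [Metric.mem_ball.1 h1]
  · have h2 := dist_triangle_left (0 : ℂ) (D.x₀ : ℂ) z
    rw [Metric.mem_sphere.1 hz] at h2
    linarith [Metric.mem_ball.1 h1]
  · exact (Metric.mem_ball.1 h1).ne hz

/-- The error matrix is close to the identity away from the endpoint disks. -/
theorem exists_norm_error_sub_one_le (hN : D.IsOuter N) (M : ℝ) :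
    ∃ (C ρ : ℝ) (n₀ : ℕ), 0 < C ∧ 0 < ρ ∧ 1 ≤ n₀ ∧ (∀ z, ρ < ‖z‖ → z ∉ D.conductors) ∧
      ∀ n : ℕ, n₀ ≤ n → ∀ T P0 P1 : ℂ → Mat3, D.IsT n T →
        D.IsLocal N n T M 0 D.r₀ P0 → D.IsLocal N n T M (D.x₀ : ℂ) D.r₁ P1 →
        ∀ z, ρ < ‖z‖ → D.errorMatrix n T N P0 P1 z = T z * (N z)⁻¹ ∧
          ‖T z * (N z)⁻¹ - 1‖ ≤ C / n := by
  obtain ⟨C1, n₁, hC1, hn₁, hout⟩ := exists_outer_extension hN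
  have hdist : D.r₀ + D.r₁ < dist (0 : ℂ) (D.x₀ : ℂ) := D.dist_edges.symm ▸ D.disks_disjoint
  obtain ⟨C2, ε₀, hC2, hε₀, hhardy⟩ := exists_norm_sub_le_of_small_jumps D.r₀_pos D.r₁_pos hdist
    (fun p : Fin 3 × Fin 3 => (1 : Mat3) p.1 p.2)
  obtain ⟨r, -, hr⟩ := hasBasis_cobounded_norm.eventually_iff.1 D.eventually_cobounded
  have hr₀ := D.r₀_pos
  have hr₁ := D.r₁_pos
  have hx₀ := D.x₀_pos
  set K : ℝ := C1 + 9 * |M| with hK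
  have hK0 : 0 < K := by positivity
  obtain ⟨n₂, hn₂⟩ := exists_nat_ge (max (2 * K) (7 * K / ε₀))
  refine ⟨2 * (9 * (C2 * (7 * K)) + K), max r (D.x₀ + D.r₀ + D.r₁ + 1), max n₁ n₂, by positivity,
    lt_max_of_lt_right (by positivity), hn₁.trans (le_max_left _ _), fun z hz => ?_, ?_⟩
  · exact fun h => (hr ((le_max_left _ _).trans hz.le)).1 (D.conductors_subset_contourS h)
  intro n hn T P0 P1 hT hP0 hP1 z hz
  have hn1 : n₁ ≤ n := (le_max_left _ _).trans hn
  have hn' : (0 : ℝ) < n := by exact_mod_cast (show 1 ≤ n from hn₁.trans hn1)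
  have hn2 : (n₂ : ℝ) ≤ n := by exact_mod_cast (le_max_right _ _).trans hn
  obtain ⟨B, q, V, hBc, hBd, hBt, hBe, hq, hV, hq0⟩ := hout n hn1 T hT
  set δ : ℝ := K / n with hδ
  have hδ0 : 0 < δ := by positivity
  have hδ2 : 2 * δ ≤ 1 := by
    rw [hδ, ← mul_div_assoc, div_le_one hn']
    exact (le_max_left _ _).trans (hn₂.trans hn2)
  have hδε : 7 * δ ≤ ε₀ := by
    rw [hδ, ← mul_div_assoc, div_le_iff₀ hn', ← div_le_iff₀' hε₀]
    exact (le_max_right _ _).trans (hn₂.trans hn2)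
  have hC1δ : C1 / n ≤ δ := by rw [hδ]; gcongr; rw [hK]; linarith [abs_nonneg M]
  have hMδ : 9 * (M / n) ≤ δ := by
    rw [hδ, ← mul_div_assoc]
    gcongr
    rw [hK]
    linarith [le_abs_self M]
  have hqδ : ∀ z, ‖q z‖ ≤ δ := fun z => (hq z).trans hC1δ
  have hVδ : ∀ z, ‖V z - 1‖ ≤ δ := fun z => (hV z).trans hC1δ
  obtain ⟨hm0, hm1⟩ := D.Γ.arc.joins_mem_carrier D.Γ.arc_joins
  have hsub : D.Γ.arc.carrier ⊆ D.contourS := fun w h => Or.inl (Or.inl (Or.inl h))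
  obtain ⟨A0, hA0c, hA0d, hA0e⟩ := D.exists_inner_extension hr₀ hT hP0 (fun w hw h0 => ⟨h0, by
    rintro rfl
    rw [Metric.mem_closedBall, dist_comm, D.dist_edges] at hw
    linarith [D.disks_disjoint]⟩) (hsub hm0)
  obtain ⟨A1, hA1c, hA1d, hA1e⟩ := D.exists_inner_extension hr₁ hT hP1 (fun w hw h0 => ⟨by
    rintro rfl
    rw [Metric.mem_closedBall, D.dist_edges] at hw
    linarith [D.disks_disjoint], h0⟩) (hsub hm1)
  obtain ⟨hs0, hs1⟩ := D.sphere_subset_outside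
  have j0 : ∀ w ∈ Metric.sphere (0 : ℂ) D.r₀, ‖A0 w - B w‖ ≤ 7 * δ * ‖A0 w‖ := fun w hw =>
    jump_le hr₀ hP0 (finite_sphere_inter_contourS fun γ hγ => (D.crosses_disks γ hγ).1) hs0
      hA0c hA0e hBc hBe (by linarith) hMδ hqδ hVδ hw
  have j1 : ∀ w ∈ Metric.sphere (D.x₀ : ℂ) D.r₁, ‖A1 w - B w‖ ≤ 7 * δ * ‖A1 w‖ := fun w hw =>
    jump_le hr₁ hP1 (finite_sphere_inter_contourS fun γ hγ => (D.crosses_disks γ hγ).2) hs1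
      hA1c hA1e hBc hBe (by linarith) hMδ hqδ hVδ hw
  have entry : ∀ {X Y : Mat3}, ‖X - Y‖ ≤ 7 * δ * ‖X‖ → ∀ p : Fin 3 × Fin 3,
      ‖X p.1 p.2 - Y p.1 p.2‖ ≤ 7 * δ * ∑ k : Fin 3 × Fin 3, ‖X k.1 k.2‖ := fun h p =>
    (norm_entry_le (_ - _) p.1 p.2).trans (h.trans
      (mul_le_mul_of_nonneg_left (norm_le_sum_entries _) (by positivity)))
  have dcc : ∀ {A : ℂ → Mat3} {e : ℂ} {r : ℝ}, 0 < r → ContinuousOn A (Metric.closedBall e r) →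
      DifferentiableOn ℂ A (Metric.ball e r) → ∀ p : Fin 3 × Fin 3,
      DiffContOnCl ℂ (fun w => A w p.1 p.2) (Metric.ball e r) := by
    intro A e r hr hc hd p
    refine ⟨fun w hw => (differentiableAt_entry (hd.differentiableAt
      (Metric.isOpen_ball.mem_nhds hw)) p.1 p.2).differentiableWithinAt, ?_⟩
    rw [closure_ball e hr.ne']
    exact continuousOn_pi.1 (continuousOn_pi.1 hc p.1) p.2
  obtain ⟨hzc, hzU, hzf⟩ := hr ((le_max_left _ _).trans hz.le)
  have hzρ := (le_max_right _ _).trans_lt hz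
  have hB1 : ‖B z - 1‖ ≤ 9 * (C2 * (7 * δ)) := by
    refine norm_le_of_entries_le fun i j => ?_
    refine hhardy (fun p w => A0 w p.1 p.2) (fun p w => A1 w p.1 p.2) (fun p w => B w p.1 p.2)
      (7 * δ) (by positivity) hδε (dcc hr₀ hA0c hA0d) (dcc hr₁ hA1c hA1d)
      (fun p => continuousOn_pi.1 (continuousOn_pi.1 hBc p.1) p.2)
      (fun p w hw => (differentiableAt_entry (hBd.differentiableAt
        ((Metric.isClosed_closedBall.union Metric.isClosed_closedBall).isOpen_compl.mem_nhds hw))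
          p.1 p.2).differentiableWithinAt)
      (fun p => tendsto_pi_nhds.1 (tendsto_pi_nhds.1 hBt p.1) p.2)
      (fun w hw => entry (j0 w hw)) (fun w hw => entry (j1 w hw)) z ?_ ?_ (i, j)
    · rw [dist_zero_right]; linarith
    · have h1 := dist_triangle z (D.x₀ : ℂ) 0
      rw [dist_zero_right, dist_comm _ (0 : ℂ), D.dist_edges] at h1
      linarith
  have hS : D.lensOpening n T z = T z := by rw [D.lensOpening_eq, hzf, sub_zero, mul_one]
  refine ⟨?_, ?_⟩
  · have hU0 : z ∉ D.U0 := fun h => hzU (Or.inl h)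
    have hU1 : z ∉ D.U1 := fun h => hzU (Or.inr h)
    rw [errorMatrix, globalParametrix, if_neg hU0, if_neg hU1, hS]
  · have hRV : B z = T z * (N z)⁻¹ * V z := by
      rw [hBe z hzU hzc, hS, hq0 z (hzf n), add_zero, mul_one]
    set R := T z * (N z)⁻¹
    have e : R - 1 = (B z - 1) - (V z - 1) - (R - 1) * (V z - 1) := by
      rw [hRV]; noncomm_ring
    have k1 : ‖R - 1‖ ≤ ‖B z - 1‖ + ‖V z - 1‖ + ‖R - 1‖ * ‖V z - 1‖ := by
      calc ‖R - 1‖ = ‖(B z - 1) - (V z - 1) - (R - 1) * (V z - 1)‖ := by rw [← e]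
        _ ≤ _ := (norm_sub_le _ _).trans (add_le_add (norm_sub_le _ _) (norm_mul_le _ _))
    have k2 : ‖R - 1‖ * ‖V z - 1‖ ≤ ‖R - 1‖ * (1 / 2) :=
      mul_le_mul_of_nonneg_left ((hVδ z).trans (by linarith)) (norm_nonneg _)
    have k3 : 2 * (9 * (C2 * (7 * K)) + K) / n = 2 * (9 * (C2 * (7 * δ)) + δ) := by
      rw [hδ]; ring
    rw [k3]
    linarith [hVδ z]

/-- The error matrix has an expansion at infinity with a small first coefficient. -/
theorem exists_expansion (hN : D.IsOuter N) (M : ℝ) :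
    ∃ (C ρ : ℝ) (n₀ : ℕ), 0 < C ∧ 0 < ρ ∧ 1 ≤ n₀ ∧
      ∀ n : ℕ, n₀ ≤ n → ∀ T P0 P1 : ℂ → Mat3, D.IsT n T →
        D.IsLocal N n T M 0 D.r₀ P0 → D.IsLocal N n T M (D.x₀ : ℂ) D.r₁ P1 →
        ∃ R₁ : Mat3, ‖R₁‖ ≤ C / n ∧ ∀ z : ℂ, ρ ≤ ‖z‖ →
          ‖D.errorMatrix n T N P0 P1 z - 1 - z⁻¹ • R₁‖ ≤ C / ‖z‖ ^ 2 := by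
  have : CompleteSpace Mat3 := FiniteDimensional.complete ℂ Mat3
  obtain ⟨C, ρ, n₀, hC, hρ, hn₀, hoff, h⟩ := exists_norm_error_sub_one_le hN M
  refine ⟨ρ * C + 2 * ρ ^ 2 * C, ρ + 1, n₀, by positivity, by positivity, hn₀, ?_⟩
  intro n hn T P0 P1 hT hP0 hP1
  have hn1 : (1 : ℝ) ≤ n := by exact_mod_cast hn₀.trans hn
  have key := h n hn T P0 P1 hT hP0 hP1
  have hlim : Tendsto (fun z => T z * (N z)⁻¹) (Bornology.cobounded ℂ) (𝓝 1) := by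
    have h1 := (tendsto_one_of_normalized hT.infinity).mul (tendsto_matrix_inv
        (tendsto_one_of_normalized hN.infinity) isUnit_one)
    rwa [inv_one, mul_one] at h1
  obtain ⟨R₁, hR₁, hR⟩ := exists_laurent_coefficient (F := fun z => T z * (N z)⁻¹) hρ
    (fun z hz => ((hT.analytic.differentiableAt D.isClosed_conductors.isOpen_compl
      (hoff z hz)).mul (hN.differentiableAt_inv (hoff z hz))).differentiableWithinAt)
    (fun z hz => (key z hz).2) hlim
  have hCn : C / n ≤ C := div_le_self hC.le hn1
  refine ⟨R₁, hR₁.trans ?_, fun z hz => ?_⟩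
  · rw [← mul_div_assoc]
    gcongr
    nlinarith [mul_pos hρ hC, mul_pos (pow_pos hρ 2) hC]
  · have hz' : ρ < ‖z‖ := by linarith
    rw [(key z hz').1]
    refine (hR z hz').trans ?_
    gcongr
    nlinarith [mul_pos hρ hC, mul_le_mul_of_nonneg_left hCn (by positivity : 0 ≤ 2 * ρ ^ 2)]

end Regime

end Conclusion

end TwoEdge

theorem corollary7p2 (D : TwoEdge.Regime) (N : ℂ → TwoEdge.Mat3) (hN : D.IsOuter N) (M : ℝ) :
    ∃ (C ρ : ℝ) (n₀ : ℕ), 0 < C ∧ 0 < ρ ∧ 1 ≤ n₀ ∧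
      ∀ n : ℕ, n₀ ≤ n → ∀ T P0 P1 : ℂ → TwoEdge.Mat3,
        D.IsT n T →
        D.IsLocal N n T M 0 D.r₀ P0 →
        D.IsLocal N n T M (D.x₀ : ℂ) D.r₁ P1 →
        ∃ R₁ : TwoEdge.Mat3,
          (∀ i j, ‖R₁ i j‖ ≤ C / n) ∧
          ∀ z : ℂ, ρ ≤ ‖z‖ → ∀ i j,
            ‖(D.errorMatrix n T N P0 P1 z - 1 - z⁻¹ • R₁) i j‖ ≤ C / ‖z‖ ^ 2 := by
  obtain ⟨C, ρ, n₀, hC, hρ, hn₀, h⟩ := TwoEdge.Regime.exists_expansion hN M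
  refine ⟨C, ρ, n₀, hC, hρ, hn₀, fun n hn T P0 P1 hT hP0 hP1 => ?_⟩
  obtain ⟨R₁, h1, h2⟩ := h n hn T P0 P1 hT hP0 hP1
  exact ⟨R₁, fun i j => (TwoEdge.norm_entry_le _ i j).trans h1,
    fun z hz i j => (TwoEdge.norm_entry_le _ i j).trans (h2 z hz)⟩
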